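/- Let $M$ be a smooth manifold of dimension $n=p+q\ge 3$ with a conformal structure of signature $(p,q)$, i.e. an equivalence class of smooth pseudo-Riemannian metrics of signature $(p,q)$, where metrics are equivalent iff they differ by a positive smooth factor. Let $\pi:\mathcal Q\to M$ be the ray subbundle of $S^2T^*M$ whose fibre over $x$ consists of the values $g_x$ of the metrics $g$ in the class, with the $\mathbb R_+$-action $\rho^s(g_x)=s^2g_x$, and let $\mathcal E[w]$ be the line bundle whose smooth sections are the smooth functions $f:\mathcal Q\to\mathbb R$ with $f\circ\rho^s=s^wf$. Let $\tilde M$ be an ambient manifold: a smooth $(n+2)$-manifold with a free smooth $\mathbb R_+$-action $\rho$ and an $\mathbb R_+$-equivariant smooth embedding $\mathcal Q\hookrightarrow\tilde M$ (suppressed in the notation). Let $\tilde h$ be an ambient metric: a pseudo-Riemannian metric of signature $(p+1,q+1)$ on $\tilde M$ with $(\rho^s)^*\tilde h=s^2\tilde h$ for all $s>0$ and $\tilde h(\xi,\eta)=u(T\pi\,\xi,T\pi\,\eta)$ for all $u\in\mathcal Q$ and $\xi,\eta\in T_u\mathcal Q$. Let $X$ be the infinitesimal generator of the action on $\tilde M$,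 let $\alpha=\tilde h(X,\cdot)$, and let $\mathcal T=(T\tilde M|_{\mathcal Q})/\mathbb R_+$ be the quotient by the action $s\cdot\xi=s^{-1}T\rho^s\xi$. This is a smooth vector bundle of rank $n+2$ over $M$, whose smooth sections correspond to the smooth ambient vector fields along $\mathcal Q$ which are homogeneous of degree $-1$. Write $[\xi]\in\mathcal T_{\pi(u)}$ for the class of $\xi\in T_u\tilde M$, $u\in\mathcal Q$. **Proposition.** 1. $\tilde h$ descends to a smooth bundle metric $h$ on $\mathcal T$ of signature $(p+1,q+1)$: $h([\xi],[\eta])=\tilde h(\xi,\eta)$ for $\xi,\eta\in T_u\tilde M$, $u\in\mathcal Q$. 2. The vertical bundle of $\mathcal Q\to M$ descends to a subbundle $\mathcal T^1\subset\mathcal T$, which is the image of the map $j:\mathcal E[-1]\to\mathcal T$, $j(f)(\pi(u))=[f(u)X(u)]$. 3. Suppose that $d\alpha$ vanishes at all points of $\mathcal Q$ (on all tangent vectors of $\tilde M$). Then the Levi-Civita connection $\tilde\nabla$ of $\tilde h$ descends to a linear connection $\nabla$ on $\mathcal T$: if the vector field $V$ on $\tilde M$ represents the section $\sigma$ of $\mathcal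 T$ along $\mathcal Q$ near $u\in\mathcal Q$, then $\nabla_{T\pi\,\xi}\,\sigma=[\tilde\nabla_\xi V]$ for all $\xi\in T_u\mathcal Q$. Moreover $(\mathcal T,h,j,\nabla)$ is a conformal standard tractor bundle for the given conformal structure, that is: * $\mathcal T$ has rank $n+2$ and $h$ has signature $(p+1,q+1)$; * $j$ is a smooth injective bundle map, and its image $\mathcal T^1$ is null for $h$, so that $\mathcal T\supset\mathcal T^0:=(\mathcal T^1)^\perp\supset\mathcal T^1$; * $\nabla$ is smooth and preserves $h$, and it is non-degenerate: for every $x\in M$ and $0\ne\xi\in T_xM$ there is a smooth section $\sigma$ of $\mathcal T^1$ with $(\nabla_\xi\sigma)(x)\notin\mathcal T^1_x$; * the conformal structure determined by these data is the given one: $h(\nabla_\xi j(f),\nabla_\eta j(f'))=f(u)\,f'(u)\,u(\xi,\eta)$ for all $u\in\mathcal Q$, $\xi,\eta\in T_{\pi(u)}M$ and smooth sections $f,f'$ of $\mathcal E[-1]$. Equivalently, under the isomorphism $TM[-1]:=TM\otimes\mathcal E[-1]\cong\mathcal T^0/\mathcal T^1$ induced by $\xi\otimes f\mapsto\nabla_\xi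 j(f)$, the metric which $h$ induces on $\mathcal T^0/\mathcal T^1$ is the one given by the conformal structure. -/

import Mathlib

open Bundle Manifold Function
open scoped Manifold ContDiff Topology Bundle

noncomputable section

namespace ConformalTractor

set_option linter.unusedSectionVars false
set_option linter.style.haveILetI false

section Transport

variable {B : Type*} [TopologicalSpace B] (F : Type*) [NormedAddCommGroup F] [NormedSpace ℝ F]
  {E₁ : B → Type*} [TopologicalSpace (TotalSpace F E₁)]
  [∀ b, TopologicalSpace (E₁ b)] [∀ b, AddCommMonoid (E₁ b)] [∀ b, Module ℝ (E₁ b)]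
  [FiberBundle F E₁]
  {E₂ : B → Type*} [∀ b, AddCommGroup (E₂ b)] [∀ b, Module ℝ (E₂ b)]
  (e : ∀ b, E₂ b ≃ₗ[ℝ] E₁ b)

/-- The map of total spaces given by fibrewise isomorphisms. -/
def transportEquiv : TotalSpace F E₂ ≃ TotalSpace F E₁ where
  toFun z := ⟨z.1, e z.1 z.2⟩
  invFun z := ⟨z.1, (e z.1).symm z.2⟩
  left_inv z := by simp
  right_inv z := by simp

/-- The vector space topology pulled back along an isomorphism. -/
abbrev transportFibreTopology (b : B) : TopologicalSpace (E₂ b) :=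
  TopologicalSpace.induced (e b) inferInstance

/-- The topology of a total space pulled back along fibrewise isomorphisms. -/
abbrev transportTopology : TopologicalSpace (TotalSpace F E₂) :=
  TopologicalSpace.induced (transportEquiv F e) inferInstance

/-- `transportEquiv` as a homeomorphism. -/
def transportHomeo : letI := transportTopology F e; TotalSpace F E₂ ≃ₜ TotalSpace F E₁ :=
  letI := transportTopology F e
  (transportEquiv F e).toHomeomorphOfIsInducing ⟨rfl⟩

/-- A local trivialisation pulled back along fibrewise isomorphisms. -/
def transportTriv (t : Trivialization F (π F E₁)) :
    letI := transportTopology F e; Trivialization F (π F E₂) :=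
  letI := transportTopology F e
  t.compHomeomorph (transportHomeo F e)

/-- The fibre bundle structure pulled back along fibrewise isomorphisms. -/
abbrev transportFiberBundle :
    letI := transportTopology F e; letI := transportFibreTopology e; FiberBundle F E₂ :=
  letI := transportTopology F e
  letI := transportFibreTopology e
  { totalSpaceMk_isInducing' := fun b ↦ by
      have h1 : Topology.IsInducing (transportEquiv F e) := ⟨rfl⟩
      have h2 : Topology.IsInducing (e b) := ⟨rfl⟩
      rw [← h1.of_comp_iff]
      exact (FiberBundle.totalSpaceMk_isInducing F E₁ b).comp h2
    trivializationAtlas' := transportTriv F e '' trivializationAtlas F E₁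
    trivializationAt' := fun b ↦ transportTriv F e (trivializationAt F E₁ b)
    mem_baseSet_trivializationAt' := fun b ↦ FiberBundle.mem_baseSet_trivializationAt' b
    trivialization_mem_atlas' := fun b ↦ ⟨_, FiberBundle.trivialization_mem_atlas' b, rfl⟩ }

theorem transport_isLinear (t : Trivialization F (π F E₁)) [t.IsLinear ℝ] :
    letI := transportTopology F e
    (transportTriv F e t).IsLinear ℝ :=
  letI := transportTopology F e
  ⟨fun b hb ↦
    ⟨fun x y ↦ by
        have h := (t.linear ℝ (b := b) hb).map_add (e b x) (e b y)
        rw [← map_add] at h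
        exact h,
      fun a x ↦ by
        have h := (t.linear ℝ (b := b) hb).map_smul a (e b x)
        rw [← map_smul] at h
        exact h⟩⟩

theorem transport_coordChangeL (t t' : Trivialization F (π F E₁)) [t.IsLinear ℝ] [t'.IsLinear ℝ]
    {b : B} (hb : b ∈ t.baseSet ∩ t'.baseSet) :
    letI := transportTopology F e
    letI := transportFibreTopology e
    letI := transportFiberBundle F e
    haveI := transport_isLinear F e t
    haveI := transport_isLinear F e t'
    ((transportTriv F e t).coordChangeL ℝ (transportTriv F e t') b : F →L[ℝ] F) =
      t.coordChangeL ℝ t' b := by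
  letI := transportTopology F e
  letI := transportFibreTopology e
  letI := transportFiberBundle F e
  haveI := transport_isLinear F e t
  haveI := transport_isLinear F e t'
  ext1 v
  change (transportTriv F e t).coordChangeL ℝ (transportTriv F e t') b v = t.coordChangeL ℝ t' b v
  rw [t.coordChangeL_apply' t' hb, (transportTriv F e t).coordChangeL_apply' _ hb]
  change (t' (transportHomeo F e ((transportHomeo F e).symm (t.toOpenPartialHomeomorph.symm _)))).2
    = _
  rw [Homeomorph.apply_symm_apply]

theorem transport_vectorBundle [VectorBundle ℝ F E₁] :
    letI := transportTopology F e
    letI := transportFibreTopology e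
    letI := transportFiberBundle F e
    VectorBundle ℝ F E₂ :=
  letI := transportTopology F e
  letI := transportFibreTopology e
  letI := transportFiberBundle F e
  { trivialization_linear' := by
      rintro _ ⟨t, ht, rfl⟩
      haveI : MemTrivializationAtlas t := ⟨ht⟩
      exact transport_isLinear F e t
    continuousOn_coordChange' := by
      rintro _ _ ⟨t, ht, rfl⟩ ⟨t', ht', rfl⟩
      haveI : MemTrivializationAtlas t := ⟨ht⟩
      haveI : MemTrivializationAtlas t' := ⟨ht'⟩
      exact (continuousOn_coordChange ℝ t t').congr fun b hb ↦ transport_coordChangeL F e t t' hb }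

theorem transport_contMDiffVectorBundle [VectorBundle ℝ F E₁]
    {EB : Type*} [NormedAddCommGroup EB] [NormedSpace ℝ EB]
    {HB : Type*} [TopologicalSpace HB] {IB : ModelWithCorners ℝ EB HB} [ChartedSpace HB B]
    [ContMDiffVectorBundle ∞ F E₁ IB] :
    letI := transportTopology F e
    letI := transportFibreTopology e
    letI := transportFiberBundle F e
    haveI := transport_vectorBundle F e
    ContMDiffVectorBundle ∞ F E₂ IB :=
  letI := transportTopology F e
  letI := transportFibreTopology e
  letI := transportFiberBundle F e
  haveI := transport_vectorBundle F e
  { contMDiffOn_coordChangeL := by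
      rintro _ _ ⟨t, ht, rfl⟩ ⟨t', ht', rfl⟩
      haveI : MemTrivializationAtlas t := ⟨ht⟩
      haveI : MemTrivializationAtlas t' := ⟨ht'⟩
      exact (contMDiffOn_coordChangeL (IB := IB) t t').congr
        fun b hb ↦ transport_coordChangeL F e t t' hb }

end Transport

/-- The multiplicative group `ℝ₊` of positive real numbers. -/
abbrev PosReal := {s : ℝ // 0 < s}

/-- The one-parameter subgroup `t ↦ eᵗ`, which identifies `ℝ` with `ℝ₊`. -/
def expPos (t : ℝ) : PosReal := ⟨Real.exp t, Real.exp_pos t⟩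

/-- The model space `ℝᵐ`. -/
abbrev Eu (m : ℕ) := EuclideanSpace ℝ (Fin m)

section BundleMetric

variable {EB : Type*} [NormedAddCommGroup EB] [NormedSpace ℝ EB]
  {HB : Type*} [TopologicalSpace HB] (IB : ModelWithCorners ℝ EB HB)
  {B : Type*} [TopologicalSpace B] [ChartedSpace HB B]
  (F : Type*) [NormedAddCommGroup F] [NormedSpace ℝ F]
  (V : B → Type*) [TopologicalSpace (TotalSpace F V)]
  [∀ b, TopologicalSpace (V b)] [∀ b, AddCommGroup (V b)] [∀ b, Module ℝ (V b)]
  [∀ b, IsTopologicalAddGroup (V b)] [∀ b, ContinuousSMul ℝ (V b)]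
  [FiberBundle F V] [VectorBundle ℝ F V]

/-- A smooth bundle metric (of any signature) on a real vector bundle: a smooth family of
non-degenerate symmetric bilinear forms on the fibres. -/
structure BundleMetric where
  /-- The bilinear form on the fibre over `b`. -/
  val (b : B) : V b →L[ℝ] V b →L[ℝ] ℝ
  symm (b : B) (v w : V b) : val b v w = val b w v
  nondegenerate (b : B) (v : V b) : (∀ w, val b v w = 0) → v = 0
  contMDiff : ContMDiff IB (IB.prod 𝓘(ℝ, F →L[ℝ] F →L[ℝ] ℝ)) ∞
    (fun b ↦ TotalSpace.mk' (F →L[ℝ] F →L[ℝ] ℝ) b (val b))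

variable {IB F V}

/-- The quadratic form `v ↦ g(v, v)` on the fibre over `b`. -/
def BundleMetric.quadraticForm (g : BundleMetric IB F V) (b : B) : QuadraticForm ℝ (V b) :=
  LinearMap.BilinMap.toQuadraticMap
    (LinearMap.mk₂ ℝ (fun v w ↦ g.val b v w) (by simp) (by simp) (by simp) (by simp))

/-- The bundle metric has signature `(p, q)`: `p` positive and `q` negative directions in every
fibre. -/
def BundleMetric.HasSignature (g : BundleMetric IB F V) (p q : ℕ) : Prop :=
  ∀ b, sigPos (g.quadraticForm b) = p ∧ sigNeg (g.quadraticForm b) = q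

theorem continuous_scaled_section {s : ∀ b, V b} {T : Type*} [TopologicalSpace T] {φ : T → ℝ}
    (hs : Continuous fun b ↦ TotalSpace.mk' F b (s b)) (hφ : Continuous φ) :
    Continuous fun y : B × T ↦ TotalSpace.mk' F y.1 (φ y.2 • s y.1) := by
  rw [continuous_iff_continuousAt]
  intro y
  rw [FiberBundle.continuousAt_totalSpace]
  refine ⟨continuous_fst.continuousAt, ?_⟩
  have hy : y.1 ∈ (trivializationAt F V y.1).baseSet :=
    FiberBundle.mem_baseSet_trivializationAt' y.1
  have h1 : ContinuousAt (fun z : B × T ↦ (trivializationAt F V y.1 ⟨z.1, s z.1⟩).2) y := by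
    have := hs.continuousAt (x := y.1)
    rw [FiberBundle.continuousAt_totalSpace] at this
    exact ContinuousAt.comp (f := Prod.fst) (x := y) this.2 continuous_fst.continuousAt
  have h2 : ContinuousAt (fun z : B × T ↦ φ z.2) y := (hφ.comp continuous_snd).continuousAt
  refine (h2.smul h1).congr ?_
  filter_upwards [((trivializationAt F V y.1).open_baseSet.preimage continuous_fst).mem_nhds hy]
    with z hz
  exact (((trivializationAt F V y.1).linear ℝ hz).map_smul _ _).symm

end BundleMetric

section Conformal

variable (n p q : ℕ) (M : Type*) [TopologicalSpace M] [ChartedSpace (Eu n) M]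
  [IsManifold (𝓡 n) ∞ M]

/-- Smooth pseudo-Riemannian metrics on an `n`-dimensional manifold. -/
abbrev PseudoMetric :=
  BundleMetric (𝓡 n) (Eu n) (TangentSpace (𝓡 n) : M → Type _)

/-- A conformal structure of signature `(p, q)`, `p + q = n ≥ 3`, on an `n`-manifold: an equivalence
class of smooth pseudo-Riemannian metrics of signature `(p, q)`, two metrics being equivalent if
and only if they differ by multiplication with a positive smooth function. -/
structure ConformalStructure where
  /-- The metrics in the conformal class. -/
  metrics : Set (PseudoMetric n M)
  three_le : 3 ≤ n
  add_eq : p + q = n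
  nonempty : metrics.Nonempty
  hasSignature : ∀ g ∈ metrics, g.HasSignature p q
  mem_iff : ∀ g ∈ metrics, ∀ g' : PseudoMetric n M, g' ∈ metrics ↔
    ∃ f : M → ℝ, ContMDiff (𝓡 n) 𝓘(ℝ, ℝ) ∞ f ∧ (∀ x, 0 < f x) ∧
      ∀ x ξ η, g'.val x ξ η = f x * g.val x ξ η

variable {n p q M}

/-- The total space of the bundle of bilinear forms on the tangent spaces of `M`. -/
abbrev FormBundle (n : ℕ) (M : Type*) [TopologicalSpace M] [ChartedSpace (Eu n) M] :=
  TotalSpace (Eu n →L[ℝ] Eu n →L[ℝ] ℝ)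
    (fun x : M ↦ TangentSpace (𝓡 n) x →L[ℝ] TangentSpace (𝓡 n) x →L[ℝ] ℝ)

/-- The ray bundle `𝒬 ⊂ S²T*M` of a conformal structure: its fibre at `x` consists of the values
`g_x` of all metrics `g` in the conformal class. It carries the subspace topology. -/
def RayBundle (c : ConformalStructure n p q M) : Type _ :=
  {u : FormBundle n M // ∃ g ∈ c.metrics, u.2 = g.val u.1}

namespace RayBundle

variable (c : ConformalStructure n p q M)

instance : TopologicalSpace (RayBundle c) := inferInstanceAs (TopologicalSpace {u : FormBundle n M //
  ∃ g ∈ c.metrics, u.2 = g.val u.1})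

variable {c}

/-- The projection `π : 𝒬 → M`. -/
def proj (u : RayBundle c) : M := u.1.1

/-- The inner product on `T_{π(u)} M` which the point `u` of `𝒬` is. -/
def form (u : RayBundle c) :
    TangentSpace (𝓡 n) u.proj →L[ℝ] TangentSpace (𝓡 n) u.proj →L[ℝ] ℝ := u.1.2

end RayBundle

namespace ConformalStructure

variable (c : ConformalStructure n p q M)

set_option synthInstance.maxHeartbeats 400000 in
/-- Rescaling a metric by a positive constant. -/
def _root_.ConformalTractor.BundleMetric.rescale (g : PseudoMetric n M) (a : PosReal) :
    PseudoMetric n M where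
  val x := (a : ℝ) • g.val x
  symm x v w := by simp [g.symm x v w]
  nondegenerate x v h := g.nondegenerate x v fun w ↦ by
    have := h w
    simpa [a.2.ne'] using this
  contMDiff := ContMDiff.const_smul_section g.contMDiff

variable {c} in
theorem rescale_mem {g : PseudoMetric n M} (hg : g ∈ c.metrics) (a : PosReal) :
    g.rescale a ∈ c.metrics :=
  (c.mem_iff g hg _).2 ⟨fun _ ↦ a, contMDiff_const, fun _ ↦ a.2, fun x ξ η ↦ by
    simp [BundleMetric.rescale]⟩

/-- A reference metric in the conformal class, chosen once and for all. -/
def ref : PseudoMetric n M := c.nonempty.some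

theorem ref_mem : c.ref ∈ c.metrics := c.nonempty.some_mem

variable {c}

theorem exists_ref_ne (x : M) : ∃ v, c.ref.val x v v ≠ 0 := by
  by_contra! H
  have h0 : ∀ v w, c.ref.val x v w = 0 := by
    intro v w
    have h1 := H (v + w)
    simp only [map_add, add_apply] at h1
    have h2 := H v
    have h3 := H w
    have h4 := c.ref.symm x v w
    linarith
  have hs : Subsingleton (Eu n) := ⟨fun a b ↦ by
    have ha := c.ref.nondegenerate x (a : TangentSpace (𝓡 n) x) (h0 _)
    have hb := c.ref.nondegenerate x (b : TangentSpace (𝓡 n) x) (h0 _)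
    exact ha.trans hb.symm⟩
  have : 0 < n := by have := c.three_le; omega
  have hfin : Module.finrank ℝ (Eu n) = 0 := Module.finrank_zero_of_subsingleton
  simp at hfin
  omega

theorem exists_exp (u : RayBundle c) :
    ∃ t : ℝ, u.form = Real.exp (2 * t) • c.ref.val u.proj := by
  obtain ⟨g, hg, hu⟩ := u.2
  obtain ⟨f, -, hf, hfg⟩ := (c.mem_iff _ c.ref_mem g).1 hg
  refine ⟨Real.log (f u.proj) / 2, ?_⟩
  rw [mul_div_cancel₀ _ two_ne_zero, Real.exp_log (hf _)]
  ext ξ η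
  have := hfg u.proj ξ η
  simp only [RayBundle.form, hu]
  simpa using! this

end ConformalStructure

namespace RayBundle

variable {c : ConformalStructure n p q M}

/-- The action `ρˢ(g_x) = s² g_x` of `ℝ₊` on `𝒬`. -/
instance : MulAction PosReal (RayBundle c) where
  smul s u := ⟨⟨u.proj, ((s : ℝ) ^ 2) • u.form⟩, by
    obtain ⟨g, hg, hu⟩ := u.2
    refine ⟨g.rescale (s ^ 2), ConformalStructure.rescale_mem hg _, ?_⟩
    simp only [BundleMetric.rescale, form, hu]
    rfl⟩
  one_smul u := by
    apply Subtype.ext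
    change (⟨u.proj, ((1 : ℝ) ^ 2) • u.form⟩ : FormBundle n M) = u.1
    rw [one_pow, one_smul]
    rfl
  mul_smul s t u := by
    apply Subtype.ext
    change (⟨u.proj, ((s * t : ℝ) ^ 2) • u.form⟩ : FormBundle n M)
      = ⟨u.proj, ((s : ℝ) ^ 2) • ((t : ℝ) ^ 2) • u.form⟩
    rw [mul_pow, mul_smul]

@[simp] theorem proj_smul (s : PosReal) (u : RayBundle c) : (s • u).proj = u.proj := rfl

theorem form_smul (s : PosReal) (u : RayBundle c) : (s • u).form = ((s : ℝ) ^ 2) • u.form := rfl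

/-- The point `e²ᵗ g_x` of `𝒬`, for the reference metric `g` and `t ∈ ℝ`. -/
def ofProd (c : ConformalStructure n p q M) (y : M × ℝ) : RayBundle c :=
  ⟨⟨y.1, Real.exp (2 * y.2) • c.ref.val y.1⟩,
    c.ref.rescale (expPos (2 * y.2)), ConformalStructure.rescale_mem c.ref_mem _, rfl⟩

/-- The number `t` with `u = e²ᵗ g_x`, for the reference metric `g`. -/
def logScale (u : RayBundle c) : ℝ := (ConformalStructure.exists_exp u).choose

theorem form_eq (u : RayBundle c) : u.form = Real.exp (2 * u.logScale) • c.ref.val u.proj :=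
  (ConformalStructure.exists_exp u).choose_spec

theorem continuous_proj : Continuous (proj : RayBundle c → M) :=
  (FiberBundle.continuous_proj (Eu n →L[ℝ] Eu n →L[ℝ] ℝ)
    (fun x : M ↦ TangentSpace (𝓡 n) x →L[ℝ] TangentSpace (𝓡 n) x →L[ℝ] ℝ)).comp
    continuous_subtype_val

theorem continuous_logScale : Continuous (logScale : RayBundle c → ℝ) := by
  rw [continuous_iff_continuousAt]
  intro u
  obtain ⟨v, hv⟩ := c.exists_ref_ne u.proj
  let V := FiberBundle.extend (Eu n) v
  have hV : ContinuousAt (fun x ↦ (TotalSpace.mk' (Eu n) x (V x) : TangentBundle (𝓡 n) M)) u.proj :=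
    (FiberBundle.contMDiffAt_extend (k := 0) (I := 𝓡 n) (Eu n) v).continuousAt
  have hV' : ContinuousAt (fun w : RayBundle c ↦
      (TotalSpace.mk' (Eu n) w.proj (V w.proj) : TangentBundle (𝓡 n) M)) u :=
    ContinuousAt.comp (f := proj) hV continuous_proj.continuousAt
  have h1 : ContinuousAt (fun w : RayBundle c ↦
      (TotalSpace.mk' (Eu n →L[ℝ] Eu n →L[ℝ] ℝ) w.proj w.form : FormBundle n M)) u :=
    continuous_subtype_val.continuousAt
  have h2 : ContinuousAt (fun w : RayBundle c ↦
      (TotalSpace.mk' (Eu n →L[ℝ] Eu n →L[ℝ] ℝ) w.proj (c.ref.val w.proj) : FormBundle n M)) u :=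
    (c.ref.contMDiff.continuous.comp continuous_proj).continuousAt
  have k1 := h1.clm_bundle_apply₂ (E₃ := Bundle.Trivial M ℝ) (F₃ := ℝ) hV' hV'
  have k2 := h2.clm_bundle_apply₂ (E₃ := Bundle.Trivial M ℝ) (F₃ := ℝ) hV' hV'
  have l1 : ContinuousAt (fun w : RayBundle c ↦ w.form (V w.proj) (V w.proj)) u :=
    ((Bundle.Trivial.homeomorphProd M ℝ).continuous.continuousAt.comp k1).snd
  have l2 : ContinuousAt (fun w : RayBundle c ↦ c.ref.val w.proj (V w.proj) (V w.proj)) u :=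
    ((Bundle.Trivial.homeomorphProd M ℝ).continuous.continuousAt.comp k2).snd
  have hVu : V u.proj = v := FiberBundle.extend_apply_self _ _
  have hne : c.ref.val u.proj (V u.proj) (V u.proj) ≠ 0 := by rwa [hVu]
  have l3 := ((l1.div l2 hne).log (by
    rw [Pi.div_apply, form_eq]
    simp [hne, Real.exp_ne_zero])).div_const 2
  refine l3.congr ?_
  filter_upwards [l2.eventually_ne hne] with w hw
  simp only [Pi.div_apply]
  rw [form_eq]
  simp [hw]

theorem continuous_ofProd : Continuous (ofProd c) := by
  refine Continuous.subtype_mk ?_ _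
  exact continuous_scaled_section c.ref.contMDiff.continuous (φ := fun t : ℝ ↦ Real.exp (2 * t))
    (by fun_prop)

/-- The global trivialisation `𝒬 ≅ M × ℝ`, `e²ᵗ g_x ↔ (x, t)`, given by the reference metric `g`. -/
def homeo (c : ConformalStructure n p q M) : RayBundle c ≃ₜ M × ℝ where
  toFun u := (u.proj, u.logScale)
  invFun := ofProd c
  left_inv u := by
    apply Subtype.ext
    change (⟨u.proj, Real.exp (2 * u.logScale) • c.ref.val u.proj⟩ : FormBundle n M) = u.1
    rw [← form_eq]
    rfl
  right_inv y := by
    refine Prod.ext rfl ?_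
    obtain ⟨v, hv⟩ := c.exists_ref_ne y.1
    have h := congr($(form_eq (ofProd c y)) v v)
    change Real.exp (2 * y.2) * c.ref.val y.1 v v
      = Real.exp (2 * (ofProd c y).logScale) * c.ref.val y.1 v v at h
    have := Real.exp_injective (mul_right_cancel₀ hv h)
    change (ofProd c y).logScale = y.2
    linarith
  continuous_toFun := continuous_proj.prodMk continuous_logScale
  continuous_invFun := continuous_ofProd

/-- The manifold structure of `𝒬`, for which `homeo` is a diffeomorphism. It does not depend on the
reference metric: passing to `f² g` changes the coordinate `t` by the smooth function `log f`. -/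
instance : ChartedSpace (ModelProd (Eu n) ℝ) (RayBundle c) where
  atlas := (fun e ↦ (homeo c).transOpenPartialHomeomorph e) ''
    atlas (ModelProd (Eu n) ℝ) (M × ℝ)
  chartAt u := (homeo c).transOpenPartialHomeomorph (chartAt _ (homeo c u))
  mem_chart_source u := by simp
  chart_mem_atlas u := ⟨_, chart_mem_atlas _ _, rfl⟩

/-- The model of the `(n+1)`-manifold `𝒬`. -/
abbrev model (n : ℕ) := (𝓡 n).prod 𝓘(ℝ, ℝ)

instance : IsManifold (model n) ∞ (RayBundle c) where
  compatible := by
    rintro _ _ ⟨e, he, rfl⟩ ⟨e', he', rfl⟩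
    have h := HasGroupoid.compatible (G := contDiffGroupoid ∞ (model n)) he he'
    have : ((homeo c).transOpenPartialHomeomorph e).symm.trans
        ((homeo c).transOpenPartialHomeomorph e') = e.symm.trans e' := by
      ext x <;> simp
    simpa only [this] using h

/-- The point of `𝒬` over `x` given by the reference metric. -/
def refPt (c : ConformalStructure n p q M) (x : M) : RayBundle c := ofProd c (x, 0)

end RayBundle

end Conformal

section Connections

variable {EB : Type*} [NormedAddCommGroup EB] [NormedSpace ℝ EB]
  {HB : Type*} [TopologicalSpace HB] {IB : ModelWithCorners ℝ EB HB}
  {B : Type*} [TopologicalSpace B] [ChartedSpace HB B]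

section Metric

variable {F : Type*} [NormedAddCommGroup F] [NormedSpace ℝ F]
  {V : B → Type*} [TopologicalSpace (TotalSpace F V)]
  [∀ b, TopologicalSpace (V b)] [∀ b, AddCommGroup (V b)] [∀ b, Module ℝ (V b)]
  [∀ b, IsTopologicalAddGroup (V b)] [∀ b, ContinuousSMul ℝ (V b)]
  [FiberBundle F V] [VectorBundle ℝ F V]

variable (IB F) in
/-- The section `σ` of a vector bundle is smooth. -/
def SmoothSection (σ : ∀ b, V b) : Prop :=
  ContMDiff IB (IB.prod 𝓘(ℝ, F)) ∞ (fun b ↦ TotalSpace.mk' F b (σ b))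

variable (IB F) in
/-- The section `σ` of a vector bundle is differentiable at the point `b`. -/
def DiffSectionAt (σ : ∀ b, V b) (b : B) : Prop :=
  MDifferentiableAt IB (IB.prod 𝓘(ℝ, F)) (fun b ↦ TotalSpace.mk' F b (σ b)) b

/-- The connection `D` preserves the bundle metric `h`:
`ξ · h(σ, τ) = h(D_ξ σ, τ) + h(σ, D_ξ τ)`. -/
def PreservesMetric (h : BundleMetric IB F V) (D : CovariantDerivative IB F V) : Prop :=
  ∀ (σ τ : ∀ b, V b) (b : B), DiffSectionAt IB F σ b → DiffSectionAt IB F τ b →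
    ∀ ξ : TangentSpace IB b, mvfderiv IB (fun y ↦ h.val y (σ y) (τ y)) b ξ =
      h.val b (D σ b ξ) (τ b) + h.val b (σ b) (D τ b ξ)

end Metric

variable [IsManifold IB ∞ B]

/-- `D` is the Levi-Civita connection of the pseudo-Riemannian metric `g`: it preserves `g` and is
torsion free, `D_V W - D_W V = [V, W]`. -/
structure IsLeviCivita (g : BundleMetric IB EB (TangentSpace IB : B → Type _))
    (D : CovariantDerivative IB EB (TangentSpace IB : B → Type _)) : Prop where
  preserves : PreservesMetric g D
  torsionFree : ∀ (V W : ∀ y : B, TangentSpace IB y) (y : B), 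
    DiffSectionAt IB EB V y → DiffSectionAt IB EB W y →
    D W y (V y) - D V y (W y) = VectorField.mlieBracket IB V W y

/-- The exterior derivative of a one-form, evaluated on two vector fields:
`dα(V, W) = V · α(W) - W · α(V) - α([V, W])`. -/
def extDerivOneForm (α : ∀ y : B, TangentSpace IB y →L[ℝ] ℝ) (V W : ∀ y : B, TangentSpace IB y)
    (y : B) : ℝ :=
  mvfderiv IB (fun z ↦ α z (W z)) y (V y) - mvfderiv IB (fun z ↦ α z (V z)) y (W y)
    - α y (VectorField.mlieBracket IB V W y)

end Connections

section Ambient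

open RayBundle

variable {n p q : ℕ} {M : Type*} [TopologicalSpace M] [ChartedSpace (Eu n) M]
  [IsManifold (𝓡 n) ∞ M]

/-- `homeo` is a diffeomorphism. -/
theorem RayBundle.contMDiff_ofProd (c : ConformalStructure n p q M) :
    ContMDiff (model n) (model n) ∞ (ofProd c) := by
  intro y
  rw [contMDiffAt_iff]
  refine ⟨continuous_ofProd.continuousAt, ?_⟩
  have h := (contMDiffAt_iff.1 (contMDiffAt_id (I := model n) (n := ∞) (x := y))).2
  have hy : homeo c (ofProd c y) = y := (homeo c).apply_symm_apply y
  convert h using 1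
  · ext z : 1
    change (extChartAt (model n) (homeo c (ofProd c y)))
      (homeo c (ofProd c ((extChartAt (model n) y).symm z))) = _
    rw [hy]
    exact congrArg (extChartAt (model n) y) ((homeo c).apply_symm_apply _)

theorem RayBundle.contMDiff_refPt (c : ConformalStructure n p q M) :
    ContMDiff (𝓡 n) (model n) ∞ (refPt c) :=
  (contMDiff_ofProd c).comp (contMDiff_id.prodMk contMDiff_const)

/-- Any two points of `𝒬` in the same fibre differ by the action of a positive number. -/
theorem RayBundle.exists_smul_eq {c : ConformalStructure n p q M} {u u' : RayBundle c}
    (h : u.proj = u'.proj) : ∃ s : PosReal, s • u = u' := by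
  refine ⟨expPos (u'.logScale - u.logScale), Subtype.ext ?_⟩
  obtain ⟨⟨x, b⟩, hu⟩ := u
  obtain ⟨⟨x', b'⟩, hu'⟩ := u'
  obtain rfl : x = x' := h
  set u : RayBundle c := ⟨⟨x, b⟩, hu⟩
  set u' : RayBundle c := ⟨⟨x, b'⟩, hu'⟩
  have h1 : b = Real.exp (2 * u.logScale) • c.ref.val x := form_eq u
  have h2 : b' = Real.exp (2 * u'.logScale) • c.ref.val x := form_eq u'
  change (⟨x, ((Real.exp (u'.logScale - u.logScale)) ^ 2) • b⟩ : FormBundle n M) = ⟨x, b'⟩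
  congr 1
  rw [h1, h2, smul_smul, ← Real.exp_nat_mul, ← Real.exp_add]
  congr 2
  push_cast
  ring

variable (c : ConformalStructure n p q M)
  (N : Type*) [TopologicalSpace N] [ChartedSpace (Eu (n + 2)) N] [MulAction PosReal N]

/-- An ambient manifold for a conformal structure with ray bundle `𝒬`: a smooth
`(n+2)`-manifold `N` endowed with a free smooth action of `ℝ₊` and an `ℝ₊`-equivariant smooth
embedding `ι : 𝒬 → N`. -/
structure AmbientManifold where
  /-- The embedding. -/
  ι : RayBundle c → N
  contMDiff_smul : ContMDiff (𝓘(ℝ, ℝ).prod (𝓡 (n + 2))) (𝓡 (n + 2)) ∞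
    (fun y : ℝ × N ↦ expPos y.1 • y.2)
  free : ∀ (s : PosReal) (y : N), s • y = y → s = 1
  isSmoothEmbedding : IsSmoothEmbedding (model n) (𝓡 (n + 2)) ∞ ι
  ι_smul : ∀ (s : PosReal) (u : RayBundle c), ι (s • u) = s • ι u

/-- The tangent map `Tρˢ : T_y N → T_{s y} N` of the dilation `ρˢ : N → N`. -/
def dilationDeriv {m : ℕ} {N : Type*} [TopologicalSpace N]
    [ChartedSpace (Eu m) N] [MulAction PosReal N] (s : PosReal) (y : N) :
    TangentSpace (𝓡 m) y →L[ℝ] TangentSpace (𝓡 m) (s • y) :=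
  mfderiv (𝓡 m) (𝓡 m) (fun z : N ↦ s • z) y

/-- `dilationDeriv` as a map on the model space `ℝᵐ`, which is every tangent space of `N`. -/
def dilationCoord {m : ℕ} {N : Type*} [TopologicalSpace N]
    [ChartedSpace (Eu m) N] [MulAction PosReal N] (s : PosReal) (y : N) : Eu m →L[ℝ] Eu m :=
  dilationDeriv s y

/-- The infinitesimal generator `X(y) = d/dt|₀ ρ^{exp t}(y)` of an action of `ℝ₊`. (The derivative
is a tangent vector at `ρ^{exp 0}(y) = y`.) -/
def generator {m : ℕ} {N : Type*} [TopologicalSpace N]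
    [ChartedSpace (Eu m) N] [MulAction PosReal N] (y : N) : TangentSpace (𝓡 m) y :=
  (mfderiv 𝓘(ℝ, ℝ) (𝓡 m) (fun t : ℝ ↦ expPos t • y) 0 (1 : ℝ) : Eu m)

namespace AmbientManifold

variable {c N} (A : AmbientManifold c N)

theorem contMDiff_ι : ContMDiff (model n) (𝓡 (n + 2)) ∞ A.ι := A.isSmoothEmbedding.contMDiff

theorem contMDiff_dilation (A : AmbientManifold c N) (s : PosReal) :
    ContMDiff (𝓡 (n + 2)) (𝓡 (n + 2)) ∞ (fun y : N ↦ s • y) := by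
  have h := A.contMDiff_smul.comp
    ((contMDiff_const (c := Real.log s)).prodMk (contMDiff_id (I := 𝓡 (n + 2)) (M := N)))
  have hs : expPos (Real.log s) = s := Subtype.ext (Real.exp_log s.2)
  simpa [comp_def, hs] using h

theorem dilationCoord_one (y : N) :
    dilationCoord (m := n + 2) 1 y = ContinuousLinearMap.id ℝ (Eu (n + 2)) := by
  have : (fun z : N ↦ (1 : PosReal) • z) = id := by ext z; simp
  change mfderiv (𝓡 (n + 2)) (𝓡 (n + 2)) (fun z : N ↦ (1 : PosReal) • z) y = _
  rw [this]
  exact mfderiv_id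

theorem dilationCoord_mul (A : AmbientManifold c N) (s t : PosReal) (y : N) :
    dilationCoord (m := n + 2) (s * t) y =
      (dilationCoord (m := n + 2) s (t • y)).comp (dilationCoord (m := n + 2) t y) := by
  have : (fun z : N ↦ (s * t) • z) = (fun z : N ↦ s • z) ∘ (fun z : N ↦ t • z) := by
    ext z; simp [mul_smul]
  change mfderiv (𝓡 (n + 2)) (𝓡 (n + 2)) (fun z : N ↦ (s * t) • z) y = _
  rw [this]
  exact mfderiv_comp _ ((A.contMDiff_dilation s).mdifferentiable (by simp) _)
    ((A.contMDiff_dilation t).mdifferentiable (by simp) _)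

/-- The map `ξ ↦ s⁻¹ Tρˢ ξ` from `T_{ι(u)} N` to `T_{s ι(u)} N = T_{ι(s u)} N`, by which `s ∈ ℝ₊`
acts on the restriction of `TN` to `𝒬`. -/
def scale (s : PosReal) (u : RayBundle c) :
    TangentSpace (𝓡 (n + 2)) (A.ι u) →L[ℝ] TangentSpace (𝓡 (n + 2)) (A.ι (s • u)) :=
  (s : ℝ)⁻¹ • dilationCoord (m := n + 2) s (A.ι u)

/-- The restriction `TN|_𝒬` of the tangent bundle of `N` to `𝒬`. -/
def RestrictedTangent : Type _ := Σ u : RayBundle c, TangentSpace (𝓡 (n + 2)) (A.ι u)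

variable {A} in
theorem restrictedTangent_ext {u u' : RayBundle c} {ξ : TangentSpace (𝓡 (n + 2)) (A.ι u)}
    {ξ' : TangentSpace (𝓡 (n + 2)) (A.ι u')} (h : u = u')
    (h' : (ξ : Eu (n + 2)) = (ξ' : Eu (n + 2))) :
    (⟨u, ξ⟩ : A.RestrictedTangent) = ⟨u', ξ'⟩ := by
  subst h
  exact congrArg (Sigma.mk u) h'

theorem scale_one (u : RayBundle c) (ξ : TangentSpace (𝓡 (n + 2)) (A.ι u)) :
    A.scale 1 u ξ = (ξ : Eu (n + 2)) := by
  change ((1 : ℝ)⁻¹ • dilationCoord (m := n + 2) 1 (A.ι u)) (ξ : Eu (n + 2)) = (ξ : Eu (n + 2))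
  rw [dilationCoord_one, inv_one, one_smul]
  rfl

theorem scale_mul (s t : PosReal) (u : RayBundle c) (ξ : TangentSpace (𝓡 (n + 2)) (A.ι u)) :
    (A.scale (s * t) u ξ : Eu (n + 2)) = A.scale s (t • u) (A.scale t u ξ) := by
  change ((s * t : ℝ)⁻¹ • dilationCoord (m := n + 2) (s * t) (A.ι u)) (ξ : Eu (n + 2)) =
    ((s : ℝ)⁻¹ • dilationCoord (m := n + 2) s (A.ι (t • u)))
      (((t : ℝ)⁻¹ • dilationCoord (m := n + 2) t (A.ι u)) (ξ : Eu (n + 2)))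
  rw [A.dilationCoord_mul, A.ι_smul]
  have key : ∀ (D D' : Eu (n + 2) →L[ℝ] Eu (n + 2)) (v : Eu (n + 2)) (a b : ℝ),
      ((a * b)⁻¹ • D.comp D') v = (a⁻¹ • D) ((b⁻¹ • D') v) := by
    intro D D' v a b
    rw [smul_apply, smul_apply,
      smul_apply, map_smul, smul_smul, mul_inv]
    rfl
  exact key _ _ _ _ _

/-- The action `s · ξ = s⁻¹ Tρˢ ξ` of `ℝ₊` on `TN|_𝒬`. -/
instance : MulAction PosReal A.RestrictedTangent where
  smul s z := ⟨s • z.1, A.scale s z.1 z.2⟩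
  one_smul z := restrictedTangent_ext (one_smul _ z.1) (A.scale_one z.1 z.2)
  mul_smul s t z := restrictedTangent_ext (mul_smul s t z.1) (A.scale_mul s t z.1 z.2)

/-- The orbit space `𝒯 = (TN|_𝒬)/ℝ₊`. -/
def TractorTotal : Type _ := MulAction.orbitRel.Quotient PosReal A.RestrictedTangent

/-- The projection of `𝒯` to `𝒬/ℝ₊ = M`. -/
def tractorProj : A.TractorTotal → M :=
  Quotient.lift (fun z ↦ z.1.proj) (by rintro _ z ⟨s, rfl⟩; rfl)

/-- The fibre of `𝒯` over `x ∈ M`. -/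
def Tractor (x : M) : Type _ := {z : A.TractorTotal // A.tractorProj z = x}

/-- The class in `𝒯` of the tangent vector `ξ ∈ T_{ι(u)} N`. -/
def toCls (u : RayBundle c) (ξ : TangentSpace (𝓡 (n + 2)) (A.ι u)) : A.Tractor u.proj :=
  ⟨Quotient.mk _ ⟨u, ξ⟩, rfl⟩

theorem toCls_scale (s : PosReal) (u : RayBundle c) (ξ : TangentSpace (𝓡 (n + 2)) (A.ι u)) :
    (A.toCls (s • u) (A.scale s u ξ) : A.Tractor u.proj) = A.toCls u ξ :=
  Subtype.ext (Quotient.sound ⟨s, rfl⟩)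

theorem toCls_injective (u : RayBundle c) : Injective (A.toCls u) := by
  intro ξ ξ' h
  obtain ⟨s, hs⟩ := Quotient.exact (congrArg Subtype.val h)
  let z : A.RestrictedTangent := ⟨u, ξ'⟩
  have hs' : s • z = ⟨u, ξ⟩ := hs
  have h1 : s • u = u := congrArg Sigma.fst hs'
  have h2 : s = 1 := A.free s (A.ι u) (by rw [← A.ι_smul, h1])
  rw [h2, one_smul] at hs'
  have := (Sigma.mk.inj_iff.1 hs').2
  exact (eq_of_heq this).symm

theorem toCls_surjective (u : RayBundle c) : Surjective (A.toCls u) := by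
  rintro ⟨z, hz⟩
  induction z using Quotient.inductionOn with
  | h z =>
    obtain ⟨u', ξ'⟩ := z
    obtain ⟨s, rfl⟩ := RayBundle.exists_smul_eq (show u'.proj = u.proj from hz)
    exact ⟨A.scale s u' ξ', A.toCls_scale s u' ξ'⟩

/-- The bijection `T_{ι(u)} N ≅ 𝒯_{π(u)}` for the point `u` given by the reference metric. -/
def refEquiv (x : M) : A.Tractor x ≃ TangentSpace (𝓡 (n + 2)) (A.ι (refPt c x)) :=
  (Equiv.ofBijective (A.toCls (refPt c x)) ⟨A.toCls_injective _, A.toCls_surjective _⟩).symm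

instance (x : M) : AddCommGroup (A.Tractor x) := (A.refEquiv x).addCommGroup

instance (x : M) : Module ℝ (A.Tractor x) := (A.refEquiv x).module ℝ

/-- `refEquiv` as a linear isomorphism. -/
def refLinearEquiv (x : M) : A.Tractor x ≃ₗ[ℝ] TangentSpace (𝓡 (n + 2)) (A.ι (refPt c x)) :=
  (A.refEquiv x).linearEquiv ℝ

theorem refLinearEquiv_toCls (u : RayBundle c) :
    ∃ L : TangentSpace (𝓡 (n + 2)) (A.ι u) →L[ℝ] TangentSpace (𝓡 (n + 2)) (A.ι (refPt c u.proj)),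
      ∀ ξ, A.refLinearEquiv u.proj (A.toCls u ξ) = L ξ := by
  obtain ⟨s, hs⟩ := RayBundle.exists_smul_eq (show u.proj = (refPt c u.proj).proj from rfl)
  let L : TangentSpace (𝓡 (n + 2)) (A.ι u) →L[ℝ]
    TangentSpace (𝓡 (n + 2)) (A.ι (refPt c u.proj)) := A.scale s u
  refine ⟨L, fun ξ ↦ ?_⟩
  have h : A.toCls u ξ = A.toCls (refPt c u.proj) (L ξ) := by
    refine Subtype.ext (Quotient.sound ?_)
    let z : A.RestrictedTangent := ⟨u, ξ⟩
    let z' : A.RestrictedTangent := ⟨refPt c u.proj, L ξ⟩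
    refine ⟨s⁻¹, (?_ : s⁻¹ • z' = z)⟩
    rw [inv_smul_eq_iff]
    exact (restrictedTangent_ext hs rfl).symm
  exact (congrArg (A.refLinearEquiv u.proj) h).trans <| Equiv.ofBijective_symm_apply_apply _
    ⟨A.toCls_injective _, A.toCls_surjective _⟩ _

/-- The linear isomorphism `T_{ι(u)} N ≅ 𝒯_{π(u)}`, `ξ ↦ [ξ]`, for `u ∈ 𝒬`. -/
def cls (u : RayBundle c) : TangentSpace (𝓡 (n + 2)) (A.ι u) ≃ₗ[ℝ] A.Tractor u.proj :=
  LinearEquiv.ofBijective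
    { toFun := A.toCls u
      map_add' := fun ξ η ↦ by
        obtain ⟨L, hL⟩ := A.refLinearEquiv_toCls u
        apply (A.refLinearEquiv u.proj).injective
        simp only [map_add, hL]
      map_smul' := fun a ξ ↦ by
        obtain ⟨L, hL⟩ := A.refLinearEquiv_toCls u
        apply (A.refLinearEquiv u.proj).injective
        rw [hL, RingHom.id_apply]
        exact (L.map_smul a ξ).trans
          ((congrArg (a • ·) (hL ξ).symm).trans ((A.refLinearEquiv u.proj).map_smul a _).symm) }
    ⟨A.toCls_injective _, A.toCls_surjective _⟩

/-- The smooth map `x ↦ ι(g_x)` for the reference metric `g`. -/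
def refMap : ContMDiffMap (𝓡 n) (𝓡 (n + 2)) M N ∞ :=
  ⟨fun x ↦ A.ι (refPt c x), A.contMDiff_ι.comp (contMDiff_refPt c)⟩

variable [IsManifold (𝓡 (n + 2)) ∞ N]

/-- The fibrewise identification of `𝒯` with the pullback of `TN` along `refMap`. -/
def refPullback (x : M) : A.Tractor x ≃ₗ[ℝ] (A.refMap *ᵖ (TangentSpace (𝓡 (n + 2)) : N → Type _)) x :=
  A.refLinearEquiv x

instance (x : M) : TopologicalSpace (A.Tractor x) :=
  TopologicalSpace.induced (A.refLinearEquiv x) inferInstance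

instance (x : M) : IsTopologicalAddGroup (A.Tractor x) :=
  topologicalAddGroup_induced (A.refLinearEquiv x).toAddMonoidHom

instance (x : M) : ContinuousSMul ℝ (A.Tractor x) :=
  continuousSMul_induced (A.refLinearEquiv x).toLinearMap

/-- The vector bundle structure of `𝒯 → M`. The reference metric is a section of `𝒬 → M`, hence
identifies `𝒯` with the pullback of `TN`; the result does not depend on the reference metric. -/
instance : TopologicalSpace (TotalSpace (Eu (n + 2)) A.Tractor) :=
  transportTopology (Eu (n + 2)) A.refPullback

instance : FiberBundle (Eu (n + 2)) A.Tractor := transportFiberBundle (Eu (n + 2)) A.refPullback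

instance : VectorBundle ℝ (Eu (n + 2)) A.Tractor := transport_vectorBundle (Eu (n + 2)) A.refPullback

instance : ContMDiffVectorBundle ∞ (Eu (n + 2)) A.Tractor (𝓡 n) :=
  transport_contMDiffVectorBundle (Eu (n + 2)) A.refPullback

variable (g : PseudoMetric (n + 2) N)

/-- An ambient metric: a pseudo-Riemannian metric of signature `(p+1, q+1)` on the ambient manifold
which is homogeneous of degree `2` and whose restriction to `𝒬` is the tautological
form `(ξ, η) ↦ u(Tπ ξ, Tπ η)` for `ξ, η ∈ T_u 𝒬`. -/
structure IsAmbientMetric : Prop where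
  hasSignature : g.HasSignature (p + 1) (q + 1)
  homogeneous : ∀ (s : PosReal) (y : N) (ξ η : TangentSpace (𝓡 (n + 2)) y),
    g.val (s • y) (dilationDeriv s y ξ) (dilationDeriv s y η) = (s : ℝ) ^ 2 * g.val y ξ η
  restrict : ∀ (u : RayBundle c) (ξ η : TangentSpace (model n) u),
    g.val (A.ι u) (mfderiv (model n) (𝓡 (n + 2)) A.ι u ξ) (mfderiv (model n) (𝓡 (n + 2)) A.ι u η) =
      u.form (mfderiv (model n) (𝓡 n) proj u ξ) (mfderiv (model n) (𝓡 n) proj u η)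

/-- The exterior derivative of the one-form `α` vanishes at all points of `𝒬` (on all tangent
vectors of the ambient manifold). -/
def ExtDerivVanishesAlong (α : ∀ y : N, TangentSpace (𝓡 (n + 2)) y →L[ℝ] ℝ) : Prop :=
  ∀ (u : RayBundle c) (V W : ∀ y : N, TangentSpace (𝓡 (n + 2)) y),
    SmoothSection (𝓡 (n + 2)) (Eu (n + 2)) V → SmoothSection (𝓡 (n + 2)) (Eu (n + 2)) W → extDerivOneForm α V W (A.ι u) = 0

/-- A connection `D` on `TN` descends to the connection `∇` on `𝒯`: if a vector field `V` on `N`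
represents the section `σ` of `𝒯` along `𝒬` near the point `u`, then `D_{ξ} V` represents
`∇_{Tπ ξ} σ` for all `ξ ∈ T_u 𝒬`. -/
def Descends (D : CovariantDerivative (𝓡 (n + 2)) (Eu (n + 2)) (TangentSpace (𝓡 (n + 2)) : N → Type _))
    (nabla : CovariantDerivative (𝓡 n) (Eu (n + 2)) A.Tractor) : Prop :=
  ∀ (u : RayBundle c) (V : ∀ y : N, TangentSpace (𝓡 (n + 2)) y) (σ : ∀ x : M, A.Tractor x),
    DiffSectionAt (𝓡 (n + 2)) (Eu (n + 2)) V (A.ι u) → DiffSectionAt (𝓡 n) (Eu (n + 2)) σ u.proj →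
    (∀ᶠ w : RayBundle c in 𝓝 u, A.cls w (V (A.ι w)) = σ w.proj) →
    ∀ ξ : TangentSpace (model n) u,
      A.cls u (D V (A.ι u) (mfderiv (model n) (𝓡 (n + 2)) A.ι u ξ)) =
        nabla σ u.proj (mfderiv (model n) (𝓡 n) proj u ξ)

end AmbientManifold
end Ambient

section StandardTractor

open RayBundle

variable {n p q : ℕ} {M : Type*} [TopologicalSpace M] [ChartedSpace (Eu n) M]
  [IsManifold (𝓡 n) ∞ M]

/-- The fibre at `x` of the density bundle `ℰ[w]`: functions `f` on the fibre of `𝒬` over `x` with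
`f(ρˢ u) = sʷ f(u)`. -/
def Density (c : ConformalStructure n p q M) (w : ℝ) (x : M) :
    Submodule ℝ ({u : RayBundle c // u.proj = x} → ℝ) where
  carrier := {f | ∀ (s : PosReal) (u : {u : RayBundle c // u.proj = x}),
    f ⟨s • u.1, u.2⟩ = (s : ℝ) ^ w * f u}
  add_mem' := fun {f f'} hf hf' s u ↦ by
    simp only [Pi.add_apply, mul_add]
    rw [← hf s u, ← hf' s u]
  zero_mem' := fun s u ↦ by simp
  smul_mem' := fun a f hf s u ↦ by
    simp only [Pi.smul_apply, smul_eq_mul]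
    rw [hf s u]
    ring

/-- The value of a density at a point of `𝒬`. -/
def Density.eval {c : ConformalStructure n p q M} {w : ℝ} (u : RayBundle c)
    (f : Density c w u.proj) : ℝ := f.1 ⟨u, rfl⟩

/-- A section of `ℰ[w]` is smooth if the corresponding homogeneous function on `𝒬` is. -/
def IsSmoothDensity {c : ConformalStructure n p q M} {w : ℝ} (f : ∀ x, Density c w x) : Prop :=
  ContMDiff (model n) 𝓘(ℝ, ℝ) ∞ (fun u : RayBundle c ↦ Density.eval u (f u.proj))

variable (c : ConformalStructure n p q M)
  {F : Type*} [NormedAddCommGroup F] [NormedSpace ℝ F]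
  {V : M → Type*} [TopologicalSpace (TotalSpace F V)]
  [∀ x, TopologicalSpace (V x)] [∀ x, AddCommGroup (V x)] [∀ x, Module ℝ (V x)]
  [∀ x, IsTopologicalAddGroup (V x)] [∀ x, ContinuousSMul ℝ (V x)]
  [FiberBundle F V] [VectorBundle ℝ F V] [ContMDiffVectorBundle ∞ F V (𝓡 n)]

/-- The vector bundle `V` with bundle metric `h`, filtration `V ⊃ (V¹)^⊥ ⊃ V¹` given by the image
`V¹` of the bundle map `j : ℰ[-1] → V`, and connection `nabla`, is a conformal standard tractor
bundle for the conformal structure `c`. -/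
structure IsStandardTractorBundle (h : BundleMetric (𝓡 n) F V)
    (j : ∀ x, Density c (-1) x →ₗ[ℝ] V x) (nabla : CovariantDerivative (𝓡 n) F V) : Prop where
  rank : Module.finrank ℝ F = n + 2
  hasSignature : h.HasSignature (p + 1) (q + 1)
  /-- `j` is a smooth bundle map which is injective and has null image. -/
  smooth_j : ∀ f : ∀ x, Density c (-1) x, IsSmoothDensity f → 
    SmoothSection (𝓡 n) F (fun x ↦ j x (f x))
  injective_j : ∀ x, Injective (j x)
  null : ∀ x f f', h.val x (j x f) (j x f') = 0
  /-- `nabla` is a smooth connection preserving `h`. -/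
  smooth : CovariantDerivative.ContMDiffCovariantDerivative nabla ∞
  preserves : PreservesMetric h nabla
  /-- `nabla` is non-degenerate. -/
  nondegenerate : ∀ (x : M) (ξ : TangentSpace (𝓡 n) x), ξ ≠ 0 → ∃ σ : ∀ y, V y,
    SmoothSection (𝓡 n) F σ ∧ (∀ y, σ y ∈ LinearMap.range (j y)) ∧ nabla σ x ξ ∉ LinearMap.range (j x)
  /-- The underlying conformal structure is `c`: under the isomorphism `TM[-1] ≅ (V¹)^⊥ / V¹`,
  `ξ ⊗ f ↦ ∇_ξ (j f)`, the metric which `h` induces on `(V¹)^⊥ / V¹` is the tautological section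
  of `S²T*M[2]`. -/
  conformal : ∀ f f' : ∀ x, Density c (-1) x, IsSmoothDensity f → IsSmoothDensity f' →
    ∀ (u : RayBundle c) (ξ η : TangentSpace (𝓡 n) u.proj),
      h.val u.proj (nabla (fun x ↦ j x (f x)) u.proj ξ) (nabla (fun x ↦ j x (f' x)) u.proj η) =
        Density.eval u (f u.proj) * Density.eval u (f' u.proj) * u.form ξ η

end StandardTractor

end ConformalTractor

end

open ConformalTractor

/-!
# The standard tractor bundle of an ambient metric

A reference metric in the conformal class is a section of `𝒬 → M`. Composed with the embedding of `𝒬`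
it gives a map `base : M → N`, and `𝒯` is the pullback of `TN` along `base`
(`AmbientManifold.isPullback`). Bundle metric and connection on `𝒯` are defined as the pullbacks of the
ambient metric and of its Levi-Civita connection, so that smoothness, the signature and the
compatibility of the two are inherited (`IsPullback.metric`, `IsPullback.connection`,
`IsPullback.preservesMetric`). What has to be shown is that these agree with the values obtained at an
arbitrary point of `𝒬`, which is `s` times a point of the reference section.

* For the metric this is homogeneity of degree two, against the factor `s⁻¹` in the action on `TN|_𝒬`
  (`IsAmbientMetric.tractorMetric_cls`).
* For the connection, the tangent map of `𝒬 → N` is the sum of a vertical part, a multiple of the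
  generator `X`, and of `Tρˢ` applied to a vector tangent to the reference section
  (`AmbientManifold.mfderiv_ι`). In the second direction the Koszul formula shows that `ρˢ`, being a
  homothety, preserves the Levi-Civita connection (`IsLeviCivita.mpullback_homothety`). In the first
  direction, homogeneity of the metric gives `ℒ_X g = 2 g`, which determines the symmetric part of `∇X`
  (`SmoothAction.val_add_val_generator`), while the skew part is `dα / 2 = 0`; hence `∇X = id` along
  `𝒬`. A field `V` of degree `-1` satisfies `[X, V] = -V`, so that
  `∇_X V = ∇_V X + [X, V] = 0` (`SmoothAction.covariantDerivative_eq_zero_of_homogeneous`), and the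
  vertical part does not contribute (`IsAmbientMetric.descends`).

Finally `j(f) = [f X]` and `∇X = id` give `∇_ξ j(f) = [f ξ + (ξ · f) X]`. Since `X` spans the
vertical bundle of `𝒬`, where the tautological form degenerates, it is null and orthogonal to `T𝒬`; the
inner product of two such derivatives is the value of the conformal metric, and the derivative lies in
the image of `j` only for `ξ = 0`, because `𝒬 → N` is an immersion
(`IsAmbientMetric.isStandardTractorBundle`).
-/

noncomputable section

namespace ConformalTractor

set_option linter.unusedSectionVars false

/-! ### Coordinates on vector bundles -/

section Coordinates

variable {EB : Type*} [NormedAddCommGroup EB] [NormedSpace ℝ EB]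
  {HB : Type*} [TopologicalSpace HB] {IB : ModelWithCorners ℝ EB HB}
  {B : Type*} [TopologicalSpace B] [ChartedSpace HB B]
  {EP : Type*} [NormedAddCommGroup EP] [NormedSpace ℝ EP]
  {HP : Type*} [TopologicalSpace HP] {IP : ModelWithCorners ℝ EP HP}
  {P : Type*} [TopologicalSpace P] [ChartedSpace HP P]
  (F : Type*) [NormedAddCommGroup F] [NormedSpace ℝ F]
  (V : B → Type*) [TopologicalSpace (TotalSpace F V)]
  [∀ b, TopologicalSpace (V b)] [∀ b, AddCommGroup (V b)] [∀ b, Module ℝ (V b)]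
  [∀ b, IsTopologicalAddGroup (V b)] [∀ b, ContinuousSMul ℝ (V b)]
  [FiberBundle F V] [VectorBundle ℝ F V]

/-- The open set on which the preferred trivialisation of `V` at `b₀` is defined. -/
abbrev triv (b₀ : B) : Set B := (trivializationAt F V b₀).baseSet

/-- The coordinate map `V_b → F` of the preferred trivialisation of `V` at `b₀` (zero for `b` outside
its domain). -/
def coord (b₀ b : B) : V b →L[ℝ] F := (trivializationAt F V b₀).continuousLinearMapAt ℝ b

/-- The inverse `F → V_b` of the coordinate map; for fixed `a : F`, `b ↦ frame F V b₀ b a` is the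
local section with constant coordinates `a` (zero outside the domain of the trivialisation). -/
def frame (b₀ b : B) : F →L[ℝ] V b := (trivializationAt F V b₀).symmL ℝ b

variable {F V}

theorem mem_triv (b : B) : b ∈ triv F V b := FiberBundle.mem_baseSet_trivializationAt' b

theorem triv_mem_nhds {b₀ b : B} (hb : b ∈ triv F V b₀) : triv F V b₀ ∈ 𝓝 b :=
  (trivializationAt F V b₀).open_baseSet.mem_nhds hb

@[simp] theorem coord_frame {b₀ b : B} (hb : b ∈ triv F V b₀) (a : F) :
    coord F V b₀ b (frame F V b₀ b a) = a :=
  (trivializationAt F V b₀).continuousLinearMapAt_symmL hb a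

@[simp] theorem frame_coord {b₀ b : B} (hb : b ∈ triv F V b₀) (v : V b) :
    frame F V b₀ b (coord F V b₀ b v) = v :=
  (trivializationAt F V b₀).symmL_continuousLinearMapAt hb v

theorem coord_eq {b₀ b : B} (hb : b ∈ triv F V b₀) (v : V b) :
    coord F V b₀ b v = (trivializationAt F V b₀ ⟨b, v⟩).2 := by
  simp only [coord, Trivialization.continuousLinearMapAt_apply]
  rw [Trivialization.coe_linearMapAt_of_mem _ hb]

variable {k : WithTop ℕ∞}

/-- A map to the total space of a vector bundle is smooth if and only if its base point and its
coordinates are. -/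
theorem contMDiffAt_totalSpace_iff_coord [ContMDiffVectorBundle k F V IB] {f : P → B}
    {σ : ∀ x, V (f x)} {x : P} {b₀ : B} (hx : f x ∈ triv F V b₀) :
    ContMDiffAt IP (IB.prod 𝓘(ℝ, F)) k (fun x ↦ TotalSpace.mk' F (f x) (σ x)) x ↔
      ContMDiffAt IP IB k f x ∧
      ContMDiffAt IP 𝓘(ℝ, F) k (fun x ↦ coord F V b₀ (f x) (σ x)) x := by
  rw [Trivialization.contMDiffAt_iff (e := trivializationAt F V b₀)
    ((trivializationAt F V b₀).mem_source.2 hx)]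
  refine and_congr_right fun h ↦ ⟨fun h' ↦ h'.congr_of_eventuallyEq ?_,
    fun h' ↦ h'.congr_of_eventuallyEq ?_⟩
  all_goals
    filter_upwards [h.continuousAt.preimage_mem_nhds (triv_mem_nhds hx)] with y hy
  · exact coord_eq hy _
  · exact (coord_eq hy _).symm

theorem mdifferentiableAt_totalSpace_iff_coord [ContMDiffVectorBundle 1 F V IB] {f : P → B}
    {σ : ∀ x, V (f x)} {x : P} {b₀ : B} (hx : f x ∈ triv F V b₀) :
    MDifferentiableAt IP (IB.prod 𝓘(ℝ, F)) (fun x ↦ TotalSpace.mk' F (f x) (σ x)) x ↔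
      MDifferentiableAt IP IB f x ∧
      MDifferentiableAt IP 𝓘(ℝ, F) (fun x ↦ coord F V b₀ (f x) (σ x)) x := by
  rw [Trivialization.mdifferentiableAt_totalSpace_iff IB (trivializationAt F V b₀)
    _ ((trivializationAt F V b₀).mem_source.2 hx)]
  refine and_congr_right fun h ↦ ⟨fun h' ↦ h'.congr_of_eventuallyEq ?_,
    fun h' ↦ h'.congr_of_eventuallyEq ?_⟩
  all_goals
    filter_upwards [h.continuousAt.preimage_mem_nhds (triv_mem_nhds hx)] with y hy
  · exact coord_eq hy _
  · exact (coord_eq hy _).symm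

theorem contMDiffAt_section_iff_coord [ContMDiffVectorBundle k F V IB]
    {σ : ∀ b, V b} {b b₀ : B} (hb : b ∈ triv F V b₀) :
    ContMDiffAt IB (IB.prod 𝓘(ℝ, F)) k (fun x ↦ TotalSpace.mk' F x (σ x)) b ↔
      ContMDiffAt IB 𝓘(ℝ, F) k (fun x ↦ coord F V b₀ x (σ x)) b := by
  rw [contMDiffAt_totalSpace_iff_coord (f := fun b ↦ b) hb]
  exact and_iff_right contMDiffAt_id

theorem diffSectionAt_iff_coord [ContMDiffVectorBundle 1 F V IB]
    {σ : ∀ b, V b} {b b₀ : B} (hb : b ∈ triv F V b₀) :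
    DiffSectionAt IB F σ b ↔
      MDifferentiableAt IB 𝓘(ℝ, F) (fun x ↦ coord F V b₀ x (σ x)) b := by
  rw [DiffSectionAt, mdifferentiableAt_totalSpace_iff_coord (f := fun b ↦ b) hb]
  exact and_iff_right mdifferentiableAt_id

theorem contMDiffAt_frame [ContMDiffVectorBundle k F V IB] {b b₀ : B} (hb : b ∈ triv F V b₀)
    (a : F) :
    ContMDiffAt IB (IB.prod 𝓘(ℝ, F)) k (fun x ↦ TotalSpace.mk' F x (frame F V b₀ x a)) b := by
  rw [contMDiffAt_section_iff_coord hb]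
  refine contMDiffAt_const (c := a) |>.congr_of_eventuallyEq ?_
  filter_upwards [triv_mem_nhds hb] with x hx
  exact coord_frame hx a

theorem diffSectionAt_frame [ContMDiffVectorBundle 1 F V IB] {b b₀ : B} (hb : b ∈ triv F V b₀)
    (a : F) : DiffSectionAt IB F (fun x ↦ frame F V b₀ x a) b :=
  (contMDiffAt_frame (k := 1) hb a).mdifferentiableAt one_ne_zero

section Hom

variable {G : Type*} [NormedAddCommGroup G] [NormedSpace ℝ G] [FiniteDimensional ℝ F]

/-- A family of linear maps on a finite-dimensional space is smooth if it is so pointwise. -/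
theorem contMDiffAt_clm_of_apply {A : P → F →L[ℝ] G} {x : P}
    (h : ∀ a, ContMDiffAt IP 𝓘(ℝ, G) k (fun y ↦ A y a) x) :
    ContMDiffAt IP 𝓘(ℝ, F →L[ℝ] G) k A x := by
  let b := Module.finBasis ℝ F
  have hA : A = fun y ↦ ∑ i, ContinuousLinearMap.smulRightL ℝ F G
      (LinearMap.toContinuousLinearMap (b.coord i)) (A y (b i)) := by
    funext y
    ext v
    conv_lhs => rw [← b.sum_repr v, map_sum]
    simp
  rw [hA]
  refine ContMDiffAt.sum fun i _ ↦ ?_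
  exact (ContinuousLinearMap.contMDiff _).contMDiffAt.comp x (h (b i))

variable {V₂ : B → Type*} [TopologicalSpace (TotalSpace G V₂)]
  [∀ b, TopologicalSpace (V₂ b)] [∀ b, AddCommGroup (V₂ b)] [∀ b, Module ℝ (V₂ b)]
  [∀ b, IsTopologicalAddGroup (V₂ b)] [∀ b, ContinuousSMul ℝ (V₂ b)]
  [FiberBundle G V₂] [VectorBundle ℝ G V₂]

/-- A family of linear maps between the fibres of two vector bundles is smooth if its values on the
local sections with constant coordinates are. -/
theorem contMDiffAt_hom_of_frame [ContMDiffVectorBundle k F V IB] [ContMDiffVectorBundle k G V₂ IB]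
    {A : ∀ b, V b →L[ℝ] V₂ b} {b : B}
    (h : ∀ a, ContMDiffAt IB (IB.prod 𝓘(ℝ, G)) k
      (fun x ↦ TotalSpace.mk' G x (A x (frame F V b x a))) b) :
    ContMDiffAt IB (IB.prod 𝓘(ℝ, F →L[ℝ] G)) k
      (fun x ↦ TotalSpace.mk' (F →L[ℝ] G) x (A x)) b := by
  rw [contMDiffAt_hom_bundle]
  refine ⟨contMDiffAt_id, contMDiffAt_clm_of_apply fun a ↦ ?_⟩
  exact (contMDiffAt_section_iff_coord (mem_triv b)).1 (h a)

theorem contMDiffAt_hom_real_of_frame [ContMDiffVectorBundle k F V IB]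
    {A : ∀ b, V b →L[ℝ] ℝ} {b : B}
    (h : ∀ a, ContMDiffAt IB 𝓘(ℝ, ℝ) k (fun x ↦ A x (frame F V b x a)) b) :
    ContMDiffAt IB (IB.prod 𝓘(ℝ, F →L[ℝ] ℝ)) k
      (fun x ↦ TotalSpace.mk' (F →L[ℝ] ℝ) x (A x)) b := by
  refine contMDiffAt_hom_of_frame (V₂ := Bundle.Trivial B ℝ) fun a ↦ ?_
  rw [contMDiffAt_section]
  exact h a

/-- A family of bilinear forms on the fibres of a vector bundle is smooth if its values on the local
sections with constant coordinates are. -/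
theorem contMDiffAt_bilin_of_frame [ContMDiffVectorBundle k F V IB]
    {A : ∀ b, V b →L[ℝ] V b →L[ℝ] ℝ} {b : B}
    (h : ∀ a a', ContMDiffAt IB 𝓘(ℝ, ℝ) k
      (fun x ↦ A x (frame F V b x a) (frame F V b x a')) b) :
    ContMDiffAt IB (IB.prod 𝓘(ℝ, F →L[ℝ] F →L[ℝ] ℝ)) k
      (fun x ↦ TotalSpace.mk' (F →L[ℝ] F →L[ℝ] ℝ) x (A x)) b :=
  contMDiffAt_hom_of_frame (V₂ := fun b ↦ V b →L[ℝ] ℝ) fun a ↦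
    contMDiffAt_hom_real_of_frame fun a' ↦ h a a'

end Hom

theorem BundleMetric.contMDiffAt_apply [ContMDiffVectorBundle ∞ F V IB] (g : BundleMetric IB F V)
    {σ τ : ∀ b, V b} {b : B}
    (hσ : ContMDiffAt IB (IB.prod 𝓘(ℝ, F)) ∞ (fun x ↦ TotalSpace.mk' F x (σ x)) b)
    (hτ : ContMDiffAt IB (IB.prod 𝓘(ℝ, F)) ∞ (fun x ↦ TotalSpace.mk' F x (τ x)) b) :
    ContMDiffAt IB 𝓘(ℝ, ℝ) ∞ (fun x ↦ g.val x (σ x) (τ x)) b := by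
  have := g.contMDiff.contMDiffAt.clm_bundle_apply₂ (E₃ := Bundle.Trivial B ℝ) (F₃ := ℝ) hσ hτ
  rwa [contMDiffAt_section] at this

theorem BundleMetric.mdifferentiableAt_apply (g : BundleMetric IB F V)
    {σ τ : ∀ b, V b} {b : B} (hσ : DiffSectionAt IB F σ b) (hτ : DiffSectionAt IB F τ b) :
    MDifferentiableAt IB 𝓘(ℝ, ℝ) (fun x ↦ g.val x (σ x) (τ x)) b := by
  have := (g.contMDiff.contMDiffAt.mdifferentiableAt (x := b)
    (by simp)).clm_bundle_apply₂ (E₃ := Bundle.Trivial B ℝ) (F₃ := ℝ) hσ hτ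
  rwa [mdifferentiableAt_section] at this

section Covariant

variable [FiniteDimensional ℝ F] [ContMDiffVectorBundle 1 F V IB]

/-- The expression of a connection in a trivialisation: it differs from the derivative of the
coordinates of a section by a term of order zero. -/
theorem covariantDerivative_eq (D : CovariantDerivative IB F V) {σ : ∀ b, V b} {b b₀ : B}
    (hb : b ∈ triv F V b₀) (hσ : DiffSectionAt IB F σ b) (ξ : TangentSpace IB b) :
    D σ b ξ = frame F V b₀ b (mvfderiv IB (fun x ↦ coord F V b₀ x (σ x)) b ξ) +
      D (fun x ↦ frame F V b₀ x (coord F V b₀ b (σ b))) b ξ := by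
  have hco : ∀ {τ : ∀ b, V b}, DiffSectionAt IB F τ b →
      MDifferentiableAt IB 𝓘(ℝ, F) (fun x ↦ coord F V b₀ x (τ x)) b :=
    fun hτ ↦ (diffSectionAt_iff_coord hb).1 hτ
  -- the difference of the two derivatives is tensorial, and can be compared on a constant section
  have hT : TensorialAt IB F (fun τ : ∀ b, V b ↦
      D τ b ξ - frame F V b₀ b (mvfderiv IB (fun x ↦ coord F V b₀ x (τ x)) b ξ)) b :=
    { smul := fun {f τ} hf hτ ↦ by
        have h1 : (fun x ↦ coord F V b₀ x ((f • τ) x)) =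
            fun x ↦ f x • coord F V b₀ x (τ x) := by funext x; simp
        rw [D.isCovariantDerivativeOn.leibniz hτ hf (Set.mem_univ _), h1,
          mvfderiv_fun_smul hf (hco hτ)]
        simp [frame_coord hb]
        module
      add := fun {τ τ'} hτ hτ' ↦ by
        have h1 : (fun x ↦ coord F V b₀ x ((τ + τ') x)) =
            fun x ↦ coord F V b₀ x (τ x) + coord F V b₀ x (τ' x) := by funext x; simp
        rw [D.isCovariantDerivativeOn.add hτ hτ' (Set.mem_univ _), h1,
          mvfderiv_fun_add (hco hτ) (hco hτ')]
        simp
        abel }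
  have h := hT.pointwise hσ (diffSectionAt_frame hb (coord F V b₀ b (σ b)))
    (frame_coord hb _).symm
  have h0 : mvfderiv IB (fun x ↦ coord F V b₀ x (frame F V b₀ x (coord F V b₀ b (σ b)))) b = 0 := by
    have : (fun x ↦ coord F V b₀ x (frame F V b₀ x (coord F V b₀ b (σ b)))) =ᶠ[𝓝 b]
        fun _ ↦ coord F V b₀ b (σ b) := by
      filter_upwards [triv_mem_nhds hb] with x hx
      exact coord_frame hx _
    rw [mvfderiv, this.mfderiv_eq]
    exact mvfderiv_const _
  simp only [h0, zero_apply, map_zero, sub_zero] at h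
  rw [← h]
  abel

end Covariant

end Coordinates

/-! ### Tangent maps of smooth families -/

section TangentMaps

variable {EM : Type*} [NormedAddCommGroup EM] [NormedSpace ℝ EM]
  {HM : Type*} [TopologicalSpace HM] {IM : ModelWithCorners ℝ EM HM}
  {M : Type*} [TopologicalSpace M] [ChartedSpace HM M] [IsManifold IM ∞ M]
  {EB : Type*} [NormedAddCommGroup EB] [NormedSpace ℝ EB]
  {HB : Type*} [TopologicalSpace HB] {IB : ModelWithCorners ℝ EB HB}
  {B : Type*} [TopologicalSpace B] [ChartedSpace HB B] [IsManifold IB ∞ B]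
  {EP : Type*} [NormedAddCommGroup EP] [NormedSpace ℝ EP]
  {HP : Type*} [TopologicalSpace HP] {IP : ModelWithCorners ℝ EP HP}
  {P : Type*} [TopologicalSpace P] [ChartedSpace HP P] [IsManifold IP ∞ P]
  {F : Type*} [NormedAddCommGroup F] [NormedSpace ℝ F]

/-- The tangent map of a smooth family of maps, applied to a smooth family of tangent vectors. -/
theorem contMDiffAt_mfderiv_apply {f : P → M → B} {γ : P → M} {v : ∀ x, TangentSpace IM (γ x)}
    {x₀ : P} (hf : ContMDiffAt (IP.prod IM) IB ∞ (uncurry f) (x₀, γ x₀))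
    (hv : ContMDiffAt IP (IM.prod 𝓘(ℝ, EM)) ∞
      (fun x ↦ (⟨γ x, v x⟩ : TangentBundle IM M)) x₀) :
    ContMDiffAt IP (IB.prod 𝓘(ℝ, EB)) ∞
      (fun x ↦ (⟨f x (γ x), mfderiv IM IB (f x) (γ x) (v x)⟩ : TangentBundle IB B)) x₀ := by
  have hγ : ContMDiffAt IP IM ∞ γ x₀ := (contMDiff_proj _).contMDiffAt.comp x₀ hv
  have hfγ : ContMDiffAt IP IB ∞ (fun x ↦ f x (γ x)) x₀ :=
    hf.comp x₀ (contMDiffAt_id.prodMk hγ)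
  have h := hf.mfderiv f γ hγ (m := ∞) le_rfl
  unfold inTangentCoordinates at h
  exact ContMDiffAt.clm_apply_of_inCoordinates (E₁ := TangentSpace IM) (E₂ := TangentSpace IB)
    (b₁ := γ) (b₂ := fun x ↦ f x (γ x)) (ϕ := fun x ↦ mfderiv IM IB (f x) (γ x)) h hv hfγ

theorem contMDiffAt_mvfderiv_apply {s : M → F} {v : ∀ x, TangentSpace IM x} {x₀ : M}
    (hs : ContMDiffAt IM 𝓘(ℝ, F) ∞ s x₀)
    (hv : ContMDiffAt IM (IM.prod 𝓘(ℝ, EM)) ∞ (fun x ↦ (⟨x, v x⟩ : TangentBundle IM M)) x₀) :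
    ContMDiffAt IM 𝓘(ℝ, F) ∞ (fun x ↦ mvfderiv IM s x (v x)) x₀ := by
  have h := contMDiffAt_mfderiv_apply (f := fun _ : M ↦ s) (γ := id) (v := v) (x₀ := x₀)
    (ContMDiffAt.comp (f := Prod.snd) (x₀, x₀) hs contMDiffAt_snd) hv
  exact (contMDiff_snd_tangentBundle_modelSpace F 𝓘(ℝ, F)).contMDiffAt.comp x₀ h

end TangentMaps

/-! ### Pullbacks of vector bundles, bundle metrics and connections -/

section Pullback

variable {EM : Type*} [NormedAddCommGroup EM] [NormedSpace ℝ EM]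
  {HM : Type*} [TopologicalSpace HM] {IM : ModelWithCorners ℝ EM HM}
  {M : Type*} [TopologicalSpace M] [ChartedSpace HM M]
  {EB : Type*} [NormedAddCommGroup EB] [NormedSpace ℝ EB]
  {HB : Type*} [TopologicalSpace HB] {IB : ModelWithCorners ℝ EB HB}
  {B : Type*} [TopologicalSpace B] [ChartedSpace HB B]
  {F : Type*} [NormedAddCommGroup F] [NormedSpace ℝ F]

theorem mvfderiv_comp_apply_of_mdifferentiableAt {s : B → F} {f : M → B} {x : M}
    (hs : MDifferentiableAt IB 𝓘(ℝ, F) s (f x)) (hf : MDifferentiableAt IM IB f x)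
    (ξ : TangentSpace IM x) :
    mvfderiv IM (s ∘ f) x ξ = mvfderiv IB s (f x) (mfderiv IM IB f x ξ) :=
  mfderiv_comp_apply x hs hf ξ

variable
  {V : B → Type*} [TopologicalSpace (TotalSpace F V)]
  [∀ b, TopologicalSpace (V b)] [∀ b, AddCommGroup (V b)] [∀ b, Module ℝ (V b)]
  [∀ b, IsTopologicalAddGroup (V b)] [∀ b, ContinuousSMul ℝ (V b)]
  [FiberBundle F V] [VectorBundle ℝ F V]
  {W : M → Type*} [TopologicalSpace (TotalSpace F W)]
  [∀ x, TopologicalSpace (W x)] [∀ x, AddCommGroup (W x)] [∀ x, Module ℝ (W x)]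
  [∀ x, IsTopologicalAddGroup (W x)] [∀ x, ContinuousSMul ℝ (W x)]
  [FiberBundle F W] [VectorBundle ℝ F W]

variable (F) in
/-- The fibrewise isomorphisms `e` identify the vector bundle `W` with the pullback of the vector
bundle `V` along `f`, in such a way that the preferred trivialisations correspond. -/
structure IsPullback (f : M → B) (e : ∀ x, W x ≃ₗ[ℝ] V (f x)) : Prop where
  mem_triv_iff (x x' : M) : x' ∈ triv F W x ↔ f x' ∈ triv F V (f x)
  coord_apply (x x' : M) (w : W x') : coord F V (f x) (f x') (e x' w) = coord F W x x' w

namespace IsPullback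

variable (F V W) in
/-- The isomorphism `W_x → V_{f(x)}` as a continuous linear map, by its expression in
coordinates. -/
def toCLM (f : M → B) (x : M) : W x →L[ℝ] V (f x) := (frame F V (f x) (f x)).comp (coord F W x x)

variable (F V W) in
/-- The isomorphism `V_{f(x)} → W_x` as a continuous linear map, by its expression in
coordinates. -/
def invCLM (f : M → B) (x : M) : V (f x) →L[ℝ] W x := (frame F W x x).comp (coord F V (f x) (f x))

variable (F V W) in
/-- The operator underlying the pullback connection. In the trivialisation at `x`, differentiate the
coordinates of the section and add the term of order zero of the given connection. -/
def connectionFun (f : M → B) (D : CovariantDerivative IB F V) (σ : ∀ x, W x) (x : M) :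
    TangentSpace IM x →L[ℝ] W x :=
  (frame F W x x).comp (mvfderiv IM (fun x' ↦ coord F W x x' (σ x')) x) +
    (invCLM F V W f x).comp
      ((D (fun b ↦ frame F V (f x) b (coord F W x x (σ x))) (f x)).comp (mfderiv IM IB f x))


variable {f : M → B} {e : ∀ x, W x ≃ₗ[ℝ] V (f x)} (he : IsPullback F f e)
include he

theorem apply_frame {x x' : M} (hx : x' ∈ triv F W x) (a : F) :
    e x' (frame F W x x' a) = frame F V (f x) (f x') a := by
  have hx' := (he.mem_triv_iff x x').1 hx
  rw [← frame_coord hx' (e x' (frame F W x x' a)), he.coord_apply, coord_frame hx]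

theorem toCLM_apply (x : M) (w : W x) : toCLM F V W f x w = e x w := by
  rw [toCLM, ContinuousLinearMap.comp_apply, ← he.coord_apply, frame_coord (mem_triv _)]

theorem invCLM_apply (x : M) (v : V (f x)) : invCLM F V W f x v = (e x).symm v := by
  obtain ⟨w, rfl⟩ := (e x).surjective v
  rw [invCLM, ContinuousLinearMap.comp_apply, he.coord_apply, frame_coord (mem_triv _),
    LinearEquiv.symm_apply_apply]

/-- A section of `W` is smooth if and only if the corresponding map to the total space of `V` is. -/
theorem contMDiffAt_section_iff {k : WithTop ℕ∞} [ContMDiffVectorBundle k F V IB]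
    [ContMDiffVectorBundle k F W IM] (hf : ContMDiff IM IB k f) {σ : ∀ x, W x} {x : M} :
    ContMDiffAt IM (IM.prod 𝓘(ℝ, F)) k (fun x ↦ TotalSpace.mk' F x (σ x)) x ↔
      ContMDiffAt IM (IB.prod 𝓘(ℝ, F)) k
        (fun x ↦ TotalSpace.mk' F (f x) (e x (σ x))) x := by
  rw [contMDiffAt_section_iff_coord (mem_triv x),
    contMDiffAt_totalSpace_iff_coord (mem_triv (f x)), and_iff_right hf.contMDiffAt]
  simp only [he.coord_apply]

variable [FiniteDimensional ℝ F] [ContMDiffVectorBundle ∞ F V IB] [ContMDiffVectorBundle ∞ F W IM]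

/-- The pullback of a bundle metric. -/
def metric (hf : ContMDiff IM IB ∞ f) (g : BundleMetric IB F V) : BundleMetric IM F W where
  val x := (ContinuousLinearMap.precomp ℝ (toCLM F V W f x)).comp
    ((g.val (f x)).comp (toCLM F V W f x))
  symm x v w := by simp [g.symm]
  nondegenerate x v h := by
    rw [← (e x).map_eq_zero_iff]
    refine g.nondegenerate _ _ fun w ↦ ?_
    obtain ⟨w, rfl⟩ := (e x).surjective w
    simpa [he.toCLM_apply] using h w
  contMDiff := by
    intro x
    refine contMDiffAt_bilin_of_frame fun a a' ↦ ?_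
    have h := (g.contMDiffAt_apply (contMDiffAt_frame (mem_triv (f x)) a)
      (contMDiffAt_frame (mem_triv (f x)) a')).comp x hf.contMDiffAt
    refine h.congr_of_eventuallyEq ?_
    filter_upwards [triv_mem_nhds (mem_triv (F := F) (V := W) x)] with x' hx'
    simp [he.toCLM_apply, he.apply_frame hx']

theorem metric_apply (hf : ContMDiff IM IB ∞ f) (g : BundleMetric IB F V) (x : M) (v w : W x) :
    (he.metric hf g).val x v w = g.val (f x) (e x v) (e x w) := by
  simp [metric, he.toCLM_apply]

theorem metric_hasSignature (hf : ContMDiff IM IB ∞ f) {g : BundleMetric IB F V} {p q : ℕ}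
    (hg : g.HasSignature p q) : (he.metric hf g).HasSignature p q := by
  intro x
  have h1 : QuadraticMap.Equivalent ((he.metric hf g).quadraticForm x) (g.quadraticForm (f x)) :=
    ⟨⟨e x, fun v ↦ (he.metric_apply hf g x v v).symm⟩⟩
  have h2 : QuadraticMap.Equivalent (-(he.metric hf g).quadraticForm x)
      (-g.quadraticForm (f x)) :=
    ⟨⟨e x, fun v ↦ congrArg Neg.neg (he.metric_apply hf g x v v).symm⟩⟩
  exact ⟨h1.sigPos_eq.trans (hg _).1, h2.sigPos_eq.trans (hg _).2⟩

section Connection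

/-- The pullback of a connection. -/
def connection (_he : IsPullback F f e) (D : CovariantDerivative IB F V) :
    CovariantDerivative IM F W where
  toFun := connectionFun F V W f D
  isCovariantDerivativeOnUniv :=
    { add := fun {σ τ x} hσ hτ _ ↦ by
        have hσ' := (diffSectionAt_iff_coord (mem_triv x)).1 hσ
        have hτ' := (diffSectionAt_iff_coord (mem_triv x)).1 hτ
        have h1 : (fun x' ↦ coord F W x x' ((σ + τ) x')) =
            fun x' ↦ coord F W x x' (σ x') + coord F W x x' (τ x') := by funext x'; simp
        have h2 : (fun b ↦ frame F V (f x) b (coord F W x x ((σ + τ) x))) =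
            (fun b ↦ frame F V (f x) b (coord F W x x (σ x))) +
              fun b ↦ frame F V (f x) b (coord F W x x (τ x)) := by funext b; simp
        ext ξ
        simp only [connectionFun]
        rw [h1, h2, mvfderiv_fun_add hσ' hτ', D.isCovariantDerivativeOn.add
          (diffSectionAt_frame (mem_triv (f x)) _) (diffSectionAt_frame (mem_triv (f x)) _)
          (Set.mem_univ _)]
        simp
        abel
      leibniz := fun {σ φ x} hσ hφ _ ↦ by
        have hσ' := (diffSectionAt_iff_coord (mem_triv x)).1 hσ
        have h1 : (fun x' ↦ coord F W x x' ((φ • σ) x')) =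
            fun x' ↦ φ x' • coord F W x x' (σ x') := by funext x'; simp
        have h2 : (fun b ↦ frame F V (f x) b (coord F W x x ((φ • σ) x))) =
            φ x • fun b ↦ frame F V (f x) b (coord F W x x (σ x)) := by funext b; simp
        ext ξ
        simp only [connectionFun]
        rw [h1, h2, mvfderiv_fun_smul hφ hσ', D.isCovariantDerivativeOn.smul_const _
          (diffSectionAt_frame (mem_triv (f x)) _) (Set.mem_univ _)]
        simp [frame_coord (mem_triv x)]
        abel }

theorem connection_eq (D : CovariantDerivative IB F V) (σ : ∀ x, W x) (x : M)
    (ξ : TangentSpace IM x) :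
    e x (he.connection D σ x ξ) =
      frame F V (f x) (f x) (mvfderiv IM (fun x' ↦ coord F W x x' (σ x')) x ξ) +
        D (fun b ↦ frame F V (f x) b (coord F W x x (σ x))) (f x) (mfderiv IM IB f x ξ) := by
  simp [connection, connectionFun, he.apply_frame (mem_triv x), he.invCLM_apply]

/-- If a section `τ` of `V` restricts to the section `σ` of `W`, then the pullback connection on `σ`
is given by the connection on `τ`. -/
theorem connection_apply (D : CovariantDerivative IB F V) {σ : ∀ x, W x} {τ : ∀ b, V b} {x : M}
    (hf : MDifferentiableAt IM IB f x) (hτ : DiffSectionAt IB F τ (f x))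
    (h : ∀ᶠ x' in 𝓝 x, e x' (σ x') = τ (f x')) (ξ : TangentSpace IM x) :
    e x (he.connection D σ x ξ) = D τ (f x) (mfderiv IM IB f x ξ) := by
  have h1 : (fun x' ↦ coord F W x x' (σ x')) =ᶠ[𝓝 x]
      (fun b ↦ coord F V (f x) b (τ b)) ∘ f := by
    filter_upwards [h] with x' hx'
    rw [comp_apply, ← hx', he.coord_apply]
  have h2 : mvfderiv IM (fun x' ↦ coord F W x x' (σ x')) x =
      mvfderiv IM ((fun b ↦ coord F V (f x) b (τ b)) ∘ f) x := by
    rw [mvfderiv, mvfderiv, h1.mfderiv_eq]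
    rfl
  rw [he.connection_eq, covariantDerivative_eq D (mem_triv (f x)) hτ, h2,
    mvfderiv_comp_apply_of_mdifferentiableAt ((diffSectionAt_iff_coord (mem_triv (f x))).1 hτ) hf,
    ← he.coord_apply, h.self_of_nhds]

/-- The pullback of a metric connection preserves the pullback metric. The failure to do so is tensorial
in both sections. -/
theorem preservesMetric (hf : ContMDiff IM IB ∞ f) {g : BundleMetric IB F V}
    {D : CovariantDerivative IB F V} (hD : PreservesMetric g D) :
    PreservesMetric (he.metric hf g) (he.connection D) := by
  intro σ τ x hσ hτ ξ
  set h : BundleMetric IM F W := he.metric hf g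
  set nabla : CovariantDerivative IM F W := he.connection D
  have hd : ∀ {σ τ : ∀ x, W x}, DiffSectionAt IM F σ x → DiffSectionAt IM F τ x →
      MDifferentiableAt IM 𝓘(ℝ, ℝ) (fun y ↦ h.val y (σ y) (τ y)) x :=
    fun hσ hτ ↦ h.mdifferentiableAt_apply hσ hτ
  let Φ : (∀ x, W x) → (∀ x, W x) → ℝ := fun σ τ ↦
    mvfderiv IM (fun y ↦ h.val y (σ y) (τ y)) x ξ -
      (h.val x (nabla σ x ξ) (τ x) + h.val x (σ x) (nabla τ x ξ))
  have hsymm : ∀ σ τ, Φ σ τ = Φ τ σ := fun σ τ ↦ by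
    have : (fun y ↦ h.val y (σ y) (τ y)) = fun y ↦ h.val y (τ y) (σ y) := by
      funext y; exact h.symm y _ _
    simp only [Φ]
    rw [this, h.symm x (nabla σ x ξ), h.symm x (σ x)]
    ring
  have hT : ∀ τ, DiffSectionAt IM F τ x → TensorialAt IM F (Φ · τ) x := fun τ hτ ↦
    { smul := fun {φ σ} hφ hσ ↦ by
        have h1 : (fun y ↦ h.val y ((φ • σ) y) (τ y)) =
            fun y ↦ φ y * h.val y (σ y) (τ y) := by funext y; simp
        simp only [Φ]
        rw [nabla.isCovariantDerivativeOn.leibniz hσ hφ (Set.mem_univ _), h1,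
          mvfderiv_fun_mul hφ (hd hσ hτ)]
        simp
        ring
      add := fun {σ σ'} hσ hσ' ↦ by
        have h1 : (fun y ↦ h.val y ((σ + σ') y) (τ y)) =
            fun y ↦ h.val y (σ y) (τ y) + h.val y (σ' y) (τ y) := by funext y; simp
        simp only [Φ]
        rw [nabla.isCovariantDerivativeOn.add hσ hσ' (Set.mem_univ _), h1,
          mvfderiv_fun_add (hd hσ hτ) (hd hσ' hτ)]
        simp
        ring }
  -- it suffices to treat sections with constant coordinates, which are restrictions from `B`
  let ε : F → ∀ x', W x' := fun a x' ↦ frame F W x x' a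
  let ε' : F → ∀ b, V b := fun a b ↦ frame F V (f x) b a
  have hε : ∀ a, DiffSectionAt IM F (ε a) x := fun a ↦ diffSectionAt_frame (mem_triv x) a
  have hε' : ∀ a, DiffSectionAt IB F (ε' a) (f x) :=
    fun a ↦ diffSectionAt_frame (mem_triv (f x)) a
  have hεε' : ∀ a, ∀ᶠ x' in 𝓝 x, e x' (ε a x') = ε' a (f x') := fun a ↦ by
    filter_upwards [triv_mem_nhds (mem_triv (F := F) (V := W) x)] with x' hx'
    exact he.apply_frame hx' a
  have key : Φ σ τ = Φ (ε (coord F W x x (σ x))) (ε (coord F W x x (τ x))) :=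
    TensorialAt.pointwise₂ hT (fun σ hσ ↦ by simpa only [hsymm] using hT σ hσ) hσ (hε _) hτ (hε _)
      (frame_coord (mem_triv x) _).symm (frame_coord (mem_triv x) _).symm
  have hfx := hf.contMDiffAt.mdifferentiableAt (x := x) (by simp)
  have h0 : ∀ a a', Φ (ε a) (ε a') = 0 := fun a a' ↦ by
    have h1 : (fun y ↦ h.val y (ε a y) (ε a' y)) =ᶠ[𝓝 x]
        (fun b ↦ g.val b (ε' a b) (ε' a' b)) ∘ f := by
      filter_upwards [hεε' a, hεε' a'] with y hy hy'
      rw [comp_apply, ← hy, ← hy', he.metric_apply]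
    have h2 : mvfderiv IM (fun y ↦ h.val y (ε a y) (ε a' y)) x =
        mvfderiv IM ((fun b ↦ g.val b (ε' a b) (ε' a' b)) ∘ f) x := by
      rw [mvfderiv, mvfderiv, h1.mfderiv_eq]
      rfl
    simp only [Φ]
    rw [h2, mvfderiv_comp_apply_of_mdifferentiableAt (g.mdifferentiableAt_apply (hε' a) (hε' a')) hfx,
      hD _ _ _ (hε' a) (hε' a'), he.metric_apply, he.metric_apply,
      he.connection_apply D hfx (hε' a) (hεε' a), he.connection_apply D hfx (hε' a') (hεε' a'),
      (hεε' a).self_of_nhds, (hεε' a').self_of_nhds, sub_self]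
  rw [h0] at key
  simp only [Φ] at key
  linarith

variable [IsManifold IM ∞ M] [IsManifold IB ∞ B] [FiniteDimensional ℝ EM]

/-- The pullback of a smooth connection is smooth. Smoothness of the given connection enters through its
values on the local sections with constant coordinates. -/
theorem contMDiff_connection (hf : ContMDiff IM IB ∞ f) {D : CovariantDerivative IB F V}
    (hD : ∀ (b₀ : B) (a : F), ContMDiffAt IB (IB.prod 𝓘(ℝ, EB →L[ℝ] F)) ∞
      (fun b ↦ TotalSpace.mk' (EB →L[ℝ] F) (E := fun b ↦ TangentSpace IB b →L[ℝ] V b) b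
        (D (fun b ↦ frame F V b₀ b a) b)) b₀) :
    CovariantDerivative.ContMDiffCovariantDerivative (he.connection D : CovariantDerivative IM F W) ∞ where
  contMDiff := ⟨by
    intro σ hσ x _
    refine ContMDiffAt.contMDiffWithinAt ?_
    have hσ' : ContMDiff IM (IM.prod 𝓘(ℝ, F)) ∞ (fun x ↦ TotalSpace.mk' F x (σ x)) :=
      contMDiffOn_univ.1 hσ
    refine contMDiffAt_hom_of_frame fun ζ ↦ ?_
    rw [contMDiffAt_section_iff_coord (mem_triv x)]
    let s : M → F := fun x' ↦ coord F W x x' (σ x')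
    let v : ∀ x' : M, TangentSpace IM x' := fun x' ↦ frame EM (TangentSpace IM) x x' ζ
    have hs : ContMDiffAt IM 𝓘(ℝ, F) ∞ s x :=
      (contMDiffAt_section_iff_coord (mem_triv x)).1 hσ'.contMDiffAt
    have hv : ContMDiffAt IM (IM.prod 𝓘(ℝ, EM)) ∞ (fun x ↦ (⟨x, v x⟩ : TangentBundle IM M)) x :=
      contMDiffAt_frame (mem_triv x) ζ
    have hfv : ContMDiffAt IM (IB.prod 𝓘(ℝ, EB)) ∞
        (fun x ↦ (⟨f x, mfderiv IM IB f x (v x)⟩ : TangentBundle IB B)) x :=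
      contMDiffAt_mfderiv_apply (f := fun _ : M ↦ f) (γ := id)
        ((hf.comp contMDiff_snd).contMDiffAt) hv
    let b := Module.finBasis ℝ F
    let Γ : F → M → F := fun a x' ↦ coord F V (f x) (f x')
      (D (fun b ↦ frame F V (f x) b a) (f x') (mfderiv IM IB f x' (v x')))
    have hΓ : ∀ a, ContMDiffAt IM 𝓘(ℝ, F) ∞ (Γ a) x := fun a ↦ by
      have h := ((hD (f x) a).comp x hf.contMDiffAt).clm_bundle_apply hfv
      exact ((contMDiffAt_totalSpace_iff_coord (mem_triv (f x))).1 h).2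
    have hmain : ContMDiffAt IM 𝓘(ℝ, F) ∞
        (fun x' ↦ mvfderiv IM s x' (v x') + ∑ i, b.repr (s x') i • Γ (b i) x') x := by
      refine (contMDiffAt_mvfderiv_apply hs hv).add (ContMDiffAt.sum fun i _ ↦ ?_)
      have hr : ContMDiffAt IM 𝓘(ℝ, ℝ) ∞ (fun x' ↦ b.repr (s x') i) x :=
        (ContinuousLinearMap.contMDiff
          (LinearMap.toContinuousLinearMap (b.coord i))).contMDiffAt.comp x hs
      exact hr.smul (hΓ (b i))
    refine hmain.congr_of_eventuallyEq ?_
    filter_upwards [triv_mem_nhds (mem_triv (F := F) (V := W) x)] with x' hx'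
    have hfx' := (he.mem_triv_iff x x').1 hx'
    have hlin : coord F V (f x) (f x') (D (fun b ↦ frame F V (f x) b (s x')) (f x')
        (mfderiv IM IB f x' (v x'))) = ∑ i, b.repr (s x') i • Γ (b i) x' := by
      let T : F →ₗ[ℝ] F :=
        { toFun := fun a ↦ Γ a x'
          map_add' := fun a a' ↦ by
            have h2 : (fun b ↦ frame F V (f x) b (a + a')) =
              (fun b ↦ frame F V (f x) b a) + fun b ↦ frame F V (f x) b a' := by funext b; simp
            simp only [Γ]
            rw [h2, D.isCovariantDerivativeOn.add (diffSectionAt_frame hfx' a)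
              (diffSectionAt_frame hfx' a') (Set.mem_univ _)]
            simp
          map_smul' := fun r a ↦ by
            have h2 : (fun b ↦ frame F V (f x) b (r • a)) =
              r • fun b ↦ frame F V (f x) b a := by funext b; simp
            simp only [Γ]
            rw [h2, D.isCovariantDerivativeOn.smul_const r (diffSectionAt_frame hfx' a)
              (Set.mem_univ _)]
            simp }
      change T (s x') = ∑ i, b.repr (s x') i • T (b i)
      conv_lhs => rw [← b.sum_repr (s x'), map_sum]
      simp
    have hσx' : DiffSectionAt IM F σ x' := hσ'.contMDiffAt.mdifferentiableAt (by simp)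
    rw [← hlin, covariantDerivative_eq (he.connection D) hx' hσx', map_add, coord_frame hx']
    congr 1
    rw [← he.coord_apply, he.connection_apply D (hf.contMDiffAt.mdifferentiableAt (by simp))
      (diffSectionAt_frame hfx' (s x'))]
    filter_upwards [triv_mem_nhds hx'] with y hy
    exact he.apply_frame hy _⟩

end Connection

end IsPullback

end Pullback

/-! ### The Levi-Civita connection in coordinates and under homotheties -/

section LeviCivita

variable {E : Type*} [NormedAddCommGroup E] [NormedSpace ℝ E]
  {B : Type*} [TopologicalSpace B] [ChartedSpace E B] [IsManifold 𝓘(ℝ, E) ∞ B]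

/-- The coordinate vector field of the preferred chart at `y₀` in the direction `a`
(zero outside the domain of the chart). -/
abbrev coordField (y₀ : B) (a : E) (y : B) : TangentSpace 𝓘(ℝ, E) y :=
  frame E (TangentSpace 𝓘(ℝ, E)) y₀ y a

theorem coord_tangentSpace {y₀ y : B} (hy : y ∈ triv E (TangentSpace 𝓘(ℝ, E)) y₀) :
    coord E (TangentSpace 𝓘(ℝ, E)) y₀ y = mfderiv 𝓘(ℝ, E) 𝓘(ℝ, E) (extChartAt 𝓘(ℝ, E) y₀) y :=
  TangentBundle.continuousLinearMapAt_trivializationAt hy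

/-- The constant vector field on a vector space. -/
abbrev constField (a : E) (z : E) : TangentSpace 𝓘(ℝ, E) z := a

theorem coordField_eq_mpullback {y₀ y : B} (hy : y ∈ triv E (TangentSpace 𝓘(ℝ, E)) y₀) (a : E) :
    coordField y₀ a y =
      VectorField.mpullback 𝓘(ℝ, E) 𝓘(ℝ, E) (extChartAt 𝓘(ℝ, E) y₀) (constField a) y := by
  rw [VectorField.mpullback_apply, ← coord_tangentSpace hy]
  have h : (coord E (TangentSpace 𝓘(ℝ, E)) y₀ y).inverse =
      frame E (TangentSpace 𝓘(ℝ, E)) y₀ y := by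
    refine ContinuousLinearMap.inverse_eq ?_ ?_
    · ext a; exact coord_frame hy a
    · ext v; exact frame_coord hy v
  exact congr($h a).symm

theorem two_le_infty : (2 : WithTop ℕ∞) ≤ ∞ :=
  WithTop.coe_le_coe.2 (le_top : (2 : ℕ∞) ≤ ⊤)

theorem minSmoothness_le_infty : minSmoothness ℝ 2 ≤ ∞ := by
  simpa using two_le_infty

variable (E B) in
theorem isManifold_minSmoothness : IsManifold 𝓘(ℝ, E) (minSmoothness ℝ 2) B :=
  IsManifold.of_le minSmoothness_le_infty

theorem mlieBracket_coordField [CompleteSpace E] {y₀ y : B}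
    (hy : y ∈ triv E (TangentSpace 𝓘(ℝ, E)) y₀) (a b : E) :
    VectorField.mlieBracket 𝓘(ℝ, E) (coordField y₀ a) (coordField y₀ b) y = 0 := by
  have := isManifold_minSmoothness E B
  have := isManifold_minSmoothness E E
  have h : ∀ a : E, coordField y₀ a =ᶠ[𝓝 y]
      VectorField.mpullback 𝓘(ℝ, E) 𝓘(ℝ, E) (extChartAt 𝓘(ℝ, E) y₀) (constField a) := fun a ↦ by
    filter_upwards [triv_mem_nhds hy] with x hx using coordField_eq_mpullback hx a
  have hc : ∀ a : E, MDifferentiableAt 𝓘(ℝ, E) (𝓘(ℝ, E).prod 𝓘(ℝ, E))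
      (fun z : E ↦ (⟨z, constField a z⟩ : TangentBundle 𝓘(ℝ, E) E)) (extChartAt 𝓘(ℝ, E) y₀ y) := fun a ↦ by
    refine (ContMDiffAt.mdifferentiableAt (n := ∞) ?_ (by simp))
    exact contMDiffAt_vectorSpace_iff_contDiffAt.2 contDiffAt_const
  rw [Filter.EventuallyEq.mlieBracket_vectorField_eq (h a) (h b),
    ← VectorField.mpullback_mlieBracket (n := ∞) (hc a) (hc b)
      (contMDiffAt_extChartAt' (by simpa using hy)) minSmoothness_le_infty]
  have h0 : VectorField.mlieBracket 𝓘(ℝ, E) (constField a) (constField b)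
      (extChartAt 𝓘(ℝ, E) y₀ y) = 0 := by
    rw [← VectorField.mlieBracketWithin_univ, VectorField.mlieBracketWithin_eq_lieBracketWithin,
      VectorField.lieBracketWithin]
    simp
    rfl
  rw [VectorField.mpullback_apply]
  exact (congrArg _ h0).trans (map_zero _)

variable [FiniteDimensional ℝ E] {g : BundleMetric 𝓘(ℝ, E) E (TangentSpace 𝓘(ℝ, E) : B → Type _)}
  {D : CovariantDerivative 𝓘(ℝ, E) E (TangentSpace 𝓘(ℝ, E) : B → Type _)}

/-- The Koszul formula for commuting vector fields. -/
theorem IsLeviCivita.koszul (hD : IsLeviCivita g D) {U V W : ∀ y : B, TangentSpace 𝓘(ℝ, E) y}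
    {y : B} (hU : DiffSectionAt 𝓘(ℝ, E) E U y) (hV : DiffSectionAt 𝓘(ℝ, E) E V y)
    (hW : DiffSectionAt 𝓘(ℝ, E) E W y) (hUV : VectorField.mlieBracket 𝓘(ℝ, E) U V y = 0)
    (hUW : VectorField.mlieBracket 𝓘(ℝ, E) U W y = 0)
    (hVW : VectorField.mlieBracket 𝓘(ℝ, E) V W y = 0) :
    g.val y (D V y (U y)) (W y) =
      (mvfderiv 𝓘(ℝ, E) (fun z ↦ g.val z (V z) (W z)) y (U y) +
        mvfderiv 𝓘(ℝ, E) (fun z ↦ g.val z (U z) (W z)) y (V y) -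
        mvfderiv 𝓘(ℝ, E) (fun z ↦ g.val z (U z) (V z)) y (W y)) / 2 := by
  have t1 := hD.torsionFree U V y hU hV
  have t2 := hD.torsionFree U W y hU hW
  have t3 := hD.torsionFree V W y hV hW
  rw [hUV, sub_eq_zero] at t1
  rw [hUW, sub_eq_zero] at t2
  rw [hVW, sub_eq_zero] at t3
  rw [hD.preserves V W y hV hW, hD.preserves U W y hU hW, hD.preserves U V y hU hV, t1, t2, t3,
    g.symm y (V y)]
  ring

theorem diffSectionAt_coordField {y₀ y : B} (hy : y ∈ triv E (TangentSpace 𝓘(ℝ, E)) y₀) (a : E) :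
    DiffSectionAt 𝓘(ℝ, E) E (coordField y₀ a) y :=
  diffSectionAt_frame hy a

theorem IsLeviCivita.koszul_coordField [CompleteSpace E] (hD : IsLeviCivita g D) {y₀ y : B}
    (hy : y ∈ triv E (TangentSpace 𝓘(ℝ, E)) y₀) (a b c : E) :
    g.val y (D (coordField y₀ b) y (coordField y₀ a y)) (coordField y₀ c y) =
      (mvfderiv 𝓘(ℝ, E) (fun z ↦ g.val z (coordField y₀ b z) (coordField y₀ c z)) y
          (coordField y₀ a y) +
        mvfderiv 𝓘(ℝ, E) (fun z ↦ g.val z (coordField y₀ a z) (coordField y₀ c z)) y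
          (coordField y₀ b y) -
        mvfderiv 𝓘(ℝ, E) (fun z ↦ g.val z (coordField y₀ a z) (coordField y₀ b z)) y
          (coordField y₀ c y)) / 2 :=
  hD.koszul (diffSectionAt_coordField hy a) (diffSectionAt_coordField hy b)
    (diffSectionAt_coordField hy c) (mlieBracket_coordField hy a b) (mlieBracket_coordField hy a c)
    (mlieBracket_coordField hy b c)

theorem IsLeviCivita.coordField_comm [CompleteSpace E] (hD : IsLeviCivita g D) {y₀ y : B}
    (hy : y ∈ triv E (TangentSpace 𝓘(ℝ, E)) y₀) (a b : E) :
    D (coordField y₀ b) y (coordField y₀ a y) = D (coordField y₀ a) y (coordField y₀ b y) := by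
  have h := hD.torsionFree _ _ y (diffSectionAt_coordField hy a) (diffSectionAt_coordField hy b)
  rwa [mlieBracket_coordField hy, sub_eq_zero] at h

/-- The Levi-Civita connection is smooth: in coordinates, the Koszul formula expresses the
Christoffel symbols by the inverse of the metric and its first derivatives. -/
theorem IsLeviCivita.contMDiffAt_coordField (hD : IsLeviCivita g D) (y₀ : B) (b : E) :
    ContMDiffAt 𝓘(ℝ, E) (𝓘(ℝ, E).prod 𝓘(ℝ, E →L[ℝ] E)) ∞
      (fun y ↦ TotalSpace.mk' (E →L[ℝ] E)
        (E := fun y ↦ TangentSpace 𝓘(ℝ, E) y →L[ℝ] TangentSpace 𝓘(ℝ, E) y) y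
        (D (coordField y₀ b) y)) y₀ := by
  have := FiniteDimensional.complete ℝ E
  refine contMDiffAt_hom_of_frame fun a ↦ ?_
  rw [contMDiffAt_section_iff_coord (mem_triv y₀)]
  set s : B → E := fun y ↦
    coord E (TangentSpace 𝓘(ℝ, E)) y₀ y (D (coordField y₀ b) y (coordField y₀ a y))
  have hE : ∀ a, ContMDiffAt 𝓘(ℝ, E) (𝓘(ℝ, E).prod 𝓘(ℝ, E)) ∞
      (fun y ↦ (⟨y, coordField y₀ a y⟩ : TangentBundle 𝓘(ℝ, E) B)) y₀ :=
    fun a ↦ contMDiffAt_frame (mem_triv y₀) a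
  let G : B → E →L[ℝ] E →L[ℝ] ℝ := fun y ↦
    (ContinuousLinearMap.precomp ℝ (frame E (TangentSpace 𝓘(ℝ, E)) y₀ y)).comp
      ((g.val y).comp (frame E (TangentSpace 𝓘(ℝ, E)) y₀ y))
  have hG : ContMDiffAt 𝓘(ℝ, E) 𝓘(ℝ, E →L[ℝ] E →L[ℝ] ℝ) ∞ G y₀ :=
    contMDiffAt_clm_of_apply fun a ↦ contMDiffAt_clm_of_apply fun b ↦
      g.contMDiffAt_apply (hE a) (hE b)
  have hGs : ∀ y ∈ triv E (TangentSpace 𝓘(ℝ, E)) y₀, ∀ c, G y (s y) c =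
      g.val y (D (coordField y₀ b) y (coordField y₀ a y)) (coordField y₀ c y) := fun y hy c ↦ by
    simp [G, s, frame_coord hy]
  have hK : ContMDiffAt 𝓘(ℝ, E) 𝓘(ℝ, E →L[ℝ] ℝ) ∞ (fun y ↦ G y (s y)) y₀ := by
    refine contMDiffAt_clm_of_apply fun c ↦ ?_
    have h3 : ∀ a b c, ContMDiffAt 𝓘(ℝ, E) 𝓘(ℝ, ℝ) ∞ (fun y ↦
        mvfderiv 𝓘(ℝ, E) (fun z ↦ g.val z (coordField y₀ b z) (coordField y₀ c z)) y
          (coordField y₀ a y)) y₀ := fun a b c ↦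
      contMDiffAt_mvfderiv_apply (g.contMDiffAt_apply (hE b) (hE c)) (hE a)
    refine ((((h3 a b c).add (h3 b a c)).sub (h3 c a b)).div_const 2).congr_of_eventuallyEq ?_
    filter_upwards [triv_mem_nhds (mem_triv (F := E) (V := TangentSpace 𝓘(ℝ, E)) y₀)] with y hy
    rw [hGs y hy c]
    exact hD.koszul_coordField hy a b c
  have hinj : ∀ y ∈ triv E (TangentSpace 𝓘(ℝ, E)) y₀, Injective (G y) := fun y hy ↦ by
    refine (injective_iff_map_eq_zero (G y)).2 fun v hv ↦ ?_
    have h0 : frame E (TangentSpace 𝓘(ℝ, E)) y₀ y v = 0 := g.nondegenerate y _ fun w ↦ by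
      rw [← frame_coord hy w]
      exact congr($hv (coord E (TangentSpace 𝓘(ℝ, E)) y₀ y w))
    rw [← coord_frame hy v, h0, map_zero]
  have hfr : Module.finrank ℝ E = Module.finrank ℝ (E →L[ℝ] ℝ) := by
    rw [← LinearMap.toContinuousLinearMap.finrank_eq]
    exact (Subspace.dual_finrank_eq (K := ℝ) (V := E)).symm
  let e : ∀ y ∈ triv E (TangentSpace 𝓘(ℝ, E)) y₀, E ≃L[ℝ] (E →L[ℝ] ℝ) := fun y hy ↦
    (LinearEquiv.ofInjectiveOfFinrankEq (G y : E →ₗ[ℝ] (E →L[ℝ] ℝ)) (hinj y hy)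
      hfr).toContinuousLinearEquiv
  have he : ∀ y hy, (e y hy : E →L[ℝ] (E →L[ℝ] ℝ)) = G y := fun y hy ↦ rfl
  have hinv : ContMDiffAt 𝓘(ℝ, E) 𝓘(ℝ, (E →L[ℝ] ℝ) →L[ℝ] E) ∞ (fun y ↦ (G y).inverse) y₀ := by
    have h := contDiffAt_map_inverse (𝕜 := ℝ) (n := ∞) (e y₀ (mem_triv y₀))
    rw [he y₀ (mem_triv y₀)] at h
    exact h.contMDiffAt.comp y₀ hG
  refine (hinv.clm_apply hK).congr_of_eventuallyEq ?_
  filter_upwards [triv_mem_nhds (mem_triv (F := E) (V := TangentSpace 𝓘(ℝ, E)) y₀)] with y hy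
  rw [← he y hy, ContinuousLinearMap.inverse_equiv]
  exact ((e y hy).symm_apply_apply (s y)).symm

/-- The Levi-Civita connection is compatible with homotheties of the metric. -/
theorem IsLeviCivita.mpullback_homothety (hD : IsLeviCivita g D) {φ : B → B}
    (hφ : ContMDiff 𝓘(ℝ, E) 𝓘(ℝ, E) ∞ φ)
    (hinv : ∀ z, (mfderiv 𝓘(ℝ, E) 𝓘(ℝ, E) φ z).IsInvertible) {k : ℝ}
    (hg : ∀ z v w, g.val (φ z) (mfderiv 𝓘(ℝ, E) 𝓘(ℝ, E) φ z v) (mfderiv 𝓘(ℝ, E) 𝓘(ℝ, E) φ z w) =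
      k * g.val z v w)
    {y : B} {V : ∀ y : B, TangentSpace 𝓘(ℝ, E) y} (hV : DiffSectionAt 𝓘(ℝ, E) E V (φ y))
    (ξ : TangentSpace 𝓘(ℝ, E) y) :
    mfderiv 𝓘(ℝ, E) 𝓘(ℝ, E) φ y (D (VectorField.mpullback 𝓘(ℝ, E) 𝓘(ℝ, E) φ V) y ξ) =
      D V (φ y) (mfderiv 𝓘(ℝ, E) 𝓘(ℝ, E) φ y ξ) := by
  have := FiniteDimensional.complete ℝ E
  have := isManifold_minSmoothness E B
  have hd : MDifferentiableAt 𝓘(ℝ, E) 𝓘(ℝ, E) φ y := hφ.contMDiffAt.mdifferentiableAt (by simp)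
  have hpb : ∀ {V : ∀ y : B, TangentSpace 𝓘(ℝ, E) y}, DiffSectionAt 𝓘(ℝ, E) E V (φ y) →
      DiffSectionAt 𝓘(ℝ, E) E (VectorField.mpullback 𝓘(ℝ, E) 𝓘(ℝ, E) φ V) y := fun hV ↦
    MDifferentiableAt.mpullback_vectorField (n := ∞) hV hφ.contMDiffAt (hinv y) two_le_infty
  have hrel : ∀ (V : ∀ y : B, TangentSpace 𝓘(ℝ, E) y) z,
      mfderiv 𝓘(ℝ, E) 𝓘(ℝ, E) φ z (VectorField.mpullback 𝓘(ℝ, E) 𝓘(ℝ, E) φ V z) = V (φ z) :=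
    fun V z ↦ by
      obtain ⟨e, he⟩ := hinv z
      rw [VectorField.mpullback_apply, ← he, ContinuousLinearMap.inverse_equiv]
      exact e.apply_symm_apply _
  -- both sides are tensorial in the difference, which may be evaluated on coordinate fields
  have hT : TensorialAt 𝓘(ℝ, E) E (fun V : ∀ y : B, TangentSpace 𝓘(ℝ, E) y ↦
      mfderiv 𝓘(ℝ, E) 𝓘(ℝ, E) φ y (D (VectorField.mpullback 𝓘(ℝ, E) 𝓘(ℝ, E) φ V) y ξ) -
        D V (φ y) (mfderiv 𝓘(ℝ, E) 𝓘(ℝ, E) φ y ξ)) (φ y) :=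
    { smul := fun {f V} hf hV ↦ by
        have h1 : VectorField.mpullback 𝓘(ℝ, E) 𝓘(ℝ, E) φ (f • V) =
            (f ∘ φ) • VectorField.mpullback 𝓘(ℝ, E) 𝓘(ℝ, E) φ V := VectorField.mpullback_smul
        rw [h1, D.isCovariantDerivativeOn.leibniz hV hf (Set.mem_univ _),
          D.isCovariantDerivativeOn.leibniz (hpb hV) (hf.comp y hd) (Set.mem_univ _)]
        simp only [add_apply, smul_apply, map_add, map_smul, ContinuousLinearMap.smulRight_apply,
          comp_apply, hrel, mvfderiv_comp_apply_of_mdifferentiableAt hf hd]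
        module
      add := fun {V V'} hV hV' ↦ by
        have h1 : VectorField.mpullback 𝓘(ℝ, E) 𝓘(ℝ, E) φ (V + V') =
            VectorField.mpullback 𝓘(ℝ, E) 𝓘(ℝ, E) φ V +
              VectorField.mpullback 𝓘(ℝ, E) 𝓘(ℝ, E) φ V' := VectorField.mpullback_add
        rw [h1, D.isCovariantDerivativeOn.add hV hV' (Set.mem_univ _),
          D.isCovariantDerivativeOn.add (hpb hV) (hpb hV') (Set.mem_univ _)]
        simp only [add_apply, map_add]
        abel }
  have hmem : φ y ∈ triv E (TangentSpace 𝓘(ℝ, E)) (φ y) := mem_triv (φ y)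
  let b : E := coord E (TangentSpace 𝓘(ℝ, E)) (φ y) (φ y) (V (φ y))
  have key := hT.pointwise hV (diffSectionAt_coordField hmem b) (frame_coord hmem _).symm
  suffices h0 : mfderiv 𝓘(ℝ, E) 𝓘(ℝ, E) φ y
      (D (VectorField.mpullback 𝓘(ℝ, E) 𝓘(ℝ, E) φ (coordField (φ y) b)) y ξ) =
        D (coordField (φ y) b) (φ y) (mfderiv 𝓘(ℝ, E) 𝓘(ℝ, E) φ y ξ) by
    rw [h0, sub_self, sub_eq_zero] at key
    exact key
  let Z : E → ∀ y : B, TangentSpace 𝓘(ℝ, E) y := fun a ↦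
    VectorField.mpullback 𝓘(ℝ, E) 𝓘(ℝ, E) φ (coordField (φ y) a)
  have hZ : ∀ a, DiffSectionAt 𝓘(ℝ, E) E (Z a) y := fun a ↦ hpb (diffSectionAt_coordField hmem a)
  have hZZ : ∀ a b, VectorField.mlieBracket 𝓘(ℝ, E) (Z a) (Z b) y = 0 := fun a b ↦ by
    rw [← VectorField.mpullback_mlieBracket (n := ∞) (diffSectionAt_coordField hmem a)
      (diffSectionAt_coordField hmem b) hφ.contMDiffAt minSmoothness_le_infty, VectorField.mpullback_apply,
      mlieBracket_coordField hmem, map_zero]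
  have hgZ : ∀ a b c, mvfderiv 𝓘(ℝ, E) (fun z ↦ g.val (φ z) (coordField (φ y) b (φ z))
      (coordField (φ y) c (φ z))) y (Z a y) =
        k * mvfderiv 𝓘(ℝ, E) (fun z ↦ g.val z (Z b z) (Z c z)) y (Z a y) := fun a b c ↦ by
    have h1 : (fun z ↦ g.val (φ z) (coordField (φ y) b (φ z)) (coordField (φ y) c (φ z))) =
        fun z ↦ k * g.val z (Z b z) (Z c z) := by
      funext z
      rw [← hg, hrel, hrel]
    rw [h1, mvfderiv_fun_mul mdifferentiableAt_const (g.mdifferentiableAt_apply (hZ b) (hZ c)),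
      show mvfderiv 𝓘(ℝ, E) (fun _ : B ↦ k) y = 0 from mvfderiv_const _]
    simp
  have hgZ' : ∀ a b c, mvfderiv 𝓘(ℝ, E) (fun z ↦ g.val z (coordField (φ y) b z)
      (coordField (φ y) c z)) (φ y) (coordField (φ y) a (φ y)) =
        k * mvfderiv 𝓘(ℝ, E) (fun z ↦ g.val z (Z b z) (Z c z)) y (Z a y) := fun a b c ↦ by
    rw [← hgZ, ← hrel (coordField (φ y) a) y]
    exact (mvfderiv_comp_apply_of_mdifferentiableAt
      (g.mdifferentiableAt_apply (diffSectionAt_coordField hmem b)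
        (diffSectionAt_coordField hmem c)) hd (Z a y)).symm
  have hξ : ξ = Z (coord E (TangentSpace 𝓘(ℝ, E)) (φ y) (φ y)
      (mfderiv 𝓘(ℝ, E) 𝓘(ℝ, E) φ y ξ)) y := by
    obtain ⟨e, he⟩ := hinv y
    simp only [Z, VectorField.mpullback_apply, coordField, frame_coord hmem]
    rw [← he, ContinuousLinearMap.inverse_equiv]
    exact (e.symm_apply_apply ξ).symm
  rw [hξ]
  set a : E := coord E (TangentSpace 𝓘(ℝ, E)) (φ y) (φ y) (mfderiv 𝓘(ℝ, E) 𝓘(ℝ, E) φ y ξ)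
  rw [← sub_eq_zero]
  refine g.nondegenerate _ _ fun w ↦ ?_
  set c : E := coord E (TangentSpace 𝓘(ℝ, E)) (φ y) (φ y) w with hc
  have hw : w = mfderiv 𝓘(ℝ, E) 𝓘(ℝ, E) φ y (Z c y) := by
    rw [hrel, hc, coordField, frame_coord hmem]
  have k1 := hD.koszul (hZ a) (hZ b) (hZ c) (hZZ a b) (hZZ a c) (hZZ b c)
  have k2 := hD.koszul_coordField hmem a b c
  rw [hgZ', hgZ', hgZ'] at k2
  have hwc : coordField (φ y) c (φ y) = w := frame_coord hmem w
  rw [hwc] at k2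
  rw [map_sub, sub_apply, sub_eq_zero, hrel]
  refine Eq.trans ?_ k2.symm
  rw [hw, hg]
  exact (congrArg (k * ·) k1).trans (by ring)

end LeviCivita

/-! ### Actions of `ℝ₊` and their generators -/

section Flow

variable {m : ℕ} {N : Type*} [TopologicalSpace N] [ChartedSpace (Eu m) N]
  [IsManifold (𝓡 m) ∞ N]

theorem tangentBundle_mk_congr {y y' : N} (h : y = y') {v v' : Eu m} (hv : v = v') :
    (⟨y, v⟩ : TangentBundle (𝓡 m) N) = ⟨y', v'⟩ := by
  subst h hv; rfl

/-- Every tangent vector is the value of a global smooth vector field. -/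
theorem exists_smoothSection_eq [T2Space N] (y : N) (v : TangentSpace (𝓡 m) y) :
    ∃ V : ∀ z : N, TangentSpace (𝓡 m) z, SmoothSection (𝓡 m) (Eu m) V ∧ V y = v := by
  let f : SmoothBumpFunction (𝓡 m) y := Classical.arbitrary _
  let a : Eu m := coord (Eu m) (TangentSpace (𝓡 m)) y y v
  refine ⟨fun z ↦ f z • coordField y a z, fun z ↦ ?_, ?_⟩
  · by_cases hz : z ∈ triv (Eu m) (TangentSpace (𝓡 m)) y
    · exact ContMDiffAt.smul_section f.contMDiffAt (contMDiffAt_frame hz a)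
    · have hz' : z ∉ tsupport f := fun h ↦ hz (f.tsupport_subset_chartAt_source h)
      rw [contMDiffAt_section_iff_coord (mem_triv z)]
      refine contMDiffAt_const (c := 0) |>.congr_of_eventuallyEq ?_
      filter_upwards [(isClosed_tsupport f).isOpen_compl.mem_nhds hz'] with x hx
      rw [image_eq_zero_of_notMem_tsupport hx, zero_smul, map_zero]
  · change f y • coordField y a y = v
    rw [f.eq_one, one_smul]
    exact frame_coord (mem_triv y) v

variable [MulAction PosReal N]

variable (m N) in
/-- The action of `ℝ₊` is smooth, in terms of the parameter `t = log s`. -/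
def SmoothAction : Prop :=
  ContMDiff (𝓘(ℝ, ℝ).prod (𝓡 m)) (𝓡 m) ∞ (fun y : ℝ × N ↦ expPos y.1 • y.2)

theorem expPos_zero : expPos 0 = 1 := Subtype.ext Real.exp_zero

theorem expPos_zero_smul (y : N) : expPos 0 • y = y := by rw [expPos_zero, one_smul]

namespace SmoothAction

variable (hN : SmoothAction m N)
include hN

theorem contMDiff_flow (y : N) : ContMDiff 𝓘(ℝ, ℝ) (𝓡 m) ∞ (fun t ↦ expPos t • y) :=
  ContMDiff.comp hN (contMDiff_id.prodMk contMDiff_const)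

theorem contMDiff_dilation (t : ℝ) : ContMDiff (𝓡 m) (𝓡 m) ∞ (fun y : N ↦ expPos t • y) :=
  ContMDiff.comp (g := fun z : ℝ × N ↦ expPos z.1 • z.2) hN (contMDiff_const.prodMk contMDiff_id)

theorem mdifferentiableAt_flow (y : N) (t : ℝ) :
    MDifferentiableAt 𝓘(ℝ, ℝ) (𝓡 m) (fun t ↦ expPos t • y) t :=
  (hN.contMDiff_flow y).contMDiffAt.mdifferentiableAt (by simp)

theorem mdifferentiableAt_dilation (t : ℝ) (y : N) :
    MDifferentiableAt (𝓡 m) (𝓡 m) (fun y : N ↦ expPos t • y) y :=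
  (hN.contMDiff_dilation t).contMDiffAt.mdifferentiableAt (by simp)

theorem contMDiff_generator : SmoothSection (𝓡 m) (Eu m) (generator : ∀ y : N, TangentSpace (𝓡 m) y) := by
  intro y
  have h1 : ContMDiffAt (𝓡 m) (𝓘(ℝ, ℝ).prod 𝓘(ℝ, ℝ)) ∞
      (fun _ : N ↦ (⟨(0 : ℝ), (1 : ℝ)⟩ : TangentBundle 𝓘(ℝ, ℝ) ℝ)) y := contMDiffAt_const
  have h2 : ContMDiffAt ((𝓡 m).prod 𝓘(ℝ, ℝ)) (𝓡 m) ∞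
      (uncurry fun (y : N) (t : ℝ) ↦ expPos t • y) (y, 0) :=
    (ContMDiff.comp hN (contMDiff_snd.prodMk contMDiff_fst)).contMDiffAt
  have h := contMDiffAt_mfderiv_apply (f := fun (y : N) (t : ℝ) ↦ expPos t • y)
    (γ := fun _ ↦ (0 : ℝ)) (v := fun _ ↦ (1 : ℝ)) h2 h1
  refine h.congr_of_eventuallyEq (Filter.Eventually.of_forall fun z ↦ ?_)
  exact tangentBundle_mk_congr (expPos_zero_smul z).symm rfl

/-- The derivative of a function along the flow. -/
theorem hasDerivAt_flow {F : Type*} [NormedAddCommGroup F] [NormedSpace ℝ F] {s : N → F} {y : N}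
    (hs : MDifferentiableAt (𝓡 m) 𝓘(ℝ, F) s y) :
    HasDerivAt (fun t ↦ s (expPos t • y)) (mvfderiv (𝓡 m) s y (generator y)) 0 := by
  have hs' : MDifferentiableAt (𝓡 m) 𝓘(ℝ, F) s (expPos 0 • y) := by rwa [expPos_zero_smul]
  have h1 : MDifferentiableAt 𝓘(ℝ, ℝ) 𝓘(ℝ, F) (s ∘ fun t ↦ expPos t • y) 0 :=
    hs'.comp 0 (hN.mdifferentiableAt_flow y 0)
  have h2 := h1.differentiableAt.hasDerivAt
  have h3 : deriv (s ∘ fun t ↦ expPos t • y) 0 = mvfderiv (𝓡 m) s y (generator y) := by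
    rw [← fderiv_apply_one_eq_deriv, ← mfderiv_eq_fderiv]
    refine (mfderiv_comp_apply 0 hs' (hN.mdifferentiableAt_flow y 0) (1 : ℝ)).trans ?_
    have : ∀ y' : N, y' = y → ∀ w : Eu m, (mfderiv (𝓡 m) 𝓘(ℝ, F) s y' w : F) =
        mfderiv (𝓡 m) 𝓘(ℝ, F) s y w := fun y' h w ↦ by rw [h]
    exact this _ (expPos_zero_smul y) _
  rwa [h3] at h2

theorem eventually_mem_triv (y : N) :
    ∀ᶠ t : ℝ in 𝓝 0, expPos t • y ∈ triv (Eu m) (TangentSpace (𝓡 m)) y := by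
  have h : Filter.Tendsto (fun t : ℝ ↦ expPos t • y) (𝓝 0) (𝓝 y) := by
    have := (hN.contMDiff_flow y).continuous.tendsto 0
    rwa [expPos_zero_smul] at this
  exact h (triv_mem_nhds (mem_triv y))

/-- The tangent map of the flow satisfies the linearised flow equation: the derivative at `t = 0` of
the tangent map `T_y ρ^{exp t}`, in coordinates, is the derivative of the generator. -/
theorem hasDerivAt_dilationDeriv (y : N) (a : Eu m) :
    HasDerivAt (fun t ↦ coord (Eu m) (TangentSpace (𝓡 m)) y (expPos t • y)
        (dilationDeriv (expPos t) y (coordField y a y)))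
      (mvfderiv (𝓡 m) (fun z ↦ coord (Eu m) (TangentSpace (𝓡 m)) y z (generator z)) y
        (coordField y a y)) 0 := by
  set φ := extChartAt (𝓡 m) y with hφ
  let Ψ : ℝ × Eu m → Eu m := fun z ↦ φ (expPos z.1 • φ.symm z.2)
  have hφy : φ.symm (φ y) = y := extChartAt_to_inv y
  have hφd : ∀ {z : N}, z ∈ triv (Eu m) (TangentSpace (𝓡 m)) y →
      MDifferentiableAt (𝓡 m) 𝓘(ℝ, Eu m) φ z := fun hz ↦ mdifferentiableAt_extChartAt hz
  have hφs : ContMDiffAt 𝓘(ℝ, Eu m) (𝓡 m) ∞ φ.symm (φ y) :=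
    (contMDiffOn_extChartAt_symm y).contMDiffAt (extChartAt_target_mem_nhds y)
  have hΨ : ContDiffAt ℝ ∞ Ψ (0, φ y) := by
    have h1 : ContMDiffAt (𝓘(ℝ, ℝ).prod 𝓘(ℝ, Eu m)) (𝓡 m) ∞
        (fun z : ℝ × Eu m ↦ expPos z.1 • φ.symm z.2) (0, φ y) :=
      ContMDiffAt.comp (g := fun z : ℝ × N ↦ expPos z.1 • z.2) (0, φ y) hN.contMDiffAt
        (contMDiffAt_fst.prodMk (ContMDiffAt.comp (g := φ.symm) (0, φ y) hφs contMDiffAt_snd))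
    have h2 : ContMDiffAt (𝓡 m) 𝓘(ℝ, Eu m) ∞ φ (expPos 0 • φ.symm (φ y)) := by
      rw [hφy, expPos_zero_smul]
      exact contMDiffAt_extChartAt
    have h3 := ContMDiffAt.comp (g := φ) (0, φ y) h2 h1
    rw [← modelWithCornersSelf_prod, chartedSpaceSelf_prod] at h3
    exact contMDiffAt_iff_contDiffAt.1 h3
  have hΨd : ∀ᶠ z in 𝓝 (0, φ y), DifferentiableAt ℝ Ψ z := by
    filter_upwards [(hΨ.of_le (m := 1) (by simp)).eventually (by simp)] with z hz
      using hz.differentiableAt (by simp)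
  have hΨ2 : HasFDerivAt (fderiv ℝ Ψ) (fderiv ℝ (fderiv ℝ Ψ) (0, φ y)) (0, φ y) :=
    ((hΨ.fderiv_right (m := 1) (by exact two_le_infty)).differentiableAt
      (by simp)).hasFDerivAt
  have hsymm := hΨ.isSymmSndFDerivAt minSmoothness_le_infty
  -- the tangent map of the flow is the partial derivative of `Ψ` in the second variable
  have h1 : (fun t ↦ coord (Eu m) (TangentSpace (𝓡 m)) y (expPos t • y)
      (dilationDeriv (expPos t) y (coordField y a y))) =ᶠ[𝓝 0]
        fun t ↦ fderiv ℝ Ψ (t, φ y) (0, a) := by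
    have hcont : Filter.Tendsto (fun t : ℝ ↦ (t, φ y)) (𝓝 0) (𝓝 (0, φ y)) :=
      (Continuous.prodMk_left (φ y)).tendsto 0
    filter_upwards [hcont hΨd, hN.eventually_mem_triv y] with t ht hty
    have e1 : fderiv ℝ Ψ (t, φ y) (0, a) = fderiv ℝ (fun z ↦ Ψ (t, z)) (φ y) a := by
      have := ht.hasFDerivAt.comp (φ y) (hasFDerivAt_prodMk_right t (φ y))
      have h := congr($(this.fderiv) a)
      simpa [comp_def] using h.symm
    have hd1 : MDifferentiableAt 𝓘(ℝ, Eu m) (𝓡 m) φ.symm (φ y) :=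
      hφs.mdifferentiableAt (by simp)
    have hd2 : MDifferentiableAt (𝓡 m) (𝓡 m) (fun z : N ↦ expPos t • z) (φ.symm (φ y)) :=
      hN.mdifferentiableAt_dilation t _
    have hd3 : MDifferentiableAt (𝓡 m) 𝓘(ℝ, Eu m) φ (expPos t • φ.symm (φ y)) := by
      rw [hφy]; exact hφd hty
    have e2 := mfderiv_comp_apply (φ y) (g := φ) (f := fun z ↦ expPos t • φ.symm z) hd3
      (hd2.comp _ hd1) a
    have e3 := mfderiv_comp_apply (φ y) (g := fun z : N ↦ expPos t • z) (f := φ.symm) hd2 hd1 a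
    have e4 : frame (Eu m) (TangentSpace (𝓡 m)) y y =
        mfderiv 𝓘(ℝ, Eu m) (𝓡 m) φ.symm (φ y) := by
      rw [← mfderivWithin_univ]
      have := TangentBundle.symmL_trivializationAt (I := 𝓡 m) (mem_chart_source (Eu m) y)
      rw [modelWithCornersSelf_coe, Set.range_id] at this
      exact this
    rw [e1, ← mfderiv_eq_fderiv, coord_tangentSpace hty]
    refine Eq.trans ?_ e2.symm
    have key : ∀ z : N, z = y → ∀ w : Eu m, w = frame (Eu m) (TangentSpace (𝓡 m)) y y a →
        (mfderiv (𝓡 m) 𝓘(ℝ, Eu m) φ (expPos t • y)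
          (dilationDeriv (expPos t) y (coordField y a y)) : Eu m) =
        mfderiv (𝓡 m) 𝓘(ℝ, Eu m) φ (expPos t • z)
          (mfderiv (𝓡 m) (𝓡 m) (fun z : N ↦ expPos t • z) z w) := by
      rintro z rfl w rfl; rfl
    refine (key _ hφy _ ?_).trans (congrArg _ e3.symm)
    exact congr($e4 a).symm
  -- the generator is the partial derivative of `Ψ` in the first variable
  have h2 : (fun z ↦ coord (Eu m) (TangentSpace (𝓡 m)) y z (generator z)) =ᶠ[𝓝 y]
      (fun z ↦ fderiv ℝ Ψ (0, z) (1, 0)) ∘ φ := by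
    have hcont : Filter.Tendsto (fun z : N ↦ ((0 : ℝ), φ z)) (𝓝 y) (𝓝 (0, φ y)) :=
      Filter.Tendsto.prodMk_nhds tendsto_const_nhds (continuousAt_extChartAt y)
    filter_upwards [hcont hΨd, triv_mem_nhds (mem_triv (F := Eu m) (V := TangentSpace (𝓡 m)) y)]
      with z hz hzy
    have hφz : φ.symm (φ z) = z := φ.left_inv (by simpa [hφ] using hzy)
    have e1 : fderiv ℝ Ψ (0, φ z) (1, 0) = deriv (fun t ↦ Ψ (t, φ z)) 0 := by
      have := hz.hasFDerivAt.comp (0 : ℝ) (hasFDerivAt_prodMk_left (𝕜 := ℝ) (0 : ℝ) (φ z))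
      have h := this.hasDerivAt.deriv
      simpa [comp_def] using h.symm
    have e2 : (fun t ↦ Ψ (t, φ z)) = fun t ↦ φ (expPos t • z) := by
      funext t; simp only [Ψ, hφz]
    rw [comp_apply, e1, e2, (hN.hasDerivAt_flow (hφd hzy)).deriv, coord_tangentSpace hzy]
    rfl
  have h3 : HasDerivAt (fun t ↦ fderiv ℝ Ψ (t, φ y) (0, a))
      (fderiv ℝ (fderiv ℝ Ψ) (0, φ y) (1, 0) (0, a)) 0 := by
    have h := (hΨ2.comp (0 : ℝ) (hasFDerivAt_prodMk_left (0 : ℝ) (φ y))).hasDerivAt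
    have h' := h.clm_apply (hasDerivAt_const 0 ((0 : ℝ), a))
    simpa using h'
  have h4 : HasFDerivAt (fun z ↦ fderiv ℝ Ψ (0, z) (1, 0))
      ((ContinuousLinearMap.apply ℝ (Eu m) ((1 : ℝ), (0 : Eu m))).comp
        ((fderiv ℝ (fderiv ℝ Ψ) (0, φ y)).comp (ContinuousLinearMap.inr ℝ ℝ (Eu m)))) (φ y) :=
    (ContinuousLinearMap.apply ℝ (Eu m) ((1 : ℝ), (0 : Eu m))).hasFDerivAt.comp (φ y)
      (hΨ2.comp (φ y) (hasFDerivAt_prodMk_right 0 (φ y)))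
  have h5 : mvfderiv (𝓡 m) (fun z ↦ coord (Eu m) (TangentSpace (𝓡 m)) y z (generator z)) y
      (coordField y a y) = fderiv ℝ (fderiv ℝ Ψ) (0, φ y) (1, 0) (0, a) := by
    have e1 : mvfderiv (𝓡 m) (fun z ↦ coord (Eu m) (TangentSpace (𝓡 m)) y z (generator z)) y =
        mvfderiv (𝓡 m) ((fun z ↦ fderiv ℝ Ψ (0, z) (1, 0)) ∘ φ) y := by
      rw [mvfderiv, mvfderiv, h2.mfderiv_eq]
      rfl
    have e2 : mfderiv (𝓡 m) 𝓘(ℝ, Eu m) φ y (coordField y a y) = a := by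
      rw [← coord_tangentSpace (mem_triv y)]
      exact coord_frame (mem_triv y) a
    rw [e1, mvfderiv_comp_apply_of_mdifferentiableAt h4.differentiableAt.mdifferentiableAt
      (hφd (mem_triv y)), e2, mvfderiv, mfderiv_eq_fderiv, h4.fderiv]
    exact (hsymm.eq _ _).symm
  rw [h5]
  exact h3.congr_of_eventuallyEq h1

variable {g : PseudoMetric m N}
  {D : CovariantDerivative (𝓡 m) (Eu m) (TangentSpace (𝓡 m) : N → Type _)}

/-- If the metric is homogeneous of degree two, then the generator `X` of the action satisfies
`g(∇_v X, w) + g(v, ∇_w X) = 2 g(v, w)`, that is, `ℒ_X g = 2 g`. -/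
theorem val_add_val_generator (hD : IsLeviCivita g D)
    (hg : ∀ (s : PosReal) (y : N) (ξ η : TangentSpace (𝓡 m) y),
      g.val (s • y) (dilationDeriv s y ξ) (dilationDeriv s y η) = (s : ℝ) ^ 2 * g.val y ξ η)
    (y : N) (v w : TangentSpace (𝓡 m) y) :
    g.val y (D generator y v) w + g.val y v (D generator y w) = 2 * g.val y v w := by
  have hy : y ∈ triv (Eu m) (TangentSpace (𝓡 m)) y := mem_triv y
  have hX : DiffSectionAt (𝓡 m) (Eu m) (generator : ∀ y : N, TangentSpace (𝓡 m) y) y :=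
    hN.contMDiff_generator.contMDiffAt.mdifferentiableAt (by simp)
  obtain ⟨a, rfl⟩ : ∃ a, coordField y a y = v := ⟨_, frame_coord hy v⟩
  obtain ⟨b, rfl⟩ : ∃ b, coordField y b y = w := ⟨_, frame_coord hy w⟩
  let P : Eu m → ℝ → Eu m := fun a t ↦ coord (Eu m) (TangentSpace (𝓡 m)) y (expPos t • y)
    (dilationDeriv (expPos t) y (coordField y a y))
  let L : Eu m → Eu m := fun a ↦ mvfderiv (𝓡 m)
    (fun z ↦ coord (Eu m) (TangentSpace (𝓡 m)) y z (generator z)) y (coordField y a y)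
  have hP : ∀ a, HasDerivAt (P a) (L a) 0 := fun a ↦ hN.hasDerivAt_dilationDeriv y a
  have hP0 : ∀ a, P a 0 = a := fun a ↦ by
    have e1 : ∀ z : N, z = y → ∀ w : Eu m, w = coordField y a y →
        coord (Eu m) (TangentSpace (𝓡 m)) y z w = a := by
      rintro z rfl w rfl; exact coord_frame hy a
    refine e1 _ (expPos_zero_smul y) _ ?_
    have e2 : (fun z : N ↦ expPos 0 • z) = id := funext expPos_zero_smul
    have e3 : mfderiv (𝓡 m) (𝓡 m) (fun z : N ↦ expPos 0 • z) y =
        ContinuousLinearMap.id ℝ (Eu m) := by rw [e2]; exact mfderiv_id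
    exact congr($e3 (coordField y a y))
  let G : N → Eu m →L[ℝ] Eu m →L[ℝ] ℝ := fun z ↦
    (ContinuousLinearMap.precomp ℝ (frame (Eu m) (TangentSpace (𝓡 m)) y z)).comp
      ((g.val z).comp (frame (Eu m) (TangentSpace (𝓡 m)) y z))
  have hGapp : ∀ z a b, G z a b = g.val z (coordField y a z) (coordField y b z) :=
    fun z a b ↦ by simp [G]
  have hGab : ∀ a b, ContMDiffAt (𝓡 m) 𝓘(ℝ, ℝ) ∞ (fun z ↦ G z a b) y := fun a b ↦
    g.contMDiffAt_apply (contMDiffAt_frame hy a) (contMDiffAt_frame hy b)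
  have hG : MDifferentiableAt (𝓡 m) 𝓘(ℝ, Eu m →L[ℝ] Eu m →L[ℝ] ℝ) G y :=
    (contMDiffAt_clm_of_apply fun a ↦ contMDiffAt_clm_of_apply fun b ↦
      hGab a b).mdifferentiableAt (by simp)
  have d1 := hN.hasDerivAt_flow hG
  have d2 := (d1.clm_apply (hP a)).clm_apply (hP b)
  have d3 := hN.hasDerivAt_flow ((hGab a b).mdifferentiableAt (by simp))
  have d3' := ((d1.clm_apply (hasDerivAt_const 0 a)).clm_apply (hasDerivAt_const 0 b)).unique d3
  -- homogeneity of the metric, in coordinates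
  have d4 : (fun t ↦ G (expPos t • y) (P a t) (P b t)) =ᶠ[𝓝 0]
      fun t ↦ Real.exp t ^ 2 * G y a b := by
    filter_upwards [hN.eventually_mem_triv y] with t ht
    rw [hGapp, hGapp]
    refine Eq.trans ?_ (hg (expPos t) y (coordField y a y) (coordField y b y))
    simp only [P, coordField, frame_coord ht]
  have d5 : HasDerivAt (fun t ↦ Real.exp t ^ 2 * G y a b) (2 * G y a b) 0 := by
    have := ((Real.hasDerivAt_exp 0).pow 2).mul_const (G y a b)
    simpa using this
  have d6 := d2.unique (d5.congr_of_eventuallyEq d4)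
  simp only [add_apply, hP0, expPos_zero_smul] at d6
  simp only [map_zero, add_zero] at d3'
  rw [d3', hGapp, hGapp, hGapp] at d6
  -- the derivative of the coefficients of the metric along the generator
  let x : Eu m := coord (Eu m) (TangentSpace (𝓡 m)) y y (generator y)
  have hx : coordField y x y = generator y := frame_coord hy _
  have hDX : ∀ a, D generator y (coordField y a y) =
      coordField y (L a) y + D (coordField y a) y (generator y) := fun a ↦ by
    have h1 := hD.coordField_comm hy a x
    rw [hx] at h1
    exact (covariantDerivative_eq D hy hX _).trans (congrArg (coordField y (L a) y + ·) h1)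
  have d7 : mvfderiv (𝓡 m) (fun z ↦ G z a b) y (generator y) =
      g.val y (D (coordField y a) y (generator y)) (coordField y b y) +
        g.val y (coordField y a y) (D (coordField y b) y (generator y)) :=
    hD.preserves _ _ y (diffSectionAt_coordField hy a) (diffSectionAt_coordField hy b) _
  rw [d7] at d6
  rw [hDX, hDX, map_add, map_add, add_apply]
  linarith

/-- If moreover the one-form `g(X, ·)` is closed at `y`, then `∇X` is the identity at `y`. -/
theorem covariantDerivative_generator [T2Space N] (hD : IsLeviCivita g D)
    (hg : ∀ (s : PosReal) (y : N) (ξ η : TangentSpace (𝓡 m) y),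
      g.val (s • y) (dilationDeriv s y ξ) (dilationDeriv s y η) = (s : ℝ) ^ 2 * g.val y ξ η)
    {y : N} (hα : ∀ V W : ∀ y : N, TangentSpace (𝓡 m) y, SmoothSection (𝓡 m) (Eu m) V →
      SmoothSection (𝓡 m) (Eu m) W → extDerivOneForm (fun y ↦ g.val y (generator y)) V W y = 0)
    (v : TangentSpace (𝓡 m) y) : D generator y v = v := by
  rw [← sub_eq_zero]
  refine g.nondegenerate y _ fun w ↦ ?_
  obtain ⟨V, hV, rfl⟩ := exists_smoothSection_eq y v
  obtain ⟨W, hW, rfl⟩ := exists_smoothSection_eq y w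
  have hd : ∀ {V : ∀ y : N, TangentSpace (𝓡 m) y}, SmoothSection (𝓡 m) (Eu m) V →
      DiffSectionAt (𝓡 m) (Eu m) V y := fun hV ↦ hV.contMDiffAt.mdifferentiableAt (by simp)
  have hX := hd hN.contMDiff_generator
  have h1 := hα V W hV hW
  rw [extDerivOneForm, hD.preserves _ _ y hX (hd hW), hD.preserves _ _ y hX (hd hV),
    ← hD.torsionFree V W y (hd hV) (hd hW), map_sub] at h1
  have h2 := hN.val_add_val_generator hD hg y (V y) (W y)
  rw [g.symm y (V y)] at h2
  rw [map_sub, sub_apply]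
  linarith

/-- A vector field which is homogeneous of degree `-1` along an orbit is parallel along the orbit, at
all points where `∇X` is the identity. -/
theorem covariantDerivative_eq_zero_of_homogeneous (hD : IsLeviCivita g D) {y : N}
    (hX : ∀ v : TangentSpace (𝓡 m) y, D generator y v = v)
    {V : ∀ y : N, TangentSpace (𝓡 m) y} (hV : DiffSectionAt (𝓡 m) (Eu m) V y)
    (h : ∀ᶠ t : ℝ in 𝓝 0,
      V (expPos t • y) = (Real.exp t)⁻¹ • dilationDeriv (expPos t) y (V y)) :
    D V y (generator y) = 0 := by
  have hy : y ∈ triv (Eu m) (TangentSpace (𝓡 m)) y := mem_triv y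
  have hXd : DiffSectionAt (𝓡 m) (Eu m) (generator : ∀ y : N, TangentSpace (𝓡 m) y) y :=
    hN.contMDiff_generator.contMDiffAt.mdifferentiableAt (by simp)
  let a : Eu m := coord (Eu m) (TangentSpace (𝓡 m)) y y (V y)
  have ha : coordField y a y = V y := frame_coord hy _
  have hP := hN.hasDerivAt_dilationDeriv y a
  rw [ha] at hP
  have d1 := hN.hasDerivAt_flow ((diffSectionAt_iff_coord hy).1 hV)
  have d2 := ((Real.hasDerivAt_exp 0).inv (Real.exp_pos 0).ne').smul hP
  have d3 := d1.unique (d2.congr_of_eventuallyEq (by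
    filter_upwards [h] with t ht
    rw [ht, map_smul]
    rfl))
  have hP0 : coord (Eu m) (TangentSpace (𝓡 m)) y (expPos 0 • y)
      (dilationDeriv (expPos 0) y (V y)) = a := by
    have e1 := h.self_of_nhds
    rw [Real.exp_zero, inv_one, one_smul] at e1
    rw [← e1]
    have e2 : ∀ z : N, z = y → coord (Eu m) (TangentSpace (𝓡 m)) y z (V z) = a := by
      rintro z rfl; rfl
    exact e2 _ (expPos_zero_smul y)
  rw [hP0] at d3
  have d4 := hX (V y)
  let x : Eu m := coord (Eu m) (TangentSpace (𝓡 m)) y y (generator y)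
  have hx : coordField y x y = generator y := frame_coord hy _
  rw [covariantDerivative_eq D hy hXd] at d4
  have d5 := hD.coordField_comm hy a x
  rw [hx, ha] at d5
  have d6 : ∀ w : Eu m, (Real.exp⁻¹ : ℝ → ℝ) 0 • w + (-Real.exp 0 / Real.exp 0 ^ 2) • a = w - a := fun w ↦ by
    simp [sub_eq_add_neg]
  rw [covariantDerivative_eq D hy hV, d3, d6, map_sub, eq_sub_of_add_eq d4]
  change V y - D (coordField y x) y (V y) - coordField y a y + D (coordField y a) y (generator y) = 0
  rw [d5, ha]
  abel

end SmoothAction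

end Flow

/-! ### Immersions -/

section Immersion

variable {E : Type*} [NormedAddCommGroup E] [NormedSpace ℝ E]
  {H : Type*} [TopologicalSpace H] {I : ModelWithCorners ℝ E H} [I.Boundaryless]
  {M : Type*} [TopologicalSpace M] [ChartedSpace H M] [IsManifold I ∞ M]
  {E' : Type*} [NormedAddCommGroup E'] [NormedSpace ℝ E']
  {H' : Type*} [TopologicalSpace H'] {I' : ModelWithCorners ℝ E' H'}
  {M' : Type*} [TopologicalSpace M'] [ChartedSpace H' M'] [IsManifold I' ∞ M']

/-- The tangent maps of an immersion are injective, since an immersion has a smooth local left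
inverse. -/
theorem injective_mfderiv_of_isImmersionAt {f : M → M'} {x : M} (hf : IsImmersionAt I I' ∞ f x) :
    Injective (mfderiv I I' f x) := by
  let φ := hf.domChart
  let ψ := hf.codChart
  let r : M' → M := (φ.extend I).symm ∘ Prod.fst ∘ hf.equiv.symm ∘ ψ.extend I'
  have hx : x ∈ φ.source := hf.mem_domChart_source
  have hfx : f x ∈ ψ.source := hf.mem_codChart_source
  have hrf : r ∘ f =ᶠ[𝓝 x] id := by
    filter_upwards [φ.open_source.mem_nhds hx] with z hz
    have hz' : z ∈ (φ.extend I).source := by rwa [φ.extend_source]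
    have h := hf.writtenInCharts ((φ.extend I).map_source hz')
    simp only [comp_apply] at h
    rw [(φ.extend I).left_inv hz'] at h
    change (φ.extend I).symm (hf.equiv.symm (ψ.extend I' (f z))).1 = z
    rw [h, ContinuousLinearEquiv.symm_apply_apply]
    exact (φ.extend I).left_inv hz'
  have hx' : x ∈ (φ.extend I).source := by rwa [φ.extend_source]
  have hval : (hf.equiv.symm (ψ.extend I' (f x))).1 = φ.extend I x := by
    have h := hf.writtenInCharts ((φ.extend I).map_source hx')
    simp only [comp_apply] at h
    rw [(φ.extend I).left_inv hx'] at h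
    rw [h, ContinuousLinearEquiv.symm_apply_apply]
  have hr : MDifferentiableAt I' I r (f x) := by
    have h1 : MDifferentiableAt I' 𝓘(ℝ, E') (ψ.extend I') (f x) :=
      (ψ.contMDiffAt_extend hf.codChart_mem_maximalAtlas hfx).mdifferentiableAt (by simp)
    have h2 : MDifferentiableAt 𝓘(ℝ, E') 𝓘(ℝ, E) (Prod.fst ∘ hf.equiv.symm)
        (ψ.extend I' (f x)) := by
      refine DifferentiableAt.mdifferentiableAt ?_
      exact (ContinuousLinearMap.fst ℝ E hf.complement).differentiableAt.comp _
        hf.equiv.symm.differentiableAt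
    have h3 : MDifferentiableAt 𝓘(ℝ, E) I (φ.extend I).symm
        ((Prod.fst ∘ hf.equiv.symm) (ψ.extend I' (f x))) := by
      refine ContMDiffAt.mdifferentiableAt (n := ∞) ?_ (by simp)
      rw [comp_apply, hval]
      refine (contMDiffOn_extend_symm hf.domChart_mem_maximalAtlas).contMDiffAt ?_
      rw [← φ.extend_target']
      exact φ.isOpen_extend_target.mem_nhds ((φ.extend I).map_source hx')
    exact MDifferentiableAt.comp (g := (φ.extend I).symm) (f x) h3 (h2.comp (f x) h1)
  have h := mfderiv_comp x hr (hf.contMDiffAt.mdifferentiableAt (by simp))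
  rw [hrf.mfderiv_eq, mfderiv_id] at h
  intro v w hvw
  have hv := congr($h v)
  have hw := congr($h w)
  have h' := congrArg (mfderiv I' I r (f x)) hvw
  exact hv.trans (h'.trans hw.symm)

end Immersion

/-! ### The ray bundle -/

section RayBundle

namespace RayBundle

variable {n p q : ℕ} {M : Type*} [TopologicalSpace M] [ChartedSpace (Eu n) M]
  [IsManifold (𝓡 n) ∞ M] {c : ConformalStructure n p q M}

theorem contMDiff_homeo : ContMDiff (model n) (model n) ∞ (homeo c) := by
  intro u
  rw [contMDiffAt_iff]
  refine ⟨(homeo c).continuous.continuousAt, ?_⟩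
  have h := (contMDiffAt_iff.1 (contMDiffAt_id (I := model n) (n := ∞) (x := homeo c u))).2
  convert h using 1
  swap
  · rfl
  ext z : 1
  change extChartAt (model n) (homeo c u)
    (homeo c ((homeo c).symm ((extChartAt (model n) (homeo c u)).symm z))) = _
  exact congrArg (extChartAt (model n) (homeo c u)) ((homeo c).apply_symm_apply _)

theorem contMDiff_proj : ContMDiff (model n) (𝓡 n) ∞ (proj : RayBundle c → M) :=
  contMDiff_fst.comp contMDiff_homeo

theorem contMDiff_logScale : ContMDiff (model n) 𝓘(ℝ, ℝ) ∞ (logScale : RayBundle c → ℝ) :=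
  contMDiff_snd.comp contMDiff_homeo

theorem ofProd_proj_logScale (u : RayBundle c) : ofProd c (u.proj, u.logScale) = u :=
  (homeo c).symm_apply_apply u

theorem logScale_ofProd (y : M × ℝ) : (ofProd c y).logScale = y.2 :=
  congrArg Prod.snd ((homeo c).apply_symm_apply y)

theorem smul_ofProd (t : ℝ) (x : M) (r : ℝ) :
    expPos t • ofProd c (x, r) = ofProd c (x, t + r) := by
  refine Subtype.ext ?_
  change (⟨x, (Real.exp t ^ 2) • Real.exp (2 * r) • c.ref.val x⟩ : FormBundle n M) =
    ⟨x, Real.exp (2 * (t + r)) • c.ref.val x⟩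
  rw [smul_smul, ← Real.exp_nat_mul, ← Real.exp_add]
  congr 3
  push_cast
  ring

theorem logScale_smul (t : ℝ) (u : RayBundle c) : (expPos t • u).logScale = t + u.logScale := by
  conv_lhs => rw [← ofProd_proj_logScale u, smul_ofProd, logScale_ofProd]

theorem logScale_refPt (x : M) : (refPt c x).logScale = 0 := logScale_ofProd _

theorem smul_refPt (u : RayBundle c) : expPos u.logScale • refPt c u.proj = u := by
  rw [refPt, smul_ofProd, add_zero, ofProd_proj_logScale]

theorem continuous_flow (u : RayBundle c) : Continuous fun t ↦ expPos t • u := by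
  have : (fun t ↦ expPos t • u) = fun t ↦ ofProd c (u.proj, t + u.logScale) := by
    funext t
    conv_lhs => rw [← ofProd_proj_logScale u, smul_ofProd]
  rw [this]
  exact continuous_ofProd.comp (by fun_prop)

theorem mfderiv_proj_refPt (x : M) (ξ : TangentSpace (𝓡 n) x) :
    mfderiv (model n) (𝓡 n) proj (refPt c x) (mfderiv (𝓡 n) (model n) (refPt c) x ξ) = ξ := by
  have h := mfderiv_comp_apply x (g := (proj : RayBundle c → M)) (f := refPt c)
    (contMDiff_proj.contMDiffAt.mdifferentiableAt (by simp))
    ((contMDiff_refPt c).contMDiffAt.mdifferentiableAt (by simp)) ξ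
  have h2 : (proj : RayBundle c → M) ∘ refPt c = id := rfl
  rw [h2, mfderiv_id] at h
  exact h.symm

/-- The fibre of the vertical bundle of `𝒬 → M` is a line, on which the differential of `logScale` is
a coordinate. -/
theorem exists_vertical (u : RayBundle c) (a : ℝ) : ∃ v : TangentSpace (model n) u,
    mfderiv (model n) (𝓡 n) proj u v = 0 ∧ mvfderiv (model n) logScale u v = a := by
  obtain ⟨x, r, rfl⟩ : ∃ x r, ofProd c (x, r) = u := ⟨_, _, ofProd_proj_logScale u⟩
  have hγ : MDifferentiableAt 𝓘(ℝ, ℝ) (model n) (fun t : ℝ ↦ ofProd c (x, t)) r :=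
    ((contMDiff_ofProd c).comp (contMDiff_const.prodMk
      contMDiff_id)).contMDiffAt.mdifferentiableAt (by simp)
  refine ⟨mfderiv 𝓘(ℝ, ℝ) (model n) (fun t : ℝ ↦ ofProd c (x, t)) r a, ?_, ?_⟩
  · have h := mfderiv_comp_apply r (g := (proj : RayBundle c → M))
      (contMDiff_proj.contMDiffAt.mdifferentiableAt (by simp)) hγ a
    have h2 : (proj : RayBundle c → M) ∘ (fun t : ℝ ↦ ofProd c (x, t)) = fun _ ↦ x := rfl
    rw [h2, mfderiv_const] at h
    exact h.symm
  · have h := mvfderiv_comp_apply_of_mdifferentiableAt (s := (logScale : RayBundle c → ℝ))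
      (contMDiff_logScale.contMDiffAt.mdifferentiableAt (by simp)) hγ a
    have h2 : (logScale : RayBundle c → ℝ) ∘ (fun t : ℝ ↦ ofProd c (x, t)) = id :=
      funext fun t ↦ logScale_ofProd _
    rw [h2] at h
    refine h.symm.trans ?_
    rw [mvfderiv, mfderiv_id]
    rfl

end RayBundle

end RayBundle

/-! ### Dilations -/

section Dilation

variable {m : ℕ} {N : Type*} [TopologicalSpace N] [ChartedSpace (Eu m) N]
  [IsManifold (𝓡 m) ∞ N] [MulAction PosReal N]

theorem expPos_log (s : PosReal) : expPos (Real.log s) = s := Subtype.ext (Real.exp_log s.2)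

namespace SmoothAction

variable (hN : SmoothAction m N)
include hN

theorem contMDiff_smul (s : PosReal) : ContMDiff (𝓡 m) (𝓡 m) ∞ (fun y : N ↦ s • y) := by
  rw [← expPos_log s]
  exact hN.contMDiff_dilation _

/-- The generator is invariant under the action. -/
theorem dilationDeriv_generator (s : PosReal) (y : N) :
    dilationDeriv s y (generator y) = (generator (s • y) : TangentSpace (𝓡 m) (s • y)) := by
  have hs : ∀ z : N, MDifferentiableAt (𝓡 m) (𝓡 m) (fun y : N ↦ s • y) z := fun z ↦
    (hN.contMDiff_smul s).contMDiffAt.mdifferentiableAt (by simp)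
  have h := mfderiv_comp_apply (0 : ℝ) (hs (expPos 0 • y)) (hN.mdifferentiableAt_flow y 0) (1 : ℝ)
  have h2 : (fun y : N ↦ s • y) ∘ (fun t : ℝ ↦ expPos t • y) = fun t ↦ expPos t • s • y := by
    funext t
    simp only [comp_apply, smul_smul, mul_comm]
  rw [h2] at h
  have h3 : ∀ z : N, z = y → ∀ w : Eu m, dilationCoord s z w = dilationCoord s y w := by
    rintro z rfl w; rfl
  exact ((h.trans (h3 _ (expPos_zero_smul y) _))).symm

theorem isInvertible_dilationDeriv (s : PosReal) (y : N) :
    (mfderiv (𝓡 m) (𝓡 m) (fun y : N ↦ s • y) y).IsInvertible := by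
  let e : N ≃ₘ^∞⟮𝓡 m, 𝓡 m⟯ N :=
    { toEquiv := MulAction.toPerm s
      contMDiff_toFun := hN.contMDiff_smul s
      contMDiff_invFun := hN.contMDiff_smul s⁻¹ }
  exact ⟨e.mfderivToContinuousLinearEquiv (by simp) y, rfl⟩

/-- The derivative of a family `z ↦ ρ^{exp r(z)} (b(z))`, at a point where `r` vanishes. -/
theorem mfderiv_expPos_smul {E : Type*} [NormedAddCommGroup E] [NormedSpace ℝ E]
    {H : Type*} [TopologicalSpace H] {I : ModelWithCorners ℝ E H}
    {P : Type*} [TopologicalSpace P] [ChartedSpace H P] {r : P → ℝ} {b : P → N} {z : P}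
    (hr : MDifferentiableAt I 𝓘(ℝ, ℝ) r z) (hb : MDifferentiableAt I (𝓡 m) b z)
    (hz : r z = 0) (ζ : TangentSpace I z) :
    (mfderiv I (𝓡 m) (fun z ↦ expPos (r z) • b z) z ζ : Eu m) =
      mvfderiv I r z ζ • (generator (b z) : Eu m) + (mfderiv I (𝓡 m) b z ζ : Eu m) := by
  let Θ : ℝ × N → N := fun y ↦ expPos y.1 • y.2
  have hΘ : ∀ z, MDifferentiableAt (𝓘(ℝ, ℝ).prod (𝓡 m)) (𝓡 m) Θ z := fun z ↦
    ContMDiffAt.mdifferentiableAt hN.contMDiffAt (by simp)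
  let τ : ℝ := mvfderiv I r z ζ
  let η : Eu m := mfderiv I (𝓡 m) b z ζ
  have h1 := mfderiv_comp_apply z (g := Θ) (f := fun z ↦ (r z, b z)) (hΘ _) (hr.prodMk hb) ζ
  have h2 : mfderiv I (𝓘(ℝ, ℝ).prod (𝓡 m)) (fun z ↦ (r z, b z)) z =
      (mfderiv I 𝓘(ℝ, ℝ) r z).prod (mfderiv I (𝓡 m) b z) := mfderiv_prodMk hr hb
  have h3 := mfderiv_prod_eq_add_apply (f := Θ) (p := (r z, b z))
    (v := ((τ, η) : ℝ × Eu m)) (hΘ (r z, b z))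
  have h4 : (mfderiv 𝓘(ℝ, ℝ) (𝓡 m) (fun t : ℝ ↦ Θ (t, b z)) (r z) τ : Eu m) =
      τ • (generator (b z) : Eu m) := by
    rw [hz]
    have := (mfderiv 𝓘(ℝ, ℝ) (𝓡 m) (fun t : ℝ ↦ expPos t • b z) 0).map_smul τ (1 : ℝ)
    have hτ : τ • (1 : ℝ) = τ := mul_one τ
    exact (congrArg _ hτ.symm).trans this
  have h5 : (mfderiv (𝓡 m) (𝓡 m) (fun y : N ↦ Θ (r z, y)) (b z) η : Eu m) = η := by
    have : (fun y : N ↦ Θ (r z, y)) = id := by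
      funext y
      simp only [Θ, hz, expPos_zero_smul, id]
    rw [this]
    exact congr($(mfderiv_id (I := 𝓡 m) (x := b z)) η)
  refine h1.trans ((congr(mfderiv (𝓘(ℝ, ℝ).prod (𝓡 m)) (𝓡 m) Θ (r z, b z) ($h2 ζ))).trans ?_)
  refine h3.trans ?_
  exact congrArg₂ (fun v w : Eu m ↦ v + w) h4 h5

end SmoothAction

end Dilation

/-! ### The ambient manifold along the ray bundle -/

theorem BundleMetric.val_congr {m : ℕ} {N : Type*} [TopologicalSpace N] [ChartedSpace (Eu m) N]
    [IsManifold (𝓡 m) ∞ N] (g : PseudoMetric m N) {y y' : N} (h : y = y') (v w : Eu m) :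
    g.val y v w = g.val y' v w := by
  subst h; rfl

/-- The generator of an action of `ℝ₊`, as a map to the model space `ℝᵐ`. -/
def generatorCoord {m : ℕ} {N : Type*} [TopologicalSpace N] [ChartedSpace (Eu m) N]
    [MulAction PosReal N] (y : N) : Eu m := generator y

section Ambient

open RayBundle

namespace AmbientManifold

variable {n p q : ℕ} {M : Type*} [TopologicalSpace M] [ChartedSpace (Eu n) M]
  [IsManifold (𝓡 n) ∞ M] {c : ConformalStructure n p q M}
  {N : Type*} [TopologicalSpace N] [ChartedSpace (Eu (n + 2)) N] [MulAction PosReal N]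
  (A : AmbientManifold c N)

/-- The image in the ambient manifold of the section of `𝒬` given by the reference metric. -/
abbrev base (x : M) : N := A.ι (refPt c x)

theorem contMDiff_base : ContMDiff (𝓡 n) (𝓡 (n + 2)) ∞ A.base := A.refMap.contMDiff

theorem mdifferentiableAt_base (x : M) : MDifferentiableAt (𝓡 n) (𝓡 (n + 2)) A.base x :=
  A.contMDiff_base.contMDiffAt.mdifferentiableAt (by simp)

theorem mdifferentiableAt_ι (u : RayBundle c) :
    MDifferentiableAt (model n) (𝓡 (n + 2)) A.ι u :=
  A.contMDiff_ι.contMDiffAt.mdifferentiableAt (by simp)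

theorem smul_base (u : RayBundle c) : expPos u.logScale • A.base u.proj = A.ι u := by
  rw [base, ← A.ι_smul, smul_refPt]

theorem cls_scale (s : PosReal) (u : RayBundle c) (ξ : TangentSpace (𝓡 (n + 2)) (A.ι u)) :
    (A.cls (s • u) (A.scale s u ξ) : A.Tractor u.proj) = A.cls u ξ :=
  A.toCls_scale s u ξ

theorem scale_surjective (s : PosReal) (u : RayBundle c) : Surjective (A.scale s u) := fun ξ' ↦ by
  refine ⟨(A.cls u).symm (A.cls (s • u) ξ'), (A.cls (s • u)).injective ?_⟩
  exact (A.cls_scale s u _).trans ((A.cls u).apply_symm_apply _)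

theorem refLinearEquiv_cls (x : M) (ξ : TangentSpace (𝓡 (n + 2)) (A.base x)) :
    A.refLinearEquiv x (A.cls (refPt c x) ξ) = ξ :=
  Equiv.ofBijective_symm_apply_apply _ ⟨A.toCls_injective _, A.toCls_surjective _⟩ _

theorem cls_refLinearEquiv (x : M) (z : A.Tractor x) :
    (A.cls (refPt c x) (A.refLinearEquiv x z) : A.Tractor x) = z := by
  apply (A.refLinearEquiv x).injective
  exact A.refLinearEquiv_cls x _

variable [IsManifold (𝓡 (n + 2)) ∞ N]

theorem smoothAction (A : AmbientManifold c N) : SmoothAction (n + 2) N := A.contMDiff_smul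

/-- The tractor bundle is the pullback of the tangent bundle of the ambient manifold along the
section of `𝒬` given by the reference metric. -/
theorem isPullback : IsPullback (V := (TangentSpace (𝓡 (n + 2)) : N → Type _)) (W := A.Tractor)
    (Eu (n + 2)) A.base A.refLinearEquiv where
  mem_triv_iff x x' := Iff.rfl
  coord_apply x x' w := by
    simp only [coord, Trivialization.continuousLinearMapAt_apply, Trivialization.coe_linearMapAt]
    by_cases h : A.base x' ∈ triv (Eu (n + 2)) (TangentSpace (𝓡 (n + 2))) (A.base x)
    · rw [if_pos h]
      exact (if_pos (show x' ∈ triv (Eu (n + 2)) A.Tractor x from h)).symm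
    · rw [if_neg h]
      exact (if_neg (show x' ∉ triv (Eu (n + 2)) A.Tractor x from h)).symm

theorem scale_generator (s : PosReal) (u : RayBundle c) :
    (A.scale s u (generator (A.ι u)) : Eu (n + 2)) =
      (s : ℝ)⁻¹ • (generator (A.ι (s • u)) : Eu (n + 2)) := by
  have h := A.smoothAction.dilationDeriv_generator s (A.ι u)
  exact congrArg ((s : ℝ)⁻¹ • ·) (Eq.trans (b := generatorCoord (s • A.ι u)) h
    (congrArg generatorCoord (A.ι_smul s u).symm))

/-- The tangent map of the embedding of `𝒬` in terms of the identification of `𝒬` with `M × ℝ`. -/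
theorem mfderiv_ι (u : RayBundle c) (ζ : TangentSpace (model n) u) :
    (mfderiv (model n) (𝓡 (n + 2)) A.ι u ζ : Eu (n + 2)) =
      mvfderiv (model n) logScale u ζ • generatorCoord (A.ι u) +
        dilationCoord (expPos u.logScale) (A.base u.proj)
          (mfderiv (𝓡 n) (𝓡 (n + 2)) A.base u.proj (mfderiv (model n) (𝓡 n) proj u ζ)) := by
  have hN := A.smoothAction
  let r : RayBundle c → ℝ := fun w ↦ w.logScale - u.logScale
  let b : RayBundle c → N := fun w ↦ expPos u.logScale • A.base w.proj
  have hl : MDifferentiableAt (model n) 𝓘(ℝ, ℝ) (logScale : RayBundle c → ℝ) u :=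
    contMDiff_logScale.contMDiffAt.mdifferentiableAt (by simp)
  have hπ : MDifferentiableAt (model n) (𝓡 n) (proj : RayBundle c → M) u :=
    contMDiff_proj.contMDiffAt.mdifferentiableAt (by simp)
  have hδ := hN.mdifferentiableAt_dilation u.logScale (A.base u.proj)
  have hfπ : MDifferentiableAt (model n) (𝓡 (n + 2)) (A.base ∘ proj) u :=
    (A.mdifferentiableAt_base u.proj).comp u hπ
  have hb : MDifferentiableAt (model n) (𝓡 (n + 2)) b u := hδ.comp u hfπ
  have hbu : b u = A.ι u := A.smul_base u
  have h := hN.mfderiv_expPos_smul (r := r) (b := b) (z := u)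
    (hl.sub mdifferentiableAt_const) hb (sub_self _) ζ
  have hι : (fun w ↦ expPos (r w) • b w) = A.ι := by
    funext w
    simp only [r, b, smul_smul]
    rw [← A.smul_base w]
    congr 1
    refine Subtype.ext ?_
    change Real.exp _ * Real.exp _ = Real.exp _
    rw [← Real.exp_add, sub_add_cancel]
  have hι' : ∀ ι' : RayBundle c → N, ι' = A.ι →
      (mfderiv (model n) (𝓡 (n + 2)) ι' u ζ : Eu (n + 2)) =
        mfderiv (model n) (𝓡 (n + 2)) A.ι u ζ := by rintro _ rfl; rfl
  have hr : mvfderiv (model n) r u ζ = mvfderiv (model n) logScale u ζ := by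
    have := mvfderiv_fun_sub hl (mdifferentiableAt_const (c := u.logScale))
    have h0 : mvfderiv (model n) (fun _ : RayBundle c ↦ u.logScale) u = 0 := mvfderiv_const _
    rw [h0, sub_zero] at this
    exact congr($this ζ)
  have e1 := mfderiv_comp_apply u (g := fun y : N ↦ expPos u.logScale • y) (f := A.base ∘ proj)
    hδ hfπ ζ
  have e2 := mfderiv_comp_apply u (g := A.base) (f := (proj : RayBundle c → M))
    (A.mdifferentiableAt_base u.proj) hπ ζ
  have e3 := e1.trans (congrArg (dilationCoord (expPos u.logScale) (A.base u.proj)) e2)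
  rw [← hr, ← hbu]
  exact (hι' _ hι).symm.trans (h.trans (congrArg (mvfderiv (model n) r u ζ •
    generatorCoord (b u) + ·) e3))

theorem mfderiv_ι_of_vertical {u : RayBundle c} {ζ : TangentSpace (model n) u}
    (h : mfderiv (model n) (𝓡 n) proj u ζ = 0) :
    mfderiv (model n) (𝓡 (n + 2)) A.ι u ζ =
      mvfderiv (model n) logScale u ζ • generator (A.ι u) := by
  have h1 := A.mfderiv_ι u ζ
  rw [h, map_zero] at h1
  refine h1.trans ((congrArg _ (map_zero _)).trans (add_zero _))

theorem mfderiv_ι_refPt (x : M) (ξ : TangentSpace (𝓡 n) x) :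
    mfderiv (model n) (𝓡 (n + 2)) A.ι (refPt c x) (mfderiv (𝓡 n) (model n) (refPt c) x ξ) =
      mfderiv (𝓡 n) (𝓡 (n + 2)) A.base x ξ :=
  (mfderiv_comp_apply x (A.mdifferentiableAt_ι _)
    ((contMDiff_refPt c).contMDiffAt.mdifferentiableAt (by simp)) ξ).symm

theorem injective_mfderiv_ι (u : RayBundle c) :
    Injective (mfderiv (model n) (𝓡 (n + 2)) A.ι u) :=
  injective_mfderiv_of_isImmersionAt (A.isSmoothEmbedding.isImmersion.isImmersionAt u)

theorem generator_ne_zero (u : RayBundle c) : (generator (A.ι u) : TangentSpace (𝓡 (n + 2)) _) ≠ 0 := by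
  intro h
  obtain ⟨v, hv, hv'⟩ := exists_vertical u 1
  have h1 := A.mfderiv_ι_of_vertical hv
  rw [h, smul_zero] at h1
  have h2 : v = 0 := A.injective_mfderiv_ι u (h1.trans (map_zero _).symm)
  rw [h2, map_zero] at hv'
  exact zero_ne_one hv'

/-- The tangent map of `base` is injective modulo the generator. -/
theorem eq_zero_of_mfderiv_base_eq {x : M} {ξ : TangentSpace (𝓡 n) x} {a : ℝ}
    (h : mfderiv (𝓡 n) (𝓡 (n + 2)) A.base x ξ = a • generator (A.base x)) : ξ = 0 := by
  obtain ⟨v, hv, hv'⟩ := exists_vertical (refPt c x) a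
  have h1 := A.mfderiv_ι_of_vertical hv
  rw [hv'] at h1
  have h2 := A.injective_mfderiv_ι _ ((A.mfderiv_ι_refPt x ξ).trans (h.trans h1.symm))
  rw [← mfderiv_proj_refPt (c := c) x ξ, h2]
  exact hv

/-! ### Sections of the tractor bundle -/

theorem refLinearEquiv_eq_symm (x : M) (z : A.Tractor x) :
    A.refLinearEquiv x z = (A.cls (refPt c x)).symm z := by
  exact (LinearEquiv.eq_symm_apply (A.cls (refPt c x))).2 (A.cls_refLinearEquiv x z)

theorem cls_symm_smul_refPt (s : PosReal) (x : M) (z : A.Tractor x) :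
    (A.cls (s • refPt c x)).symm z = A.scale s (refPt c x) (A.refLinearEquiv x z) := by
  exact (LinearEquiv.symm_apply_eq (A.cls (s • refPt c x))).2
    ((A.cls_scale s _ _).trans (A.cls_refLinearEquiv x z)).symm

/-- Smooth sections of the tractor bundle are the smooth ambient vector fields along `𝒬` which are
homogeneous of degree `-1`. -/
theorem smoothSection_iff (σ : ∀ x : M, A.Tractor x) :
    SmoothSection (𝓡 n) (Eu (n + 2)) σ ↔
      ContMDiff (model n) (𝓡 (n + 2)).tangent ∞
        (fun u : RayBundle c ↦
          (⟨A.ι u, (A.cls u).symm (σ u.proj)⟩ : TangentBundle (𝓡 (n + 2)) N)) := by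
  have hsec : ∀ x, ContMDiffAt (𝓡 n) ((𝓡 n).prod 𝓘(ℝ, Eu (n + 2))) ∞
      (fun b ↦ TotalSpace.mk' (Eu (n + 2)) b (σ b)) x ↔
      ContMDiffAt (𝓡 n) ((𝓡 (n + 2)).prod 𝓘(ℝ, Eu (n + 2))) ∞
        (fun x ↦ (⟨A.base x, A.refLinearEquiv x (σ x)⟩ : TangentBundle (𝓡 (n + 2)) N)) x :=
    fun x ↦ A.isPullback.contMDiffAt_section_iff A.contMDiff_base
  constructor
  · intro h u
    have h1 := (hsec u.proj).1 (h u.proj)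
    have hπ : ContMDiffAt (model n) (𝓡 n) ∞ (proj : RayBundle c → M) u := contMDiff_proj.contMDiffAt
    have h2 : ContMDiffAt (model n) ((𝓡 (n + 2)).prod 𝓘(ℝ, Eu (n + 2))) ∞
        (fun w : RayBundle c ↦ (⟨A.base w.proj, A.refLinearEquiv w.proj (σ w.proj)⟩ :
          TangentBundle (𝓡 (n + 2)) N)) u := ContMDiffAt.comp u h1 hπ
    have h3 : ContMDiffAt (model n) ((𝓡 (n + 2)).prod 𝓘(ℝ, Eu (n + 2))) ∞
        (fun w : RayBundle c ↦ (⟨A.base w.proj,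
          (Real.exp w.logScale)⁻¹ • A.refLinearEquiv w.proj (σ w.proj)⟩ :
          TangentBundle (𝓡 (n + 2)) N)) u := by
      have hm : A.base u.proj ∈ triv (Eu (n + 2)) (TangentSpace (𝓡 (n + 2))) (A.base u.proj) :=
        mem_triv _
      have h2' := (contMDiffAt_totalSpace_iff_coord (f := fun w : RayBundle c ↦ A.base w.proj)
        (σ := fun w ↦ A.refLinearEquiv w.proj (σ w.proj)) hm).1 h2
      refine (contMDiffAt_totalSpace_iff_coord (f := fun w : RayBundle c ↦ A.base w.proj)
        (σ := fun w ↦ (Real.exp w.logScale)⁻¹ • A.refLinearEquiv w.proj (σ w.proj)) hm).2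
        ⟨h2'.1, ?_⟩
      simp only [map_smul]
      have he : ContMDiff 𝓘(ℝ, ℝ) 𝓘(ℝ, ℝ) ∞ (fun t : ℝ ↦ (Real.exp t)⁻¹) :=
        (Real.contDiff_exp.inv fun t ↦ (Real.exp_pos t).ne').contMDiff
      exact (he.comp contMDiff_logScale).contMDiffAt.smul h2'.2
    have h4 : ContMDiffAt ((model n).prod (𝓡 (n + 2))) (𝓡 (n + 2)) ∞
        (uncurry fun (w : RayBundle c) (y : N) ↦ expPos w.logScale • y) (u, A.base u.proj) :=
      (ContMDiff.comp (g := fun z : ℝ × N ↦ expPos z.1 • z.2) A.smoothAction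
        ((contMDiff_logScale.comp contMDiff_fst).prodMk contMDiff_snd)).contMDiffAt
    refine (contMDiffAt_mfderiv_apply (f := fun (w : RayBundle c) (y : N) ↦ expPos w.logScale • y)
      h4 h3).congr_of_eventuallyEq (Filter.Eventually.of_forall fun w ↦ ?_)
    have key : ∀ w' : RayBundle c, w' = w → ((A.cls w).symm (σ w.proj) : Eu (n + 2)) =
        (A.cls w').symm (σ w'.proj) := by rintro _ rfl; rfl
    refine tangentBundle_mk_congr (A.smul_base w).symm ?_
    refine (key _ (smul_refPt w)).trans ?_
    refine (A.cls_symm_smul_refPt (expPos w.logScale) w.proj (σ w.proj)).trans ?_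
    exact (map_smul (dilationCoord (expPos w.logScale) (A.base w.proj)) _ _).symm
  · intro h x
    rw [hsec]
    have h1 := ContMDiffAt.comp x (h (refPt c x)) (contMDiff_refPt c).contMDiffAt
    refine h1.congr_of_eventuallyEq (Filter.Eventually.of_forall fun x' ↦ ?_)
    exact tangentBundle_mk_congr rfl (A.refLinearEquiv_eq_symm x' (σ x'))

/-! ### The tractor metric -/

variable {A} {g : PseudoMetric (n + 2) N}

theorem IsAmbientMetric.val_scale (hg : A.IsAmbientMetric g) (s : PosReal) (u : RayBundle c)
    (ξ η : TangentSpace (𝓡 (n + 2)) (A.ι u)) :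
    g.val (A.ι (s • u)) (A.scale s u ξ) (A.scale s u η) = g.val (A.ι u) ξ η := by
  have h := hg.homogeneous s (A.ι u) ξ η
  have h1 : g.val (s • A.ι u) ((s : ℝ)⁻¹ • dilationDeriv s (A.ι u) ξ)
      ((s : ℝ)⁻¹ • dilationDeriv s (A.ι u) η) = g.val (A.ι u) ξ η := by
    rw [map_smul, map_smul, smul_apply, h, smul_eq_mul, smul_eq_mul]
    have := s.2.ne'
    field_simp
  exact (g.val_congr (A.ι_smul s u) _ _).trans h1

variable (A g) in
/-- The bundle metric on the tractor bundle induced by a pseudo-Riemannian metric on the ambient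
manifold. -/
def tractorMetric : BundleMetric (𝓡 n) (Eu (n + 2)) A.Tractor :=
  A.isPullback.metric A.contMDiff_base g

theorem tractorMetric_apply (x : M) (z z' : A.Tractor x) : (A.tractorMetric g).val x z z' =
    g.val (A.base x) (A.refLinearEquiv x z) (A.refLinearEquiv x z') :=
  A.isPullback.metric_apply A.contMDiff_base g x z z'

theorem IsAmbientMetric.tractorMetric_cls (hg : A.IsAmbientMetric g) (u : RayBundle c)
    (ξ η : TangentSpace (𝓡 (n + 2)) (A.ι u)) :
    (A.tractorMetric g).val u.proj (A.cls u ξ) (A.cls u η) = g.val (A.ι u) ξ η := by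
  obtain ⟨s, x, rfl⟩ : ∃ s x, s • refPt c x = u := ⟨_, _, smul_refPt u⟩
  obtain ⟨ξ, rfl⟩ := A.scale_surjective s (refPt c x) ξ
  obtain ⟨η, rfl⟩ := A.scale_surjective s (refPt c x) η
  rw [hg.val_scale, tractorMetric_apply]
  have h : ∀ ξ, A.refLinearEquiv (s • refPt c x).proj (A.cls (s • refPt c x)
      (A.scale s (refPt c x) ξ)) = ξ := fun ξ ↦
    (congrArg (A.refLinearEquiv x) (A.cls_scale s _ ξ)).trans (A.refLinearEquiv_cls x ξ)
  rw [h, h]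
  rfl

end AmbientManifold

end Ambient

/-! ### Densities of weight `-1` -/

section Tractors

open RayBundle

section Densities

variable {n p q : ℕ} {M : Type*} [TopologicalSpace M] [ChartedSpace (Eu n) M]
  [IsManifold (𝓡 n) ∞ M] {c : ConformalStructure n p q M}

variable (c) in
/-- The density of weight `-1` with the value `a` at the point of `𝒬` over `x` given by the
reference metric. -/
def refDensity (x : M) (a : ℝ) : Density c (-1) x :=
  ⟨fun u ↦ a * (Real.exp u.1.logScale)⁻¹, fun s u ↦ by
    have h : (s • u.1).logScale = Real.log s + u.1.logScale := by
      conv_lhs => rw [← expPos_log s, logScale_smul]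
    change a * (Real.exp (s • u.1).logScale)⁻¹ =
      (s : ℝ) ^ (-1 : ℝ) * (a * (Real.exp u.1.logScale)⁻¹)
    rw [h, Real.exp_add, Real.exp_log s.2, Real.rpow_neg_one, mul_inv]
    ring⟩

theorem eval_refDensity (u : RayBundle c) (a : ℝ) :
    Density.eval u (refDensity c u.proj a) = a * (Real.exp u.logScale)⁻¹ := rfl

theorem eval_refDensity_refPt (x : M) (a : ℝ) :
    Density.eval (refPt c x) (refDensity c x a) = a := by
  have h := eval_refDensity (refPt c x) a
  rw [logScale_refPt, Real.exp_zero, inv_one, mul_one] at h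
  exact h

theorem isSmoothDensity_refDensity : IsSmoothDensity (fun x ↦ refDensity c x 1) := by
  have he : ContMDiff 𝓘(ℝ, ℝ) 𝓘(ℝ, ℝ) ∞ (fun t : ℝ ↦ 1 * (Real.exp t)⁻¹) :=
    (contDiff_const.mul (Real.contDiff_exp.inv fun t ↦ (Real.exp_pos t).ne')).contMDiff
  exact he.comp contMDiff_logScale

theorem eval_smul {x : M} (s : PosReal) {u : RayBundle c} (hu : u.proj = x) (f : Density c (-1) x) :
    f.1 ⟨s • u, hu⟩ = (s : ℝ)⁻¹ * f.1 ⟨u, hu⟩ := by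
  have h := f.2 s ⟨u, hu⟩
  rwa [Real.rpow_neg_one] at h

end Densities

namespace AmbientManifold

variable {n p q : ℕ} {M : Type*} [TopologicalSpace M] [ChartedSpace (Eu n) M]
  [IsManifold (𝓡 n) ∞ M] {c : ConformalStructure n p q M}
  {N : Type*} [TopologicalSpace N] [ChartedSpace (Eu (n + 2)) N] [MulAction PosReal N]
  (A : AmbientManifold c N) [IsManifold (𝓡 (n + 2)) ∞ N]

/-! ### The canonical line subbundle -/

/-- The bundle map `j : ℰ[-1] → 𝒯`, `f ↦ [f X]`, evaluated at the point of `𝒬` given by the reference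
metric; by `canonicalMap_apply` any other point gives the same class. -/
def canonicalMap (x : M) : Density c (-1) x →ₗ[ℝ] A.Tractor x :=
  let e : Density c (-1) x →ₗ[ℝ] TangentSpace (𝓡 (n + 2)) (A.base x) :=
    { toFun := fun f ↦ f.1 ⟨refPt c x, rfl⟩ • generator (A.base x)
      map_add' := fun _ _ ↦ add_smul _ _ _
      map_smul' := fun a f ↦ mul_smul a (f.1 ⟨refPt c x, rfl⟩) (generator (A.base x)) }
  (A.cls (refPt c x)).toLinearMap.comp e

theorem canonicalMap_apply (u : RayBundle c) (f : Density c (-1) u.proj) :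
    A.canonicalMap u.proj f = A.cls u (Density.eval u f • generator (A.ι u)) := by
  obtain ⟨s, x, rfl⟩ : ∃ s x, s • refPt c x = u := ⟨_, _, smul_refPt u⟩
  refine (A.cls_scale s (refPt c x) _).symm.trans ?_
  have h1 : (A.scale s (refPt c x) (f.1 ⟨refPt c x, rfl⟩ • generator (A.base x)) : Eu (n + 2)) =
      f.1 ⟨s • refPt c x, rfl⟩ • generatorCoord (A.ι (s • refPt c x)) := by
    refine (map_smul (A.scale s (refPt c x)) _ _).trans ?_
    refine (congrArg (f.1 ⟨refPt c x, rfl⟩ • · : Eu (n + 2) → Eu (n + 2))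
      (A.scale_generator s (refPt c x))).trans ?_
    have h2 := eval_smul s (u := refPt c x) rfl f
    refine Eq.trans ?_ (congrArg (· • generatorCoord (A.ι (s • refPt c x))) h2.symm)
    rw [mul_comm, mul_smul]
    rfl
  exact congrArg (A.cls (s • refPt c x)) h1

theorem refLinearEquiv_canonicalMap (x : M) (f : Density c (-1) x) :
    A.refLinearEquiv x (A.canonicalMap x f) =
      Density.eval (refPt c x) f • generator (A.base x) :=
  A.refLinearEquiv_cls x _

/-- The image of `j` is the line subbundle to which the vertical bundle of `𝒬` descends. -/
theorem mem_range_canonicalMap (u : RayBundle c) (z : A.Tractor u.proj) :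
    z ∈ LinearMap.range (A.canonicalMap u.proj) ↔
      ∃ v : TangentSpace (model n) u, mfderiv (model n) (𝓡 n) proj u v = 0 ∧
        A.cls u (mfderiv (model n) (𝓡 (n + 2)) A.ι u v) = z := by
  constructor
  · rintro ⟨f, rfl⟩
    obtain ⟨v, hv, hv'⟩ := exists_vertical u (Density.eval u f)
    refine ⟨v, hv, ?_⟩
    rw [A.mfderiv_ι_of_vertical hv, hv', canonicalMap_apply]
  · rintro ⟨v, hv, rfl⟩
    refine ⟨refDensity c u.proj (mvfderiv (model n) logScale u v * Real.exp u.logScale), ?_⟩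
    rw [canonicalMap_apply, A.mfderiv_ι_of_vertical hv, eval_refDensity, mul_assoc,
      mul_inv_cancel₀ (Real.exp_pos _).ne', mul_one]

theorem injective_canonicalMap (x : M) : Injective (A.canonicalMap x) := by
  refine (injective_iff_map_eq_zero _).2 fun f hf ↦ ?_
  have h1 := A.refLinearEquiv_canonicalMap x f
  rw [hf, map_zero] at h1
  have h2 : f.1 ⟨refPt c x, rfl⟩ = 0 :=
    (smul_eq_zero.1 h1.symm).resolve_right (A.generator_ne_zero _)
  refine Subtype.ext (funext fun ⟨u, hu⟩ ↦ ?_)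
  obtain ⟨s, rfl⟩ : ∃ s, s • refPt c x = u := ⟨_, hu ▸ smul_refPt u⟩
  exact (eval_smul s (u := refPt c x) rfl f).trans ((congrArg ((s : ℝ)⁻¹ * ·) h2).trans (mul_zero _))

theorem smoothSection_canonicalMap {f : ∀ x, Density c (-1) x} (hf : IsSmoothDensity f) :
    SmoothSection (𝓡 n) (Eu (n + 2)) (fun x ↦ A.canonicalMap x (f x)) := by
  intro x
  rw [A.isPullback.contMDiffAt_section_iff A.contMDiff_base]
  have hX : ContMDiffAt (𝓡 n) ((𝓡 (n + 2)).prod 𝓘(ℝ, Eu (n + 2))) ∞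
      (fun x ↦ (⟨A.base x, generator (A.base x)⟩ : TangentBundle (𝓡 (n + 2)) N)) x :=
    (A.smoothAction.contMDiff_generator.comp A.contMDiff_base).contMDiffAt
  have ha : ContMDiffAt (𝓡 n) 𝓘(ℝ, ℝ) ∞ (fun x ↦ Density.eval (refPt c x) (f x)) x :=
    (hf.comp (contMDiff_refPt c)).contMDiffAt
  have hm : A.base x ∈ triv (Eu (n + 2)) (TangentSpace (𝓡 (n + 2))) (A.base x) := mem_triv _
  have h1 := (contMDiffAt_totalSpace_iff_coord (f := A.base)
    (σ := fun x ↦ generator (A.base x)) hm).1 hX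
  refine (contMDiffAt_totalSpace_iff_coord (f := A.base)
    (σ := fun x ↦ A.refLinearEquiv x (A.canonicalMap x (f x))) hm).2 ⟨h1.1, ?_⟩
  refine (ha.smul h1.2).congr_of_eventuallyEq (Filter.Eventually.of_forall fun x' ↦ ?_)
  simp only [refLinearEquiv_canonicalMap, map_smul]
  rfl

variable {A} {g : PseudoMetric (n + 2) N}

/-- The generator is orthogonal to the tangent spaces of `𝒬`, because it spans the vertical bundle of
`𝒬 → M`, on which the restriction of the ambient metric is degenerate. -/
theorem IsAmbientMetric.val_generator (hg : A.IsAmbientMetric g) (u : RayBundle c)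
    (ζ : TangentSpace (model n) u) :
    g.val (A.ι u) (generator (A.ι u)) (mfderiv (model n) (𝓡 (n + 2)) A.ι u ζ) = 0 := by
  obtain ⟨v, hv, hv'⟩ := exists_vertical u 1
  have h1 := A.mfderiv_ι_of_vertical hv
  rw [hv', one_smul] at h1
  rw [← h1, hg.restrict, hv, map_zero]
  rfl

theorem IsAmbientMetric.val_generator_self (hg : A.IsAmbientMetric g) (u : RayBundle c) :
    g.val (A.ι u) (generator (A.ι u)) (generator (A.ι u)) = 0 := by
  obtain ⟨v, hv, hv'⟩ := exists_vertical u 1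
  have h1 := A.mfderiv_ι_of_vertical hv
  rw [hv', one_smul] at h1
  have h2 := hg.val_generator u v
  rwa [h1] at h2

theorem IsAmbientMetric.val_generator_base (hg : A.IsAmbientMetric g) (x : M)
    (ξ : TangentSpace (𝓡 n) x) :
    g.val (A.base x) (generator (A.base x)) (mfderiv (𝓡 n) (𝓡 (n + 2)) A.base x ξ) = 0 := by
  rw [← A.mfderiv_ι_refPt]
  exact hg.val_generator _ _

theorem IsAmbientMetric.val_base (hg : A.IsAmbientMetric g) (x : M) (ξ η : TangentSpace (𝓡 n) x) :
    g.val (A.base x) (mfderiv (𝓡 n) (𝓡 (n + 2)) A.base x ξ)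
      (mfderiv (𝓡 n) (𝓡 (n + 2)) A.base x η) = (refPt c x).form ξ η := by
  rw [← A.mfderiv_ι_refPt, ← A.mfderiv_ι_refPt]
  refine (hg.restrict _ _ _).trans ?_
  exact congrArg₂ (fun ξ η ↦ (refPt c x).form ξ η) (mfderiv_proj_refPt x ξ) (mfderiv_proj_refPt x η)

theorem IsAmbientMetric.tractorMetric_canonicalMap (hg : A.IsAmbientMetric g) (x : M)
    (f f' : Density c (-1) x) :
    (A.tractorMetric g).val x (A.canonicalMap x f) (A.canonicalMap x f') = 0 := by
  rw [tractorMetric_apply, refLinearEquiv_canonicalMap, refLinearEquiv_canonicalMap, map_smul,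
    map_smul, smul_apply, hg.val_generator_self, smul_zero, smul_zero]

/-! ### The tractor connection -/

variable {D : CovariantDerivative (𝓡 (n + 2)) (Eu (n + 2)) (TangentSpace (𝓡 (n + 2)) : N → Type _)}

variable (A D) in
/-- The connection on the tractor bundle induced by a connection on the ambient manifold. -/
def tractorConnection : CovariantDerivative (𝓡 n) (Eu (n + 2)) A.Tractor :=
  A.isPullback.connection D

/-- Along `𝒬`, the covariant derivative of the generator is the identity: the symmetric part comes from
`ℒ_X g = 2 g`, the skew part vanishes with `dα`. -/
theorem IsAmbientMetric.covariantDerivative_generator [T2Space N] (hg : A.IsAmbientMetric g)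
    (hD : IsLeviCivita g D) (hα : A.ExtDerivVanishesAlong (fun y ↦ g.val y (generator y)))
    (u : RayBundle c) (v : TangentSpace (𝓡 (n + 2)) (A.ι u)) : D generator (A.ι u) v = v :=
  A.smoothAction.covariantDerivative_generator hD hg.homogeneous (hα u) v

/-- The Levi-Civita connection of an ambient metric descends to the tractor bundle. A tangent vector of
`𝒬` at `s g_x`, with `g` the reference metric, is the sum of a multiple of `X`, in whose direction
a homogeneous field `V` of degree `-1` is parallel, and of `Tρˢ` of a vector tangent to the section
`x ↦ g_x`. The derivative of `V` in the second direction is carried to the reference section by the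
invariance of the connection under the dilation `ρˢ`. -/
theorem IsAmbientMetric.descends [T2Space N] (hg : A.IsAmbientMetric g)
    (hD : IsLeviCivita g D) (hα : A.ExtDerivVanishesAlong (fun y ↦ g.val y (generator y))) :
    A.Descends D (A.tractorConnection D) := by
  intro u V σ hV _ hσ ζ
  have hN := A.smoothAction
  have hcongr : ∀ y y' : N, y = y' → (V y : Eu (n + 2)) = V y' := by rintro y _ rfl; rfl
  -- `V` is homogeneous along the orbit of `ι u`, hence parallel along it
  have hhom : D V (A.ι u) (generator (A.ι u)) = 0 := by
    refine hN.covariantDerivative_eq_zero_of_homogeneous hD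
      (hg.covariantDerivative_generator hD hα u) hV ?_
    have hc : Filter.Tendsto (fun t : ℝ ↦ expPos t • u) (𝓝 0) (𝓝 u) := by
      have := (continuous_flow u).tendsto 0
      rwa [expPos_zero, one_smul] at this
    filter_upwards [hc hσ] with t ht
    have h1 : V (A.ι (expPos t • u)) = A.scale (expPos t) u (V (A.ι u)) := by
      apply (A.cls (expPos t • u)).injective
      exact ht.trans (hσ.self_of_nhds.symm.trans (A.cls_scale _ _ _).symm)
    exact (hcongr _ _ (A.ι_smul _ _).symm).trans h1
  obtain ⟨s, x, rfl⟩ : ∃ s x, s • refPt c x = u := ⟨_, _, smul_refPt u⟩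
  set ξ : TangentSpace (𝓡 n) x := mfderiv (model n) (𝓡 n) proj (s • refPt c x) ζ
  -- the vector field which represents `σ` near the point given by the reference metric
  have hV' : DiffSectionAt (𝓡 (n + 2)) (Eu (n + 2)) V (s • A.base x) := by
    rw [← A.ι_smul]; exact hV
  let V₀ := VectorField.mpullback (𝓡 (n + 2)) (𝓡 (n + 2)) (fun y : N ↦ s • y) V
  have hV₀ : DiffSectionAt (𝓡 (n + 2)) (Eu (n + 2)) V₀ (A.base x) :=
    MDifferentiableAt.mpullback_vectorField (n := ∞) hV' (hN.contMDiff_smul s).contMDiffAt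
      (hN.isInvertible_dilationDeriv s _) two_le_infty
  have hVV₀ : ∀ y, dilationDeriv s y (V₀ y) = V (s • y) := fun y ↦ by
    obtain ⟨e, he⟩ := hN.isInvertible_dilationDeriv s y
    rw [dilationDeriv]
    simp only [V₀, VectorField.mpullback_apply]
    rw [← he, ContinuousLinearMap.inverse_equiv]
    exact e.apply_symm_apply _
  let W : ∀ y : N, TangentSpace (𝓡 (n + 2)) y := (s : ℝ) • V₀
  have hW : DiffSectionAt (𝓡 (n + 2)) (Eu (n + 2)) W (A.base x) := by
    have hy := mem_triv (F := Eu (n + 2)) (V := (TangentSpace (𝓡 (n + 2)) : N → Type _)) (A.base x)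
    refine (diffSectionAt_iff_coord hy).2 ?_
    simp only [W, Pi.smul_apply, map_smul]
    exact ((diffSectionAt_iff_coord hy).1 hV₀).const_smul (s : ℝ)
  have hWσ : ∀ᶠ x' in 𝓝 x, A.refLinearEquiv x' (σ x') = W (A.base x') := by
    have hc : Filter.Tendsto (fun x' ↦ s • refPt c x') (𝓝 x) (𝓝 (s • refPt c x)) := by
      have h1 : (fun x' ↦ s • refPt c x') = fun x' ↦ ofProd c (x', Real.log s + 0) := by
        funext x'
        conv_lhs => rw [← expPos_log s]
        exact smul_ofProd (Real.log s) x' 0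
      have hc : Continuous fun x' ↦ s • refPt c x' := by
        rw [h1]
        exact (continuous_ofProd (c := c)).comp (continuous_id.prodMk continuous_const)
      exact hc.tendsto x
    filter_upwards [hc hσ] with x' hx'
    have h1 : (A.scale s (refPt c x') (W (A.base x')) : Eu (n + 2)) = V (A.ι (s • refPt c x')) := by
      refine Eq.trans ?_ (hcongr (s • A.base x') (A.ι (s • refPt c x')) (A.ι_smul s (refPt c x')).symm)
      refine (map_smul (A.scale s (refPt c x')) (s : ℝ) (V₀ (A.base x'))).trans ?_
      refine (smul_inv_smul₀ s.2.ne' _).trans ?_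
      exact hVV₀ (A.base x')
    have h3 : σ x' = A.cls (refPt c x') (W (A.base x')) :=
      hx'.symm.trans ((congrArg (A.cls (s • refPt c x')) h1.symm).trans (A.cls_scale s _ _))
    rw [h3, A.refLinearEquiv_cls]
  have hbase := A.isPullback.connection_apply D (A.mdifferentiableAt_base x) hW hWσ ξ
  let w : TangentSpace (𝓡 (n + 2)) (A.base x) := mfderiv (𝓡 n) (𝓡 (n + 2)) A.base x ξ
  have hDW : D W (A.base x) w = (s : ℝ) • D V₀ (A.base x) w := by
    have h := D.isCovariantDerivativeOn.smul_const (s : ℝ) hV₀ (Set.mem_univ _)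
    exact congr($h w)
  have hDV : dilationDeriv s (A.base x) (D V₀ (A.base x) w) =
      D V (s • A.base x) (dilationDeriv s (A.base x) w) :=
    hD.mpullback_homothety (hN.contMDiff_smul s) (hN.isInvertible_dilationDeriv s)
      (hg.homogeneous s) hV' w
  have hls : expPos (s • refPt c x).logScale = s := by
    conv_lhs => rw [← expPos_log s, logScale_smul, logScale_refPt, add_zero, expPos_log]
  have hι := A.mfderiv_ι (s • refPt c x) ζ
  rw [hls] at hι
  have hcast : ∀ (y y' : N) (v : Eu (n + 2)), y = y' → (D V y v : Eu (n + 2)) = D V y' v := by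
    rintro y _ v rfl; rfl
  have key : (D V (A.ι (s • refPt c x)) (mfderiv (model n) (𝓡 (n + 2)) A.ι (s • refPt c x) ζ) :
      Eu (n + 2)) = A.scale s (refPt c x) (D W (A.base x) w) := by
    refine (congrArg (D V (A.ι (s • refPt c x))) hι).trans ?_
    refine (map_add (D V (A.ι (s • refPt c x))) _ _).trans ?_
    have h1 : D V (A.ι (s • refPt c x)) (mvfderiv (model n) logScale (s • refPt c x) ζ •
        generator (A.ι (s • refPt c x))) = 0 := by rw [map_smul, hhom, smul_zero]
    refine (congrArg (· + (D V (A.ι (s • refPt c x)) (dilationCoord s (A.base x) w) : Eu (n + 2)))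
      h1).trans ?_
    refine (zero_add _).trans ?_
    refine (hcast _ (s • A.base x) (dilationCoord s (A.base x) w) (A.ι_smul s _)).trans ?_
    refine Eq.trans hDV.symm ?_
    refine Eq.trans ?_ (congrArg (A.scale s (refPt c x)) hDW).symm
    refine Eq.trans ?_ (map_smul (A.scale s (refPt c x)) (s : ℝ) (D V₀ (A.base x) w)).symm
    exact (smul_inv_smul₀ s.2.ne' _).symm
  refine (congrArg (A.cls (s • refPt c x)) key).trans ?_
  refine (A.cls_scale s (refPt c x) _).trans ?_
  exact (congrArg (A.cls (refPt c x)) hbase.symm).trans (A.cls_refLinearEquiv x _)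

/-- The covariant derivative of a section of the canonical line subbundle, by the Leibniz rule and
`∇X = id`: at the points of `𝒬` given by the reference metric, `∇_ξ j(f) = f Tι ξ + (ξ · f) X`. -/
theorem IsAmbientMetric.tractorConnection_canonicalMap [T2Space N] (hg : A.IsAmbientMetric g)
    (hD : IsLeviCivita g D) (hα : A.ExtDerivVanishesAlong (fun y ↦ g.val y (generator y)))
    {f : ∀ x, Density c (-1) x} (hf : IsSmoothDensity f) (x : M) (ξ : TangentSpace (𝓡 n) x) :
    A.refLinearEquiv x (A.tractorConnection D (fun x ↦ A.canonicalMap x (f x)) x ξ) =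
      Density.eval (refPt c x) (f x) • mfderiv (𝓡 n) (𝓡 (n + 2)) A.base x ξ +
        mvfderiv (𝓡 n) (fun x ↦ Density.eval (refPt c x) (f x)) x ξ • generator (A.base x) := by
  let a : M → ℝ := fun x ↦ Density.eval (refPt c x) (f x)
  have ha : ContMDiff (𝓡 n) 𝓘(ℝ, ℝ) ∞ a := hf.comp (contMDiff_refPt c)
  let σ : ∀ x, A.Tractor x := fun x ↦ A.canonicalMap x (refDensity c x 1)
  have hσ : SmoothSection (𝓡 n) (Eu (n + 2)) σ :=
    A.smoothSection_canonicalMap isSmoothDensity_refDensity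
  have heσ : ∀ x, A.refLinearEquiv x (σ x) = generator (A.base x) := fun x ↦ by
    rw [refLinearEquiv_canonicalMap, eval_refDensity_refPt, one_smul]
  have h1 : (fun x ↦ A.canonicalMap x (f x)) = a • σ := by
    funext x
    apply (A.refLinearEquiv x).injective
    rw [refLinearEquiv_canonicalMap, Pi.smul_apply', map_smul, heσ]
  have h2 := A.isPullback.connection_apply D (A.mdifferentiableAt_base x)
    (A.smoothAction.contMDiff_generator.contMDiffAt.mdifferentiableAt (by simp))
    (Filter.Eventually.of_forall heσ) ξ
  rw [hg.covariantDerivative_generator hD hα] at h2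
  rw [h1, tractorConnection, (A.isPullback.connection D).isCovariantDerivativeOn.leibniz
    (hσ.contMDiffAt.mdifferentiableAt (by simp)) (ha.contMDiffAt.mdifferentiableAt (by simp))
    (Set.mem_univ x)]
  simp only [add_apply, smul_apply, ContinuousLinearMap.smulRight_apply, map_add, map_smul, h2,
    heσ]
  rfl

/-- The tractor connection makes `𝒯` a standard tractor bundle. Non-degeneracy and the underlying
conformal structure are read off from `∇_ξ j(f) = f Tι ξ + (ξ · f) X`, since `X` is null and
orthogonal to the tangent spaces of `𝒬`. -/
theorem IsAmbientMetric.isStandardTractorBundle [T2Space N] (hg : A.IsAmbientMetric g)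
    (hD : IsLeviCivita g D) (hα : A.ExtDerivVanishesAlong (fun y ↦ g.val y (generator y))) :
    IsStandardTractorBundle c (A.tractorMetric g) A.canonicalMap (A.tractorConnection D) where
  rank := by simp
  hasSignature := A.isPullback.metric_hasSignature A.contMDiff_base hg.hasSignature
  smooth_j f hf := A.smoothSection_canonicalMap hf
  injective_j := A.injective_canonicalMap
  null := hg.tractorMetric_canonicalMap
  smooth := A.isPullback.contMDiff_connection A.contMDiff_base hD.contMDiffAt_coordField
  preserves := A.isPullback.preservesMetric A.contMDiff_base hD.preserves
  nondegenerate x ξ hξ := by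
    refine ⟨fun x ↦ A.canonicalMap x (refDensity c x 1),
      A.smoothSection_canonicalMap isSmoothDensity_refDensity, fun y ↦ ⟨_, rfl⟩, ?_⟩
    rintro ⟨f, hf⟩
    have h1 := hg.tractorConnection_canonicalMap hD hα isSmoothDensity_refDensity x ξ
    rw [← hf, refLinearEquiv_canonicalMap, eval_refDensity_refPt, one_smul, ← sub_eq_iff_eq_add,
      ← sub_smul] at h1
    exact hξ (A.eq_zero_of_mfderiv_base_eq h1.symm)
  conformal f f' hf hf' u ξ η := by
    obtain ⟨s, x, rfl⟩ : ∃ s x, s • refPt c x = u := ⟨_, _, smul_refPt u⟩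
    revert ξ η
    change ∀ ξ η : TangentSpace (𝓡 n) x, _
    intro ξ η
    have h1 := hg.tractorConnection_canonicalMap hD hα hf x ξ
    have h2 := hg.tractorConnection_canonicalMap hD hα hf' x η
    have e1 : Density.eval (s • refPt c x) (f x) = (s : ℝ)⁻¹ * Density.eval (refPt c x) (f x) :=
      eval_smul s (u := refPt c x) rfl (f x)
    have e2 : Density.eval (s • refPt c x) (f' x) = (s : ℝ)⁻¹ * Density.eval (refPt c x) (f' x) :=
      eval_smul s (u := refPt c x) rfl (f' x)
    have e3 : (s • refPt c x).form ξ η = (s : ℝ) ^ 2 * (refPt c x).form ξ η := by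
      rw [form_smul]; rfl
    refine (A.tractorMetric_apply x _ _).trans ?_
    refine (congrArg₂ (fun v w ↦ g.val (A.base x) v w) h1 h2).trans ?_
    refine Eq.trans ?_ (congrArg₂ (· * ·) (congrArg₂ (· * ·) e1 e2) e3).symm
    have h3 := hg.val_generator_base x ξ
    rw [g.symm] at h3
    simp only [map_add, map_smul, add_apply, smul_apply, hg.val_generator_base x, h3,
      hg.val_generator_self, hg.val_base, smul_eq_mul, mul_zero, add_zero]
    have := s.2.ne'
    field_simp

end AmbientManifold

end Tractors

end ConformalTractor

end

theorem proposition2p4 {n p q : ℕ}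
    {M : Type*} [TopologicalSpace M] [T2Space M] [SecondCountableTopology M]
    [ChartedSpace (EuclideanSpace ℝ (Fin n)) M] [IsManifold (𝓡 n) ∞ M]
    (c : ConformalStructure n p q M)
    {N : Type*} [TopologicalSpace N] [T2Space N] [SecondCountableTopology N]
    [ChartedSpace (EuclideanSpace ℝ (Fin (n + 2))) N] [IsManifold (𝓡 (n + 2)) ∞ N]
    [MulAction {s : ℝ // 0 < s} N] (A : AmbientManifold c N)
    (g : PseudoMetric (n + 2) N) (hg : A.IsAmbientMetric g) :
    -- smooth sections of `𝒯` are the smooth fields along `𝒬` which are homogeneous of degree `-1`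
    (∀ σ : ∀ x : M, A.Tractor x,
      SmoothSection (𝓡 n) (EuclideanSpace ℝ (Fin (n + 2))) σ ↔
        ContMDiff (RayBundle.model n) (𝓡 (n + 2)).tangent ∞
          (fun u : RayBundle c ↦
            (⟨A.ι u, (A.cls u).symm (σ u.proj)⟩ : TangentBundle (𝓡 (n + 2)) N))) ∧
    -- the ambient metric descends to a bundle metric on `𝒯`
    ∃ h : BundleMetric (𝓡 n) (EuclideanSpace ℝ (Fin (n + 2))) A.Tractor,
      (∀ (u : RayBundle c) (ξ η : TangentSpace (𝓡 (n + 2)) (A.ι u)),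
        h.val u.proj (A.cls u ξ) (A.cls u η) = g.val (A.ι u) ξ η) ∧
      h.HasSignature (p + 1) (q + 1) ∧
      -- the vertical bundle of `𝒬` induces a line subbundle of `𝒯`, isomorphic to `ℰ[-1]`
      ∃ j : ∀ x, Density c (-1) x →ₗ[ℝ] A.Tractor x,
        (∀ (u : RayBundle c) (f : Density c (-1) u.proj),
          j u.proj f = A.cls u (Density.eval u f • generator (A.ι u))) ∧
        (∀ (u : RayBundle c) (z : A.Tractor u.proj), z ∈ LinearMap.range (j u.proj) ↔
          ∃ v : TangentSpace (RayBundle.model n) u,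
            mfderiv (RayBundle.model n) (𝓡 n) RayBundle.proj u v = 0 ∧
            A.cls u (mfderiv (RayBundle.model n) (𝓡 (n + 2)) A.ι u v) = z) ∧
        -- if `dα` vanishes along `𝒬`, then the Levi-Civita connection descends to a tractor
        -- connection, which makes `𝒯` a standard tractor bundle
        (A.ExtDerivVanishesAlong (fun y ↦ g.val y (generator y)) →
          ∀ D : CovariantDerivative (𝓡 (n + 2)) (EuclideanSpace ℝ (Fin (n + 2)))
              (TangentSpace (𝓡 (n + 2)) : N → Type _),
            IsLeviCivita g D →
            ∃ nabla : CovariantDerivative (𝓡 n) (EuclideanSpace ℝ (Fin (n + 2))) A.Tractor,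
              A.Descends D nabla ∧ IsStandardTractorBundle c h j nabla) := by
  exact ⟨A.smoothSection_iff, A.tractorMetric g, hg.tractorMetric_cls,
    A.isPullback.metric_hasSignature A.contMDiff_base hg.hasSignature, A.canonicalMap,
    A.canonicalMap_apply, A.mem_range_canonicalMap, fun hα D hD ↦
      ⟨A.tractorConnection D, hg.descends hD hα, hg.isStandardTractorBundle hD hα⟩⟩
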